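/- Write $\mathsf{tower}(k,0)=k$ and $\mathsf{tower}(k,h+1)=2^{\mathsf{tower}(k,h)}$. Let $\Phi=Q_1x_1\cdots Q_nx_n.\,C_1\wedge\dots\wedge C_m$ range over PCNF formulas with $\{x_1,\dots,x_n\}=\mathsf{var}(C_1\wedge\dots\wedge C_m)$; let $|\Phi|$ be its size, $q$ the number of its quantifier blocks (maximal runs of equal quantifiers in the prefix), and $k$ its pathwidth, i.e. the pathwidth of the primal graph of its matrix (read as $0$ if $n=0$). For a variable order $\pi$, all OBDDs below are minimized $\pi$-OBDDs, and the size of an OBDD is its number of nodes. QBDD with variable order $\pi$ works as follows. Each clause is represented as an OBDD and put in the bucket $S_i$ of its rightmost variable $x_i$ with respect to the prefix (clauses without variables are kept in a bucket of constants). For $i=n,n-1,\dots,1$, QBDD computes the OBDD of the conjunction of all OBDDs in $S_i$, then the OBDD obtained from it by applying $Q_ix_i$, and puts the latter in the bucket of the rightmost variable occurring in it (or in the bucket of constants). At the end it outputs the conjunction of the constants. 1. There are a program $P$ (a first-order functional program on binary trees, with unit cost per evaluation step; numbers are encoded in binary) and a polynomial $p$ such that, for every $\Phi$ and every variable order $\pi$,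 the program $P$ on input $(\Phi,\pi)$ carries out QBDD with order $\pi$, that is, it halts and outputs all OBDDs computed in the run (the OBDDs of the clauses, the bucket conjunctions, the results of the eliminations, and the final OBDD), and the final OBDD is the constant $1$ if $\Phi$ is true and the constant $0$ if $\Phi$ is false. Moreover, for every $\Phi$ there is a variable order $\pi$ for which $P$ does so in at most $\mathsf{tower}(k,q+1)\cdot p(|\Phi|)$ steps. 2. There is a polynomial $p$ such that every false $\Phi$ has an $\mathrm{OBDD}(\wedge,\exists,\forall)$-refutation of size at most $\mathsf{tower}(k,q+1)\cdot p(|\Phi|)$. Here an $\mathrm{OBDD}(\wedge,\exists,\forall)$-refutation is a sequence of OBDDs, all with the same variable order, that begins with the OBDDs of $C_1,\dots,C_m$, in which every further line represents $L\wedge L'$ for earlier lines $L,L'$, or $\exists x.L$ for an earlier line $L$ and a variable $x$ occurring in $L$, or $L[u/c]$ for an earlier line $L$, a universal variable $u$ that is rightmost among the variables occurring in $L$, and $c\in\{0,1\}$, and whose last line represents the constant $0$; its size is the sum of the sizes of its lines. -/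

import Mathlib

/-! ### Quantified Boolean formulas in prenex CNF -/

inductive Quantifier where
  | ex
  | all
  deriving DecidableEq

/-- An assignment of the variables `x_0, …, x_{n-1}`. -/
abbrev Assignment (n : ℕ) := Fin n → Bool

/-- The literal `(x, true)` is `x`, the literal `(x, false)` is `¬ x`. -/
abbrev Literal (n : ℕ) := Fin n × Bool

/-- A clause is a disjunction of literals. -/
abbrev Clause (n : ℕ) := List (Literal n)

namespace Clause

/-- The Boolean function of a clause. -/
def eval {n : ℕ} (C : Clause n) (a : Assignment n) : Bool :=
  C.any fun l => a l.1 == l.2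

/-- The set of variables of a clause. -/
def vars {n : ℕ} (C : Clause n) : Finset (Fin n) :=
  (C.map Prod.fst).toFinset

end Clause

/-- A PCNF formula `Q_0 x_0 … Q_{n-1} x_{n-1}. C_1 ∧ … ∧ C_m`. Variables are named by their
position in the prefix, and the prefix quantifies exactly the variables of the matrix. -/
structure PCNF (n : ℕ) where
  quant : Fin n → Quantifier
  clauses : List (Clause n)
  occurs : ∀ x : Fin n, ∃ C ∈ clauses, x ∈ C.vars

namespace PCNF

variable {n : ℕ}

/-- `a` satisfies the matrix. -/
def Satisfies (Φ : PCNF n) (a : Assignment n) : Prop :=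
  ∀ C ∈ Φ.clauses, C.eval a = true

/-- A universal strategy: the function of a universal variable `u` depends only on the variables
left of `u`. -/
def IsUniversalStrategy (Φ : PCNF n) (f : Fin n → Assignment n → Bool) : Prop :=
  ∀ u, Φ.quant u = Quantifier.all →
    ∀ a b : Assignment n, (∀ y < u, a y = b y) → f u a = f u b

/-- A universal winning strategy: every assignment whose universal variables are set according
to the strategy falsifies the matrix. -/
def IsUniversalWinningStrategy (Φ : PCNF n) (f : Fin n → Assignment n → Bool) : Prop :=
  Φ.IsUniversalStrategy f ∧
    ∀ a : Assignment n, (∀ u, Φ.quant u = Quantifier.all → a u = f u a) → ¬ Φ.Satisfies a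

def IsFalse (Φ : PCNF n) : Prop := ∃ f, Φ.IsUniversalWinningStrategy f

def IsTrue (Φ : PCNF n) : Prop := ¬ Φ.IsFalse

/-- The number of quantifier blocks, i.e. of maximal runs of equal quantifiers in the prefix;
the set consists of the first positions of the blocks. -/
def numBlocks (Φ : PCNF n) : ℕ :=
  (Finset.univ.filter fun i : Fin n =>
    ∀ j : Fin n, (j : ℕ) + 1 = i → Φ.quant j ≠ Φ.quant i).card

/-- The size `|Φ|` of a formula. -/
def size (Φ : PCNF n) : ℕ := n + (Φ.clauses.map fun C => C.length + 1).sum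

/-- The primal graph of the matrix. -/
def primalGraph (Φ : PCNF n) : SimpleGraph (Fin n) where
  Adj x y := x ≠ y ∧ ∃ C ∈ Φ.clauses, x ∈ C.vars ∧ y ∈ C.vars
  symm := ⟨fun _ _ h => ⟨h.1.symm, h.2.imp fun _ hC => ⟨hC.1, hC.2.2, hC.2.1⟩⟩⟩
  loopless := ⟨fun _ h => h.1 rfl⟩

end PCNF

/-! ### Pathwidth -/

structure PathDecomposition {V : Type*} (G : SimpleGraph V) where
  length : ℕ
  bag : Fin length → Finset V
  vertex_mem : ∀ v, ∃ i, v ∈ bag i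
  edge_mem : ∀ v w, G.Adj v w → ∃ i, v ∈ bag i ∧ w ∈ bag i
  interval : ∀ v i j k, i ≤ k → k ≤ j → v ∈ bag i → v ∈ bag j → v ∈ bag k

/-- The largest size of a bag, minus one (and `0` if there is no nonempty bag). -/
def PathDecomposition.width {V : Type*} {G : SimpleGraph V} (D : PathDecomposition G) : ℕ :=
  (Finset.univ.sup fun i => (D.bag i).card) - 1

/-- The minimum width of a path decomposition. -/
noncomputable def pathwidth {V : Type*} (G : SimpleGraph V) : ℕ :=
  sInf {w | ∃ D : PathDecomposition G, D.width = w}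

noncomputable def PCNF.pathwidth {n : ℕ} (Φ : PCNF n) : ℕ := _root_.pathwidth Φ.primalGraph

/-- `tower k h = 2 ^ (2 ^ (… ^ (2 ^ k)))` with `h` twos. -/
def tower (k : ℕ) : ℕ → ℕ
  | 0 => k
  | h + 1 => 2 ^ tower k h

/-! ### OBDDs -/

/-- A branching program on `x_0, …, x_{n-1}`: a reference `Sum.inl b` is the `b`-sink, a
reference `Sum.inr v` is the inner node `v`; inner nodes carry a variable and have a `false`-child
and a `true`-child. -/
structure OBDD (n : ℕ) where
  numNodes : ℕ
  label : Fin numNodes → Fin n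
  child : Fin numNodes → Bool → Bool ⊕ Fin numNodes
  root : Bool ⊕ Fin numNodes

/-- A variable order; `π x` is the position of the variable `x`. -/
abbrev VarOrder (n : ℕ) := Equiv.Perm (Fin n)

namespace OBDD

variable {n : ℕ}

/-- The number of nodes, the two sinks included. -/
def size (B : OBDD n) : ℕ := B.numNodes + 2

/-- Along every edge between inner nodes the variables strictly increase in the order `π`
(in particular the graph is acyclic). -/
def IsOrdered (π : VarOrder n) (B : OBDD n) : Prop :=
  ∀ v c w, B.child v c = Sum.inr w → π (B.label v) < π (B.label w)

/-- One step of the path given by the assignment `a`; sinks are never left. -/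
def step (B : OBDD n) (a : Assignment n) : Bool ⊕ Fin B.numNodes → Bool ⊕ Fin B.numNodes
  | Sum.inl b => Sum.inl b
  | Sum.inr v => B.child v (a (B.label v))

/-- The value `B(a)`. In an ordered `B` every path has at most `n` inner nodes, so that `n` steps
lead from the root to a sink. -/
def eval (B : OBDD n) (a : Assignment n) : Bool :=
  decide ((B.step a)^[n] B.root = Sum.inl true)

/-- `B` is a `π`-OBDD computing `f`. -/
def Computes (π : VarOrder n) (B : OBDD n) (f : Assignment n → Bool) : Prop :=
  B.IsOrdered π ∧ ∀ a, B.eval a = f a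

/-- `B` is the minimized `π`-OBDD of `f`. (Minimality excludes nodes that are not reachable from
the root.) -/
def Represents (π : VarOrder n) (B : OBDD n) (f : Assignment n → Bool) : Prop :=
  B.Computes π f ∧ ∀ B' : OBDD n, B'.Computes π f → B.size ≤ B'.size

/-- The variables that occur as labels. -/
def vars (B : OBDD n) : Finset (Fin n) := Finset.univ.image B.label

end OBDD

/-! ### Operations on Boolean functions -/

/-- The function `f[x/c]`. -/
def restrictFun {n : ℕ} (f : Assignment n → Bool) (x : Fin n) (c : Bool) : Assignment n → Bool :=
  fun a => f (Function.update a x c)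

/-- The function `∃ x. f` or `∀ x. f`. -/
def quantifyFun {n : ℕ} (Q : Quantifier) (x : Fin n) (f : Assignment n → Bool) :
    Assignment n → Bool :=
  match Q with
  | Quantifier.ex => fun a => restrictFun f x false a || restrictFun f x true a
  | Quantifier.all => fun a => restrictFun f x false a && restrictFun f x true a

/-- The conjunction of the functions computed by a list of OBDDs. -/
def conjFun {n : ℕ} (L : List (OBDD n)) : Assignment n → Bool :=
  fun a => L.all fun B => B.eval a

/-! ### The refutation system with conjunction, projection and universal reduction -/

/-- `B` is derived from the lines in `L` by conjunction, projection or universal reduction. -/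
inductive OBDDRule {n : ℕ} (Φ : PCNF n) (π : VarOrder n) (L : List (OBDD n)) : OBDD n → Prop
  | conjunction (B B₁ B₂ : OBDD n) : B₁ ∈ L → B₂ ∈ L →
      B.Represents π (conjFun [B₁, B₂]) → OBDDRule Φ π L B
  | projection (B B₁ : OBDD n) (x : Fin n) : B₁ ∈ L → x ∈ B₁.vars →
      B.Represents π (quantifyFun Quantifier.ex x B₁.eval) → OBDDRule Φ π L B
  | universalReduction (B B₁ : OBDD n) (u : Fin n) (c : Bool) : B₁ ∈ L →
      Φ.quant u = Quantifier.all → B₁.vars.max = (u : WithBot (Fin n)) →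
      B.Represents π (restrictFun B₁.eval u c) → OBDDRule Φ π L B

/-- An `OBDD(∧, ∃, ∀)`-derivation from `Φ` in which all lines use the order `π`: it begins with
the OBDDs of the clauses of the matrix. -/
inductive OBDDDerivation {n : ℕ} (Φ : PCNF n) (π : VarOrder n) : List (OBDD n) → Prop
  | start (L : List (OBDD n)) :
      List.Forall₂ (fun C B => OBDD.Represents π B (Clause.eval C)) Φ.clauses L →
      OBDDDerivation Φ π L
  | step (L : List (OBDD n)) (B : OBDD n) :
      OBDDDerivation Φ π L → OBDDRule Φ π L B → OBDDDerivation Φ π (L ++ [B])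

/-- A derivation whose last line represents `0`. -/
def OBDDRefutation {n : ℕ} (Φ : PCNF n) (π : VarOrder n) (L : List (OBDD n)) : Prop :=
  OBDDDerivation Φ π L ∧ ∃ B, L.getLast? = some B ∧ B.Represents π fun _ => false

/-- The size of a derivation is the sum of the sizes of its lines. -/
def derivationSize {n : ℕ} (L : List (OBDD n)) : ℕ := (L.map OBDD.size).sum

/-! ### The procedure QBDD -/

/-- The OBDDs computed by a run of QBDD: those of the clauses, for every variable `x_i` the
conjunction of the bucket `S_i` and the OBDD obtained from it by eliminating `x_i`, and the final
constant OBDD. -/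
structure QBDDTrace (n : ℕ) where
  clause : List (OBDD n)
  conj : Fin n → OBDD n
  elim : Fin n → OBDD n
  result : OBDD n

namespace QBDDTrace

variable {n : ℕ}

/-- The clauses whose rightmost variable is `i`, as OBDDs (for `i = ⊥`: the clauses without
variables). -/
def initialBucket (R : QBDDTrace n) (Φ : PCNF n) (i : WithBot (Fin n)) : List (OBDD n) :=
  ((Φ.clauses.zip R.clause).filter fun p => decide (p.1.vars.max = i)).map Prod.snd

/-- The OBDDs that result from the eliminations and whose rightmost variable is `i` (for `i = ⊥`:
the constant ones). -/
def derivedBucket (R : QBDDTrace n) (i : WithBot (Fin n)) : List (OBDD n) :=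
  ((List.finRange n).filter fun j : Fin n =>
    decide (i < (j : WithBot (Fin n)) ∧ (R.elim j).vars.max = i)).map R.elim

/-- The bucket `S_i` when the variables right of `x_i` have been eliminated (for `i = ⊥`: the
constant OBDDs when all variables have been eliminated). -/
def bucket (R : QBDDTrace n) (Φ : PCNF n) (i : WithBot (Fin n)) : List (OBDD n) :=
  R.initialBucket Φ i ++ R.derivedBucket i

/-- `R` is the run of QBDD on `Φ` with the variable order `π` for the OBDDs: variables are
eliminated from the inside out by conjoining the OBDDs in the bucket of `x_i` and quantifying
`x_i`; the resulting OBDD goes to the bucket of its rightmost variable. -/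
def IsRun (R : QBDDTrace n) (Φ : PCNF n) (π : VarOrder n) : Prop :=
  List.Forall₂ (fun C B => OBDD.Represents π B (Clause.eval C)) Φ.clauses R.clause ∧
  (∀ i : Fin n, (R.conj i).Represents π (conjFun (R.bucket Φ i))) ∧
  (∀ i : Fin n, (R.elim i).Represents π (quantifyFun (Φ.quant i) i (R.conj i).eval)) ∧
  R.result.Represents π (conjFun (R.bucket Φ ⊥))

end QBDDTrace

/-! ### A machine model with a step count

First-order functional programs on binary trees (pure first-order LISP without symbols). Every
evaluation step costs one unit; each is a constant number of pointer operations. -/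

inductive Dat where
  | nil
  | cons (l r : Dat)

inductive Expr where
  | var (i : ℕ)
  | nil
  | cons (e₁ e₂ : Expr)
  /-- If `e` evaluates to `nil`, go on with `e₁`; if it evaluates to `cons l r`, go on with `e₂`
  where `l` and `r` are bound as the variables `0` and `1` and the old ones are shifted by `2`. -/
  | cases (e e₁ e₂ : Expr)
  /-- Bind the value of `e₁` as the variable `0` in `e₂`, and shift the old variables by `1`. -/
  | bind (e₁ e₂ : Expr)
  /-- Call the function with index `f` on the value of `e`. -/
  | call (f : ℕ) (e : Expr)

/-- A program is a list of function bodies; the argument of a function is its variable `0`. The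
program starts with the function `0`. -/
abbrev Program := List Expr

/-- `Eval P env e v t`: in the environment `env`, the expression `e` evaluates to `v` in `t`
steps. -/
inductive Eval (P : Program) : List Dat → Expr → Dat → ℕ → Prop
  | var (env : List Dat) (i : ℕ) (v : Dat) : env[i]? = some v → Eval P env (Expr.var i) v 1
  | nil (env : List Dat) : Eval P env Expr.nil Dat.nil 1
  | cons (env : List Dat) (e₁ e₂ : Expr) (v₁ v₂ : Dat) (t₁ t₂ : ℕ) :
      Eval P env e₁ v₁ t₁ → Eval P env e₂ v₂ t₂ →
      Eval P env (Expr.cons e₁ e₂) (Dat.cons v₁ v₂) (t₁ + t₂ + 1)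
  | casesNil (env : List Dat) (e e₁ e₂ : Expr) (v : Dat) (t t₁ : ℕ) :
      Eval P env e Dat.nil t → Eval P env e₁ v t₁ →
      Eval P env (Expr.cases e e₁ e₂) v (t + t₁ + 1)
  | casesCons (env : List Dat) (e e₁ e₂ : Expr) (l r v : Dat) (t t₂ : ℕ) :
      Eval P env e (Dat.cons l r) t → Eval P (l :: r :: env) e₂ v t₂ →
      Eval P env (Expr.cases e e₁ e₂) v (t + t₂ + 1)
  | bind (env : List Dat) (e₁ e₂ : Expr) (v₁ v : Dat) (t₁ t₂ : ℕ) :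
      Eval P env e₁ v₁ t₁ → Eval P (v₁ :: env) e₂ v t₂ →
      Eval P env (Expr.bind e₁ e₂) v (t₁ + t₂ + 1)
  | call (env : List Dat) (f : ℕ) (e body : Expr) (w v : Dat) (t t' : ℕ) :
      Eval P env e w t → P[f]? = some body → Eval P [w] body v t' →
      Eval P env (Expr.call f e) v (t + t' + 1)

/-- On the given input the program halts with the given output after exactly `t` steps. -/
def Program.Runs (P : Program) (input output : Dat) (t : ℕ) : Prop :=
  ∃ main, P[0]? = some main ∧ Eval P [input] main output t

/-! ### Encodings -/

def encList {α : Type*} (f : α → Dat) : List α → Dat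
  | [] => Dat.nil
  | x :: l => Dat.cons (f x) (encList f l)

def encBool : Bool → Dat
  | false => Dat.nil
  | true => Dat.cons Dat.nil Dat.nil

/-- Numbers in binary, least significant bit first. -/
def encNat (m : ℕ) : Dat := encList encBool m.bits

def encFin {n : ℕ} (x : Fin n) : Dat := encNat x

def encQuantifier : Quantifier → Dat
  | Quantifier.ex => encBool false
  | Quantifier.all => encBool true

def encLiteral {n : ℕ} (l : Literal n) : Dat := Dat.cons (encFin l.1) (encBool l.2)

def encClause {n : ℕ} (C : Clause n) : Dat := encList encLiteral C

def encPCNF {n : ℕ} (Φ : PCNF n) : Dat :=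
  Dat.cons (encList encQuantifier (List.ofFn Φ.quant)) (encList encClause Φ.clauses)

/-- A variable order is given as the list of the variables in this order. -/
def encVarOrder {n : ℕ} (π : VarOrder n) : Dat := encList encFin (List.ofFn fun i => π.symm i)

def encRef {m : ℕ} : Bool ⊕ Fin m → Dat
  | Sum.inl b => Dat.cons (encBool false) (encBool b)
  | Sum.inr v => Dat.cons (encBool true) (encFin v)

/-- The root, followed by the list of the inner nodes with their labels and children. -/
def encOBDD {n : ℕ} (B : OBDD n) : Dat :=
  Dat.cons (encRef B.root) (encList
    (fun v => Dat.cons (encFin (B.label v))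
      (Dat.cons (encRef (B.child v false)) (encRef (B.child v true))))
    (List.finRange B.numNodes))

def encTrace {n : ℕ} (R : QBDDTrace n) : Dat :=
  Dat.cons (encList encOBDD R.clause)
    (Dat.cons (encList encOBDD (List.ofFn R.conj))
      (Dat.cons (encList encOBDD (List.ofFn R.elim)) (encOBDD R.result)))

/-- Given `Φ` and the order `π`, the program `P` carries out QBDD, i.e. computes all OBDDs of the
run of QBDD, in at most `T` steps, and the run solves `Φ`: it ends with the constant `1` if `Φ` is
true and with the constant `0` if `Φ` is false. -/
def SolvesByQBDD {n : ℕ} (P : Program) (Φ : PCNF n) (π : VarOrder n) (T : ℕ) : Prop :=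
  ∃ (R : QBDDTrace n) (t : ℕ),
    R.IsRun Φ π ∧
    (Φ.IsTrue → R.result.Represents π fun _ => true) ∧
    (Φ.IsFalse → R.result.Represents π fun _ => false) ∧
    P.Runs (Dat.cons (encPCNF Φ) (encVarOrder π)) (encTrace R) t ∧ t ≤ T

/-! Every OBDD that occurs in a run or in the refutation is, up to fixing one variable, the OBDD of
a function Q_m x_m ⋯ Q_{n-1} x_{n-1}. ⋀T for some clauses T of the matrix. Such a function is
recognised by a deterministic automaton (`stateAut`) that reads the variables in the order π. Its
states are nested finite sets with one level for each block of the suffix; innermost are residual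
clause lists. Reading a free variable assigns it in all leaves; reading a variable of some block
replaces each element of a set on the level of this block by its two cofactors. Falsity is the
single tree `nil`: it is dropped from existential levels and absorbs universal ones. Sets are sorted
lists, so that equal sets are equal trees. Correctness is `stateAut_value_startState`.

The width is bounded as follows. Order the variables by the first bag in which they occur in an
optimal path decomposition. At any time the variables already read that share a clause with an
unread variable lie in one bag together with the next variable, hence there are at most k of them
(`exists_order`). A residual list without an empty clause depends only on the values of these
variables, so there are at most 2^k such leaves (`card_leafLayer`). Each level contributes one power
set, and there are at most q levels (`length_levelsOf_le`), whence at most tower(k, q+1) states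
besides `nil` after any number of read variables (`card_stateSet`, `card_layer_le`).

The minimized OBDD arises from the automaton by a memoised depth-first search with a unique table
(`build_spec`). The resulting node list is reduced, so different nodes denote different functions
(`Reduced.canonical`), and all its nodes denote cofactors, which gives minimality
(`Reduced.represents`).

For the run of QBDD, the conjunction of pending OBDDs equals the quantified conjunction of the
clauses from which they stem, because quantifying x does not affect an OBDD in which x does not
occur (`tail_flatMap`). Therefore the program need not operate on OBDDs: it remembers the clauses
and the set of labels of each pending OBDD and constructs every OBDD anew from clauses. Tries for
the memo and for the unique table make the time (number of states) · poly(size of a state)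
(`implements_dfs`, `exists_program`).

The size of a state is polynomial in tower(k, q), not only in |Φ|, and it enters the time with a
constant exponent c. If tower(k, q) is less than (c+1)n, this factor is polynomial in |Φ|. Otherwise
tower(k, q+1) is at least 2^((c+1)n), and the trivial bound of 2^n states per layer of size 2^n ·
poly suffices (`exists_runBound`).

For the refutation, the clauses are conjoined one by one and the variables are eliminated from the
inside out, an existential one by projection and a universal one by its two reductions and their
conjunction (`exists_derivation_tail`). All lines obey the same width bound, since a restriction is
computed by an automaton with states from the same sets. -/

/-! ### Evaluation with a time bound -/

/-- `e` evaluates to `v` in at most `T` steps. -/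
def EvalLE (P : Program) (env : List Dat) (e : Expr) (v : Dat) (T : ℕ) : Prop :=
  ∃ t ≤ T, Eval P env e v t

namespace EvalLE

variable {P : Program} {env : List Dat}

theorem mono {e : Expr} {v : Dat} {T T' : ℕ} (h : EvalLE P env e v T) (hT : T ≤ T') :
    EvalLE P env e v T' :=
  let ⟨t, ht, he⟩ := h
  ⟨t, ht.trans hT, he⟩

theorem var {i : ℕ} {v : Dat} (h : env[i]? = some v) : EvalLE P env (Expr.var i) v 1 :=
  ⟨1, le_rfl, Eval.var env i v h⟩

theorem nil : EvalLE P env Expr.nil Dat.nil 1 := ⟨1, le_rfl, Eval.nil env⟩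

theorem cons {e₁ e₂ : Expr} {v₁ v₂ : Dat} {T₁ T₂ : ℕ} (h₁ : EvalLE P env e₁ v₁ T₁)
    (h₂ : EvalLE P env e₂ v₂ T₂) : EvalLE P env (Expr.cons e₁ e₂) (Dat.cons v₁ v₂) (T₁ + T₂ + 1) :=
  let ⟨t₁, ht₁, he₁⟩ := h₁
  let ⟨t₂, ht₂, he₂⟩ := h₂
  ⟨t₁ + t₂ + 1, by omega, Eval.cons _ _ _ _ _ _ _ he₁ he₂⟩

theorem casesNil {e e₁ e₂ : Expr} {v : Dat} {T₁ T₂ : ℕ} (h : EvalLE P env e Dat.nil T₁)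
    (h₁ : EvalLE P env e₁ v T₂) : EvalLE P env (Expr.cases e e₁ e₂) v (T₁ + T₂ + 1) :=
  let ⟨t₁, ht₁, he₁⟩ := h
  let ⟨t₂, ht₂, he₂⟩ := h₁
  ⟨t₁ + t₂ + 1, by omega, Eval.casesNil _ _ _ _ _ _ _ he₁ he₂⟩

theorem casesCons {e e₁ e₂ : Expr} {l r v : Dat} {T₁ T₂ : ℕ}
    (h : EvalLE P env e (Dat.cons l r) T₁) (h₂ : EvalLE P (l :: r :: env) e₂ v T₂) :
    EvalLE P env (Expr.cases e e₁ e₂) v (T₁ + T₂ + 1) :=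
  let ⟨t₁, ht₁, he₁⟩ := h
  let ⟨t₂, ht₂, he₂⟩ := h₂
  ⟨t₁ + t₂ + 1, by omega, Eval.casesCons _ _ _ _ _ _ _ _ _ he₁ he₂⟩

theorem bind {e₁ e₂ : Expr} {v₁ v : Dat} {T₁ T₂ : ℕ} (h₁ : EvalLE P env e₁ v₁ T₁)
    (h₂ : EvalLE P (v₁ :: env) e₂ v T₂) : EvalLE P env (Expr.bind e₁ e₂) v (T₁ + T₂ + 1) :=
  let ⟨t₁, ht₁, he₁⟩ := h₁
  let ⟨t₂, ht₂, he₂⟩ := h₂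
  ⟨t₁ + t₂ + 1, by omega, Eval.bind _ _ _ _ _ _ _ he₁ he₂⟩

/-- The second premise evaluates the call on a bare variable, so its bound already contains the step
for the call, and nothing is added to the sum. In this way a specification in the sense of `Meets`
can be plugged in directly. -/
theorem call {i : ℕ} {e : Expr} {w v : Dat} {T₁ T₂ : ℕ} (h : EvalLE P env e w T₁)
    (h' : EvalLE P [w] (Expr.call i (Expr.var 0)) v T₂) :
    EvalLE P env (Expr.call i e) v (T₁ + T₂) := by
  obtain ⟨t₁, ht₁, he₁⟩ := h
  obtain ⟨t₂, ht₂, he₂⟩ := h'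
  cases he₂ with
  | call _ _ _ body w' _ t t' hw hb hv =>
    cases hw with
    | var _ _ _ hw =>
      simp only [List.getElem?_cons_zero, Option.some.injEq] at hw
      subst hw
      exact ⟨t₁ + t' + 1, by omega, Eval.call _ _ _ _ _ _ _ _ he₁ hb hv⟩

theorem self {i : ℕ} {body : Expr} {w v : Dat} {T : ℕ} (hb : P[i]? = some body)
    (h : EvalLE P [w] body v T) : EvalLE P [w] (Expr.call i (Expr.var 0)) v (T + 2) :=
  let ⟨t, ht, he⟩ := h
  ⟨1 + t + 1, by omega, Eval.call _ _ _ _ _ _ _ _ (Eval.var _ _ _ rfl) hb he⟩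

end EvalLE

/-! ### Linking programs -/

/-- A specification relates inputs, outputs and time bounds. -/
abbrev Spec := Dat → Dat → ℕ → Prop

/-- In the program `P`, the function with index `i` meets the specification `R`. -/
def Meets (P : Program) (i : ℕ) (R : Spec) : Prop :=
  ∀ w v T, R w v T → EvalLE P [w] (Expr.call i (Expr.var 0)) v T

/-- There is a relocatable piece of program with a function that meets `R`. -/
def Implements (R : Spec) : Prop :=
  ∀ s : ℕ, ∃ (Q : Program) (i : ℕ), ∀ Pre Post : Program, Pre.length = s →
    Meets (Pre ++ Q ++ Post) i R

theorem Implements.mono {R R' : Spec} (h : Implements R)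
    (hR : ∀ w v T, R' w v T → ∃ T' ≤ T, R w v T') : Implements R' := by
  intro s
  obtain ⟨Q, i, hQ⟩ := h s
  refine ⟨Q, i, fun Pre Post hs w v T hw => ?_⟩
  obtain ⟨T', hT', h'⟩ := hR w v T hw
  exact (hQ Pre Post hs w v T' h').mono hT'

/-- Calls use absolute indices. As every piece is available for every offset, the pieces can be
placed one behind the other, each with the offset given by the length of what precedes it. -/
theorem Implements.family : ∀ {m : ℕ} (R : Fin m → Spec) (_ : ∀ j, Implements (R j)) (s : ℕ),
    ∃ (Q : Program) (i : Fin m → ℕ), ∀ Pre Post : Program, Pre.length = s →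
      ∀ j, Meets (Pre ++ Q ++ Post) (i j) (R j)
  | 0, _, _, _ => ⟨[], Fin.elim0, fun _ _ _ j => j.elim0⟩
  | m + 1, R, h, s => by
    obtain ⟨Q₁, i₁, h₁⟩ := h 0 s
    obtain ⟨Q₂, i₂, h₂⟩ := Implements.family (fun j => R j.succ) (fun j => h j.succ) (s + Q₁.length)
    refine ⟨Q₁ ++ Q₂, Fin.cons i₁ i₂, fun Pre Post hs j => ?_⟩
    refine Fin.cases ?_ (fun j => ?_) j
    · simpa using h₁ Pre (Q₂ ++ Post) hs
    · simpa using h₂ (Pre ++ Q₁) Post (by simp [hs]) j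

/-- Definition of a (recursive) function that calls functions which are already implemented. -/
theorem Implements.define {m : ℕ} (R : Fin m → Spec) (h : ∀ j, Implements (R j))
    (body : (Fin m → ℕ) → ℕ → Expr) (S : Spec)
    (H : ∀ (P : Program) (idx : Fin m → ℕ) (self : ℕ), P[self]? = some (body idx self) →
      (∀ j, Meets P (idx j) (R j)) → Meets P self S) : Implements S := by
  intro s
  obtain ⟨Q, i, hQ⟩ := Implements.family R h s
  refine ⟨Q ++ [body i (s + Q.length)], s + Q.length, fun Pre Post hs => ?_⟩
  refine H _ i _ ?_ fun j => ?_
  · subst hs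
    rw [List.getElem?_append_left (by simp), ← List.append_assoc,
      List.getElem?_append_right (by simp)]
    simp
  · simpa using hQ Pre (body i (s + Q.length) :: Post) hs j

/-- Programs start with function `0`; the piece is placed at offset `1` behind a main function that
only calls it. -/
theorem Implements.run {R : Spec} (h : Implements R) :
    ∃ P : Program, ∀ w v T, R w v T → ∃ t ≤ T, P.Runs w v t := by
  obtain ⟨Q, i, hQ⟩ := h 1
  refine ⟨[Expr.call i (Expr.var 0)] ++ Q ++ [], fun w v T hw => ?_⟩
  obtain ⟨t, ht, he⟩ := hQ [Expr.call i (Expr.var 0)] [] rfl w v T hw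
  exact ⟨t, ht, _, rfl, he⟩

/-! ### Trees -/

namespace Dat

def size : Dat → ℕ
  | nil => 1
  | cons l r => l.size + r.size + 1

def fst : Dat → Dat
  | nil => nil
  | cons l _ => l

def snd : Dat → Dat
  | nil => nil
  | cons _ r => r

/-- Everything except `nil` counts as true. -/
def ite : Dat → Dat → Dat → Dat
  | nil, _, b => b
  | cons _ _, a, _ => a

@[simp] theorem fst_cons (l r : Dat) : (cons l r).fst = l := rfl
@[simp] theorem snd_cons (l r : Dat) : (cons l r).snd = r := rfl
@[simp] theorem fst_nil : nil.fst = nil := rfl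
@[simp] theorem snd_nil : nil.snd = nil := rfl
@[simp] theorem size_nil : nil.size = 1 := rfl
@[simp] theorem size_cons (l r : Dat) : (cons l r).size = l.size + r.size + 1 := rfl
@[simp] theorem ite_nil (a b : Dat) : ite nil a b = b := rfl
@[simp] theorem ite_cons (l r a b : Dat) : ite (cons l r) a b = a := rfl

@[simp] theorem ite_encBool (c : Bool) (a b : Dat) :
    ite (encBool c) a b = if c then a else b := by cases c <;> rfl

theorem size_pos (w : Dat) : 0 < w.size := by cases w <;> simp

theorem size_fst_le (w : Dat) : w.fst.size ≤ w.size := by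
  cases w <;> simp; omega

theorem size_snd_le (w : Dat) : w.snd.size ≤ w.size := by
  cases w <;> simp; omega

theorem size_ite_le (c a b : Dat) : (ite c a b).size ≤ a.size + b.size := by
  cases c <;> simp

end Dat

/-! ### Polynomial bounds -/

/-- A function of trees that is bounded by a polynomial in the size. -/
def PolyBd (f : Dat → ℕ) : Prop := ∃ c, ∀ w : Dat, f w ≤ (w.size + 2) ^ c

namespace PolyBd

theorem mono {f g : Dat → ℕ} (hg : PolyBd g) (h : ∀ w, f w ≤ g w) : PolyBd f :=
  let ⟨c, hc⟩ := hg
  ⟨c, fun w => (h w).trans (hc w)⟩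

theorem const (a : ℕ) : PolyBd fun _ => a :=
  ⟨a, fun w => (Nat.lt_pow_self (by omega : 1 < 2)).le.trans
    (Nat.pow_le_pow_left (by omega) a)⟩

theorem size : PolyBd Dat.size := ⟨1, fun w => by simp⟩

theorem add {f g : Dat → ℕ} (hf : PolyBd f) (hg : PolyBd g) : PolyBd fun w => f w + g w := by
  obtain ⟨a, ha⟩ := hf
  obtain ⟨b, hb⟩ := hg
  refine ⟨max a b + 1, fun w => ?_⟩
  have h1 : f w ≤ (w.size + 2) ^ max a b :=
    (ha w).trans (Nat.pow_le_pow_right (by omega) (le_max_left _ _))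
  have h2 : g w ≤ (w.size + 2) ^ max a b :=
    (hb w).trans (Nat.pow_le_pow_right (by omega) (le_max_right _ _))
  calc f w + g w ≤ (w.size + 2) ^ max a b * 2 := by omega
    _ ≤ (w.size + 2) ^ max a b * (w.size + 2) := Nat.mul_le_mul_left _ (by omega)
    _ = _ := (pow_succ _ _).symm

theorem mul {f g : Dat → ℕ} (hf : PolyBd f) (hg : PolyBd g) : PolyBd fun w => f w * g w := by
  obtain ⟨a, ha⟩ := hf
  obtain ⟨b, hb⟩ := hg
  exact ⟨a + b, fun w => (Nat.mul_le_mul (ha w) (hb w)).trans_eq (pow_add _ _ _).symm⟩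

theorem pow {f : Dat → ℕ} (hf : PolyBd f) (c : ℕ) : PolyBd fun w => f w ^ c := by
  obtain ⟨a, ha⟩ := hf
  exact ⟨a * c, fun w => (Nat.pow_le_pow_left (ha w) c).trans_eq (pow_mul _ _ _).symm⟩

theorem comp {f : Dat → ℕ} {G : Dat → Dat} (hf : PolyBd f) (hG : PolyBd fun w => (G w).size) :
    PolyBd fun w => f (G w) := by
  obtain ⟨c, hc⟩ := hf
  exact ((hG.add (const 2)).pow c).mono fun w => hc (G w)

end PolyBd

/-! ### Polynomial time -/

/-- `F` has polynomially bounded values and is computable in polynomial time. -/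
@[fun_prop]
def PolyTime (F : Dat → Dat) : Prop :=
  PolyBd (fun w => (F w).size) ∧
    ∃ t : Dat → ℕ, PolyBd t ∧ Implements fun w v T => v = F w ∧ T = t w

namespace PolyTime

theorem bound {F : Dat → Dat} (h : PolyTime F) :
    ∃ c, (∀ w, (F w).size ≤ (w.size + 2) ^ c) ∧
      Implements fun w v T => v = F w ∧ T = (w.size + 2) ^ c := by
  obtain ⟨⟨a, ha⟩, t, ⟨b, hb⟩, h⟩ := h
  refine ⟨max a b, fun w => (ha w).trans (Nat.pow_le_pow_right (by omega) (le_max_left _ _)),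
    h.mono ?_⟩
  rintro w v T ⟨rfl, rfl⟩
  exact ⟨t w, (hb w).trans (Nat.pow_le_pow_right (by omega) (le_max_right _ _)), rfl, rfl⟩

theorem define {F : Dat → Dat} (hsize : PolyBd fun w => (F w).size) (t : Dat → ℕ) (ht : PolyBd t)
    {m : ℕ} (R : Fin m → Spec) (h : ∀ j, Implements (R j)) (body : (Fin m → ℕ) → Expr)
    (H : ∀ (P : Program) (idx : Fin m → ℕ), (∀ j, Meets P (idx j) (R j)) →
      ∀ w, EvalLE P [w] (body idx) (F w) (t w)) : PolyTime F := by
  refine ⟨hsize, fun w => t w + 2, ht.add (PolyBd.const 2),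
    Implements.define R h (fun idx _ => body idx) _ ?_⟩
  rintro P idx self hself hR w v T ⟨rfl, rfl⟩
  exact EvalLE.self hself (H P idx hR w)

@[fun_prop] theorem id : PolyTime fun w => w :=
  define PolyBd.size (fun _ => 1) (PolyBd.const 1) Fin.elim0 (fun j => j.elim0)
    (fun _ => Expr.var 0) fun _ _ _ _ => EvalLE.var rfl

theorem nil : PolyTime fun _ => Dat.nil :=
  define (PolyBd.const 1) (fun _ => 1) (PolyBd.const 1) Fin.elim0 (fun j => j.elim0)
    (fun _ => Expr.nil) fun _ _ _ _ => EvalLE.nil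

@[fun_prop] theorem comp {F G : Dat → Dat} (hF : PolyTime F) (hG : PolyTime G) :
    PolyTime fun w => F (G w) := by
  obtain ⟨hFs, tF, htF, hF⟩ := hF
  obtain ⟨hGs, tG, htG, hG⟩ := hG
  refine define (hFs.comp hGs) (fun w => 1 + tG w + tF (G w))
    (((PolyBd.const 1).add htG).add (htF.comp hGs)) ![_, _] (Fin.forall_fin_two.2 ⟨hF, hG⟩)
    (fun i => Expr.call (i 0) (Expr.call (i 1) (Expr.var 0))) fun P i h w => ?_
  exact ((EvalLE.var rfl).call (h 1 _ _ _ ⟨rfl, rfl⟩)).call (h 0 _ _ _ ⟨rfl, rfl⟩)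

@[fun_prop] theorem cons {F G : Dat → Dat} (hF : PolyTime F) (hG : PolyTime G) :
    PolyTime fun w => Dat.cons (F w) (G w) := by
  obtain ⟨hFs, tF, htF, hF⟩ := hF
  obtain ⟨hGs, tG, htG, hG⟩ := hG
  refine define ((hFs.add hGs).add (PolyBd.const 1)) (fun w => (1 + tF w) + (1 + tG w) + 1)
    ((((PolyBd.const 1).add htF).add ((PolyBd.const 1).add htG)).add (PolyBd.const 1))
    ![_, _] (Fin.forall_fin_two.2 ⟨hF, hG⟩)
    (fun i => Expr.cons (Expr.call (i 0) (Expr.var 0)) (Expr.call (i 1) (Expr.var 0)))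
    fun P i h w => ?_
  exact ((EvalLE.var rfl).call (h 0 _ _ _ ⟨rfl, rfl⟩)).cons
    ((EvalLE.var rfl).call (h 1 _ _ _ ⟨rfl, rfl⟩))

@[fun_prop] theorem const : ∀ d : Dat, PolyTime fun _ => d
  | Dat.nil => nil
  | Dat.cons l r => (const l).cons (const r)

@[fun_prop] theorem fst : PolyTime Dat.fst := by
  refine define (PolyBd.size.mono Dat.size_fst_le) (fun _ => 1 + 1 + 1) (PolyBd.const _)
    Fin.elim0 (fun j => j.elim0)
    (fun _ => Expr.cases (Expr.var 0) Expr.nil (Expr.var 0)) fun P i h w => ?_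
  cases w with
  | nil => exact EvalLE.casesNil (EvalLE.var rfl) EvalLE.nil
  | cons l r => exact EvalLE.casesCons (EvalLE.var rfl) (EvalLE.var rfl)

@[fun_prop] theorem snd : PolyTime Dat.snd := by
  refine define (PolyBd.size.mono Dat.size_snd_le) (fun _ => 1 + 1 + 1) (PolyBd.const _)
    Fin.elim0 (fun j => j.elim0)
    (fun _ => Expr.cases (Expr.var 0) Expr.nil (Expr.var 1)) fun P i h w => ?_
  cases w with
  | nil => exact EvalLE.casesNil (EvalLE.var rfl) EvalLE.nil
  | cons l r => exact EvalLE.casesCons (EvalLE.var rfl) (EvalLE.var rfl)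

@[fun_prop] theorem ite {C F G : Dat → Dat} (hC : PolyTime C) (hF : PolyTime F)
    (hG : PolyTime G) : PolyTime fun w => Dat.ite (C w) (F w) (G w) := by
  obtain ⟨hCs, tC, htC, hC⟩ := hC
  obtain ⟨hFs, tF, htF, hF⟩ := hF
  obtain ⟨hGs, tG, htG, hG⟩ := hG
  refine define ((hFs.add hGs).mono fun w => Dat.size_ite_le _ _ _)
    (fun w => (1 + tC w) + ((1 + tF w) + (1 + tG w)) + 1)
    ((((PolyBd.const 1).add htC).add (((PolyBd.const 1).add htF).add
      ((PolyBd.const 1).add htG))).add (PolyBd.const 1))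
    ![_, _, _] (Fin.forall_fin_succ.2 ⟨hC, Fin.forall_fin_two.2 ⟨hF, hG⟩⟩)
    (fun i => Expr.cases (Expr.call (i 0) (Expr.var 0)) (Expr.call (i 2) (Expr.var 0))
      (Expr.call (i 1) (Expr.var 2)))
    fun P i h w => ?_
  have h0 := (EvalLE.var (P := P) (env := [w]) (i := 0) rfl).call (h 0 w _ _ ⟨rfl, rfl⟩)
  cases hw : C w with
  | nil =>
    rw [hw] at h0
    exact (h0.casesNil ((EvalLE.var rfl).call (h 2 _ _ _ ⟨rfl, rfl⟩))).mono (by omega)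
  | cons l r =>
    rw [hw] at h0
    exact (h0.casesCons ((EvalLE.var rfl).call (h 1 _ _ _ ⟨rfl, rfl⟩))).mono (by omega)

/-- Recursion on trees. -/
theorem treeRec {F : Dat → Dat → Dat} {z h₁ h₂ : Dat → Dat} {g : Dat → Dat → Dat → Dat → Dat → Dat}
    (hnil : ∀ p, F p Dat.nil = z p)
    (hcons : ∀ p l r, F p (Dat.cons l r) = g p l r (F (h₁ p) l) (F (h₂ p) r))
    (hz : PolyTime z)
    (hg : PolyTime fun w => g w.fst w.snd.fst w.snd.snd.fst w.snd.snd.snd.fst w.snd.snd.snd.snd)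
    (hh₁ : PolyTime h₁) (hh₂ : PolyTime h₂)
    (hs₁ : ∀ p, (h₁ p).size ≤ p.size) (hs₂ : ∀ p, (h₂ p).size ≤ p.size)
    (hsize : ∃ c, ∀ p t, (F p t).size ≤ (p.size + t.size + 2) ^ c) :
    PolyTime fun w => F w.fst w.snd := by
  obtain ⟨cz, -, iz⟩ := hz.bound
  obtain ⟨cg, -, ig⟩ := hg.bound
  obtain ⟨c₁, -, i₁⟩ := hh₁.bound
  obtain ⟨c₂, -, i₂⟩ := hh₂.bound
  obtain ⟨c, hc⟩ := hsize
  -- The cost of one node of the recursion for parameters of size at most `a` and trees of size at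
  -- most `b`. As the parameters never grow, the same `a` and `b` serve in the whole recursion, and
  -- the total is `Z a b` per node of the tree. The base with exponent `cg` bounds the argument of
  -- `g`, which contains the two recursive values; this is why `hsize` is needed.
  set Z : ℕ → ℕ → ℕ := fun a b => (a + 2) ^ cz + (a + 2) ^ c₁ + (a + 2) ^ c₂ +
    (a + b + b + 2 * (a + b + 2) ^ c + 6) ^ cg + 50 with hZ
  -- The two bindings are the projections of the argument. After the case distinction the variables
  -- `0` to `3` are the two subtrees, the tree and the parameter.
  have main : ∀ (P : Program) (i : Fin 4 → ℕ) (self : ℕ),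
      P[self]? = some (Expr.bind (Expr.cases (Expr.var 0) Expr.nil (Expr.var 0))
        (Expr.bind (Expr.cases (Expr.var 1) Expr.nil (Expr.var 1))
          (Expr.cases (Expr.var 0) (Expr.call (i 0) (Expr.var 1))
            (Expr.call (i 1) (Expr.cons (Expr.var 3) (Expr.cons (Expr.var 0) (Expr.cons (Expr.var 1)
              (Expr.cons
                (Expr.call self (Expr.cons (Expr.call (i 2) (Expr.var 3)) (Expr.var 0)))
                (Expr.call self (Expr.cons (Expr.call (i 3) (Expr.var 3)) (Expr.var 1)))))))))))
      → (∀ j, Meets P (i j) ((![fun w v T => v = z w ∧ T = (w.size + 2) ^ cz,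
          fun w v T => v = g w.fst w.snd.fst w.snd.snd.fst w.snd.snd.snd.fst w.snd.snd.snd.snd ∧
            T = (w.size + 2) ^ cg,
          fun w v T => v = h₁ w ∧ T = (w.size + 2) ^ c₁,
          fun w v T => v = h₂ w ∧ T = (w.size + 2) ^ c₂] : Fin 4 → Spec) j)) →
      ∀ a b t p, p.size ≤ a → t.size ≤ b → ∀ w : Dat, w.fst = p → w.snd = t →
        EvalLE P [w] (Expr.call self (Expr.var 0)) (F p t) (t.size * Z a b) := by
    intro P i self hself hm a b t
    induction t with
    | nil =>
      intro p hp ht w hw₁ hw₂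
      refine (EvalLE.self hself (EvalLE.bind (v₁ := p) (T₁ := 1 + 1 + 1) ?_
        (EvalLE.bind (v₁ := Dat.nil) (T₁ := 1 + 1 + 1) ?_ (EvalLE.casesNil (EvalLE.var rfl)
          ((EvalLE.var rfl).call (hm 0 _ _ _ ⟨hnil p, rfl⟩)))))).mono ?_
      · cases w with
        | nil => rw [← hw₁]; exact EvalLE.casesNil (EvalLE.var rfl) EvalLE.nil
        | cons l r => rw [← hw₁]; exact EvalLE.casesCons (EvalLE.var rfl) (EvalLE.var rfl)
      · cases w with
        | nil => exact EvalLE.casesNil (EvalLE.var rfl) EvalLE.nil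
        | cons l r => rw [← hw₂]; exact EvalLE.casesCons (EvalLE.var rfl) (EvalLE.var rfl)
      · have : (p.size + 2) ^ cz ≤ (a + 2) ^ cz := Nat.pow_le_pow_left (by omega) _
        simp only [Dat.size_nil, hZ]
        omega
    | cons l r ihl ihr =>
      intro p hp ht w hw₁ hw₂
      simp only [Dat.size_cons] at ht
      have e₁ := ihl (h₁ p) ((hs₁ p).trans hp) (by omega) (Dat.cons (h₁ p) l) rfl rfl
      have e₂ := ihr (h₂ p) ((hs₂ p).trans hp) (by omega) (Dat.cons (h₂ p) r) rfl rfl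
      refine (EvalLE.self hself (EvalLE.bind (v₁ := p) (T₁ := 1 + 1 + 1) ?_
        (EvalLE.bind (v₁ := Dat.cons l r) (T₁ := 1 + 1 + 1) ?_ (EvalLE.casesCons (EvalLE.var rfl)
          (EvalLE.call (EvalLE.cons (EvalLE.var rfl) (EvalLE.cons (EvalLE.var rfl)
            (EvalLE.cons (EvalLE.var rfl) (EvalLE.cons
              (EvalLE.call (EvalLE.cons ((EvalLE.var rfl).call (hm 2 p _ _ ⟨rfl, rfl⟩))
                (EvalLE.var rfl)) e₁)
              (EvalLE.call (EvalLE.cons ((EvalLE.var rfl).call (hm 3 p _ _ ⟨rfl, rfl⟩))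
                (EvalLE.var rfl)) e₂)))))
            (hm 1 _ _ _ ⟨hcons p l r, rfl⟩)))))).mono ?_
      · cases w with
        | nil => rw [← hw₁]; exact EvalLE.casesNil (EvalLE.var rfl) EvalLE.nil
        | cons l r => rw [← hw₁]; exact EvalLE.casesCons (EvalLE.var rfl) (EvalLE.var rfl)
      · cases w with
        | nil => simp at hw₂
        | cons l r => rw [← hw₂]; exact EvalLE.casesCons (EvalLE.var rfl) (EvalLE.var rfl)
      · have b₁ : (p.size + 2) ^ c₁ ≤ (a + 2) ^ c₁ := Nat.pow_le_pow_left (by omega) _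
        have b₂ : (p.size + 2) ^ c₂ ≤ (a + 2) ^ c₂ := Nat.pow_le_pow_left (by omega) _
        have s₁ : (F (h₁ p) l).size ≤ (a + b + 2) ^ c :=
          (hc _ _).trans (Nat.pow_le_pow_left (by have := hs₁ p; omega) _)
        have s₂ : (F (h₂ p) r).size ≤ (a + b + 2) ^ c :=
          (hc _ _).trans (Nat.pow_le_pow_left (by have := hs₂ p; omega) _)
        have b₃ : (p.size + (l.size + (r.size + ((F (h₁ p) l).size + (F (h₂ p) r).size + 1) + 1) + 1)
            + 1 + 2) ^ cg ≤ (a + b + b + 2 * (a + b + 2) ^ c + 6) ^ cg :=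
          Nat.pow_le_pow_left (by omega) _
        simp only [Dat.size_cons]
        have : (l.size + r.size + 1) * Z a b = l.size * Z a b + r.size * Z a b + Z a b := by ring
        rw [this]
        have hZab : Z a b = (a + 2) ^ cz + (a + 2) ^ c₁ + (a + 2) ^ c₂ +
          (a + b + b + 2 * (a + b + 2) ^ c + 6) ^ cg + 50 := rfl
        generalize l.size * Z a b = X at *
        generalize r.size * Z a b = Y at *
        rw [hZab]
        omega
  refine ⟨?_, fun w => w.size * Z w.size w.size, ?_, Implements.define
    ![fun w v T => v = z w ∧ T = (w.size + 2) ^ cz,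
          fun w v T => v = g w.fst w.snd.fst w.snd.snd.fst w.snd.snd.snd.fst w.snd.snd.snd.snd ∧
            T = (w.size + 2) ^ cg,
          fun w v T => v = h₁ w ∧ T = (w.size + 2) ^ c₁,
          fun w v T => v = h₂ w ∧ T = (w.size + 2) ^ c₂]
    (Fin.forall_fin_succ.2 ⟨iz, Fin.forall_fin_succ.2 ⟨ig, Fin.forall_fin_two.2 ⟨i₁, i₂⟩⟩⟩)
    (fun i self => Expr.bind (Expr.cases (Expr.var 0) Expr.nil (Expr.var 0))
        (Expr.bind (Expr.cases (Expr.var 1) Expr.nil (Expr.var 1))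
          (Expr.cases (Expr.var 0) (Expr.call (i 0) (Expr.var 1))
            (Expr.call (i 1) (Expr.cons (Expr.var 3) (Expr.cons (Expr.var 0) (Expr.cons (Expr.var 1)
              (Expr.cons
                (Expr.call self (Expr.cons (Expr.call (i 2) (Expr.var 3)) (Expr.var 0)))
                (Expr.call self (Expr.cons (Expr.call (i 3) (Expr.var 3)) (Expr.var 1)))))))))))
        _ ?_⟩
  · have h2 : PolyBd fun w => (w.size + w.size + 2) ^ c :=
      ((PolyBd.size.add PolyBd.size).add (PolyBd.const 2)).pow c
    refine h2.mono fun w => (hc _ _).trans (Nat.pow_le_pow_left ?_ _)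
    have := w.size_fst_le
    have := w.size_snd_le
    omega
  · have e : ∀ k, PolyBd fun w => (w.size + 2) ^ k :=
      fun k => (PolyBd.size.add (PolyBd.const 2)).pow k
    refine PolyBd.size.mul ((((e cz).add (e c₁)).add (e c₂)).add ?_ |>.add (PolyBd.const 50))
    exact (((PolyBd.size.add PolyBd.size).add PolyBd.size).add ((PolyBd.const 2).mul
      (((PolyBd.size.add PolyBd.size).add (PolyBd.const 2)).pow c)) |>.add (PolyBd.const 6)).pow cg
  · rintro P i self hself hm w v T ⟨rfl, rfl⟩
    refine (main P i self hself hm w.size w.size w.snd w.fst w.size_fst_le w.size_snd_le w rfl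
      rfl).mono (Nat.mul_le_mul_right _ w.size_snd_le)

/-- Recursion on lists. -/
theorem listRec {F : Dat → Dat → Dat} {z : Dat → Dat} {g : Dat → Dat → Dat → Dat → Dat}
    (hnil : ∀ p, F p Dat.nil = z p)
    (hcons : ∀ p l r, F p (Dat.cons l r) = g p l r (F p r))
    (hz : PolyTime z)
    (hg : PolyTime fun w => g w.fst w.snd.fst w.snd.snd.fst w.snd.snd.snd)
    (hsize : ∃ c, ∀ p t, (F p t).size ≤ (p.size + t.size + 2) ^ c) :
    PolyTime fun w => F w.fst w.snd :=
  treeRec (z := z) (h₁ := fun p => p) (h₂ := fun p => p) (g := fun p l r _ x => g p l r x)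
    hnil hcons hz
    (hg.comp (G := fun w => Dat.cons w.fst (Dat.cons w.snd.fst
      (Dat.cons w.snd.snd.fst w.snd.snd.snd.snd))) (by fun_prop))
    (by fun_prop) (by fun_prop) (fun _ => le_rfl) (fun _ => le_rfl) hsize

theorem comp₂ {F : Dat → Dat → Dat} (hF : PolyTime fun w => F w.fst w.snd) {a b : Dat → Dat}
    (ha : PolyTime a) (hb : PolyTime b) : PolyTime fun w => F (a w) (b w) :=
  hF.comp (ha.cons hb)

end PolyTime

/-! ### Lists as trees -/

namespace Dat

instance decEq : DecidableEq Dat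
  | nil, nil => isTrue rfl
  | nil, cons _ _ => isFalse (by simp)
  | cons _ _, nil => isFalse (by simp)
  | cons a b, cons c d =>
    match decEq a c, decEq b d with
    | isTrue h, isTrue h' => isTrue (by rw [h, h'])
    | isFalse h, _ => isFalse (by simp [h])
    | _, isFalse h => isFalse (by simp [h])

/-- Every tree is a list of trees. -/
def toList : Dat → List Dat
  | nil => []
  | cons l r => l :: r.toList

@[simp] theorem toList_nil : nil.toList = [] := rfl
@[simp] theorem toList_cons (l r : Dat) : (cons l r).toList = l :: r.toList := rfl

@[simp] theorem toList_encList {α : Type*} (f : α → Dat) (l : List α) :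
    (encList f l).toList = l.map f := by
  induction l with
  | nil => rfl
  | cons x l ih => simp [encList, ih]

@[simp] theorem encList_toList (d : Dat) : encList id d.toList = d := by
  induction d with
  | nil => rfl
  | cons l r _ ih => simp [encList, ih]

theorem toList_injective : Function.Injective toList := fun a b h => by
  rw [← encList_toList a, h, encList_toList]

theorem encList_map {α β : Type*} (f : β → Dat) (g : α → β) (l : List α) :
    encList f (l.map g) = encList (fun x => f (g x)) l := by
  induction l with
  | nil => rfl
  | cons x l ih => simp [encList, ih]

theorem toList_eq_nil {d : Dat} : d.toList = [] ↔ d = nil := by cases d <;> simp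

theorem size_encBool_le (b : Bool) : (encBool b).size ≤ 3 := by cases b <;> simp [encBool]

theorem encBool_injective : Function.Injective encBool := by
  intro a b h; cases a <;> cases b <;> simp_all [encBool]

theorem encList_injective {α : Type*} {f : α → Dat} (hf : Function.Injective f) :
    Function.Injective (encList f) := fun a b h => by
  have := congrArg toList h
  simpa [(List.map_injective_iff.2 hf).eq_iff] using this

theorem encNat_injective : Function.Injective encNat := fun a b h => by
  have := encList_injective encBool_injective h
  have h2 := congrArg (List.foldr Nat.bit 0) this
  have key : ∀ m : ℕ, List.foldr Nat.bit 0 m.bits = m := by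
    intro m
    induction m using Nat.binaryRec' with
    | zero => simp
    | bit b m h ih => rw [Nat.bits_append_bit _ _ h]; simp [ih]
  rwa [key, key] at h2

theorem encFin_injective {n : ℕ} : Function.Injective (encFin (n := n)) := fun _ _ h =>
  Fin.ext (encNat_injective h)

theorem encLiteral_injective {n : ℕ} : Function.Injective (encLiteral (n := n)) := by
  rintro ⟨x, b⟩ ⟨y, c⟩ h
  simp only [encLiteral, Dat.cons.injEq] at h
  rw [encFin_injective h.1, encBool_injective h.2]

theorem encClause_injective {n : ℕ} : Function.Injective (encClause (n := n)) :=
  encList_injective encLiteral_injective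

theorem encQuantifier_injective : Function.Injective encQuantifier := by
  intro a b h; cases a <;> cases b <;> simp_all [encBool, encQuantifier]

/-- The comparison of trees by the root, then the left subtree, then the right subtree. -/
def lt : Dat → Dat → Bool
  | _, nil => false
  | nil, cons _ _ => true
  | cons a b, cons l r => lt a l || (decide (a = l) && lt b r)

theorem lt_irrefl (a : Dat) : lt a a = false := by
  induction a <;> simp_all [lt]

theorem lt_trans : ∀ {a b c : Dat}, lt a b = true → lt b c = true → lt a c = true
  | a, nil, c, h, _ => by cases a <;> simp [lt] at h
  | a, cons _ _, nil, _, h => by simp [lt] at h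
  | nil, cons _ _, cons _ _, _, _ => by simp [lt]
  | cons a b, cons c d, cons e f, h, h' => by
    simp only [lt, Bool.or_eq_true, Bool.and_eq_true, decide_eq_true_eq] at h h' ⊢
    rcases h with h | ⟨rfl, h⟩ <;> rcases h' with h' | ⟨rfl, h'⟩
    · exact Or.inl (lt_trans h h')
    · exact Or.inl h
    · exact Or.inl h'
    · exact Or.inr ⟨rfl, lt_trans h h'⟩

theorem lt_trichotomy : ∀ a b : Dat, lt a b = true ∨ a = b ∨ lt b a = true
  | nil, nil => by simp
  | nil, cons _ _ => by simp [lt]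
  | cons _ _, nil => by simp [lt]
  | cons a b, cons c d => by
    simp only [lt, Bool.or_eq_true, Bool.and_eq_true, decide_eq_true_eq, Dat.cons.injEq]
    rcases lt_trichotomy a c with h | rfl | h
    · simp [h]
    · rcases lt_trichotomy b d with h | h | h <;> simp [h]
    · simp [h]

/-- Sorted insertion without repetition. -/
def ins (x : Dat) : Dat → Dat
  | nil => cons x nil
  | cons y r => if x = y then cons y r else if lt x y then cons x (cons y r) else cons y (ins x r)

/-- The sorted list of the elements of a list. -/
def sort : Dat → Dat
  | nil => nil
  | cons x r => ins x (sort r)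

theorem mem_ins {x y s : Dat} : y ∈ (ins x s).toList ↔ y = x ∨ y ∈ s.toList := by
  induction s with
  | nil => simp [ins]
  | cons a r _ ih =>
    simp only [ins]
    split_ifs with h h'
    · subst h; simp
    · simp
    · simp [ih]; tauto

theorem mem_sort {y s : Dat} : y ∈ (sort s).toList ↔ y ∈ s.toList := by
  induction s with
  | nil => simp [sort]
  | cons a r _ ih => simp [sort, mem_ins, ih]

theorem ins_sorted {x s : Dat} (h : s.toList.Pairwise fun a b => lt a b = true) :
    (ins x s).toList.Pairwise fun a b => lt a b = true := by
  induction s with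
  | nil => simp [ins]
  | cons a r _ ih =>
    simp only [toList_cons, List.pairwise_cons] at h
    simp only [ins]
    split_ifs with h₁ h₂
    · simpa using h
    · simp only [toList_cons, List.pairwise_cons, List.mem_cons, forall_eq_or_imp]
      exact ⟨⟨h₂, fun b hb => lt_trans h₂ (h.1 b hb)⟩, h⟩
    · simp only [toList_cons, List.pairwise_cons]
      refine ⟨fun b hb => ?_, ih h.2⟩
      rcases mem_ins.1 hb with rfl | hb
      · exact ((lt_trichotomy b a).resolve_left h₂).resolve_left h₁
      · exact h.1 b hb

theorem sort_sorted (s : Dat) : (sort s).toList.Pairwise fun a b => lt a b = true := by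
  induction s with
  | nil => simp [sort]
  | cons a r _ ih => exact ins_sorted ih

/-- Strictly sorted lists have no repetitions, so they are permutations of each other, and a list
sorted by an asymmetric relation is determined by its elements. This makes sorted lists canonical
names of finite sets, so that states can be compared and counted as trees. -/
theorem eq_of_sorted {s t : Dat} (hs : s.toList.Pairwise fun a b => lt a b = true)
    (ht : t.toList.Pairwise fun a b => lt a b = true) (h : ∀ x, x ∈ s.toList ↔ x ∈ t.toList) :
    s = t := by
  refine toList_injective ?_
  have irr : ∀ a b, lt a b = true → a ≠ b := fun a b hab he => by
    subst he; simp [lt_irrefl] at hab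
  refine List.Perm.eq_of_pairwise (le := fun a b => lt a b = true) ?_ hs ht ?_
  · intro a b _ _ hab hba
    exact absurd (lt_trans hab hba) (by simp [lt_irrefl])
  · exact (List.perm_ext_iff_of_nodup (hs.imp (irr _ _)) (ht.imp (irr _ _))).2 h

theorem size_ins_le (x s : Dat) : (ins x s).size ≤ x.size + s.size + 1 := by
  induction s with
  | nil => simp [ins]
  | cons a r _ ih =>
    simp only [ins]
    split_ifs <;> simp <;> omega

theorem size_sort_le (s : Dat) : (sort s).size ≤ s.size := by
  induction s with
  | nil => simp [sort]
  | cons a r _ ih =>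
    have := size_ins_le a (sort r)
    simp [sort]; omega

end Dat

/-! ### Basic operations in polynomial time -/

/-- The base is at least 2, so the constant is absorbed by `a` further factors. -/
theorem exists_pow_bound {f : Dat → Dat → ℕ} (a : ℕ)
    (h : ∀ p t : Dat, f p t ≤ a * (p.size + t.size + 2) ^ 2) :
    ∃ c, ∀ p t : Dat, f p t ≤ (p.size + t.size + 2) ^ c := by
  refine ⟨a + 2, fun p t => (h p t).trans ?_⟩
  rw [pow_add]
  exact Nat.mul_le_mul_right _ ((Nat.lt_pow_self (by omega : 1 < 2)).le.trans
    (Nat.pow_le_pow_left (by omega) a))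

theorem exists_pow_bound' {f : Dat → Dat → ℕ} (a : ℕ)
    (h : ∀ p t : Dat, f p t ≤ a * (p.size + t.size + 2)) :
    ∃ c, ∀ p t : Dat, f p t ≤ (p.size + t.size + 2) ^ c :=
  exists_pow_bound a fun p t => (h p t).trans (Nat.mul_le_mul_left _ (Nat.le_self_pow (by omega) _))

namespace PolyTime

variable {a b c d : Dat → Dat}

@[fun_prop] theorem fst_comp (ha : PolyTime a) : PolyTime fun w => (a w).fst := fst.comp ha

@[fun_prop] theorem snd_comp (ha : PolyTime a) : PolyTime fun w => (a w).snd := snd.comp ha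

-- Simultaneous descent in two trees: the recursion is on the second tree, and the first one is the
-- parameter, replaced by its left or right subtree. The same scheme serves for `ltD`.
@[fun_prop] theorem eqD (ha : PolyTime a) (hb : PolyTime b) :
    PolyTime fun w => encBool (decide (a w = b w)) := by
  refine PolyTime.comp₂ (F := fun p t => encBool (decide (p = t))) ?_ ha hb
  refine treeRec (F := fun p t => encBool (decide (p = t))) (z := fun p => Dat.ite p (encBool false) (encBool true)) (h₁ := Dat.fst)
    (h₂ := Dat.snd)
    (g := fun p l r x y => Dat.ite p (Dat.ite x y (encBool false)) (encBool false))
    ?_ ?_ ?_ ?_ (by fun_prop) (by fun_prop) Dat.size_fst_le Dat.size_snd_le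
    (exists_pow_bound' 2 fun p t => ?_)
  · intro p; cases p <;> simp
  · intro p l r
    cases p with
    | nil => simp
    | cons x y => by_cases h : x = l <;> simp [h]
  · fun_prop
  · fun_prop
  · exact (Dat.size_encBool_le _).trans (by omega)

@[fun_prop] theorem ltD (ha : PolyTime a) (hb : PolyTime b) :
    PolyTime fun w => encBool (Dat.lt (a w) (b w)) := by
  refine PolyTime.comp₂ (F := fun p t => encBool (Dat.lt p t)) ?_ ha hb
  refine treeRec (F := fun p t => encBool (Dat.lt p t)) (z := fun p => encBool false) (h₁ := Dat.fst)
    (h₂ := Dat.snd)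
    (g := fun p l r x y => Dat.ite p (Dat.ite x (encBool true)
      (Dat.ite (encBool (decide (p.fst = l))) y (encBool false))) (encBool true))
    ?_ ?_ ?_ ?_ (by fun_prop) (by fun_prop) Dat.size_fst_le Dat.size_snd_le
    (exists_pow_bound' 2 fun p t => ?_)
  · intro p; cases p <;> simp [Dat.lt]
  · intro p l r
    cases p with
    | nil => simp [Dat.lt]
    | cons x y =>
      by_cases h : x = l
      · subst h; simp [Dat.lt, Dat.lt_irrefl]
      · cases h' : Dat.lt x l <;> simp [Dat.lt, h, h']
  · fun_prop
  · fun_prop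
  · exact (Dat.size_encBool_le _).trans (by omega)

@[fun_prop] theorem memD (ha : PolyTime a) (hb : PolyTime b) :
    PolyTime fun w => encBool (decide (a w ∈ (b w).toList)) := by
  refine PolyTime.comp₂ (F := fun p t => encBool (decide (p ∈ t.toList))) ?_ ha hb
  refine listRec (F := fun p t => encBool (decide (p ∈ t.toList))) (z := fun p => encBool false)
    (g := fun p l r y => Dat.ite (encBool (decide (p = l))) (encBool true) y)
    ?_ ?_ (by fun_prop) (by fun_prop)
    (exists_pow_bound' 2 fun p t => ?_)
  · intro p; simp
  · intro p l r
    by_cases h : p = l <;> simp [h]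
  · exact (Dat.size_encBool_le _).trans (by omega)

@[fun_prop] theorem insD (ha : PolyTime a) (hb : PolyTime b) :
    PolyTime fun w => Dat.ins (a w) (b w) := by
  refine PolyTime.comp₂ (F := Dat.ins) ?_ ha hb
  refine listRec (F := Dat.ins) (z := fun p => Dat.cons p Dat.nil)
    (g := fun p l r y => Dat.ite (encBool (decide (p = l))) (Dat.cons l r)
      (Dat.ite (encBool (Dat.lt p l)) (Dat.cons p (Dat.cons l r)) (Dat.cons l y)))
    ?_ ?_ (by fun_prop) (by fun_prop)
    (exists_pow_bound' 1 fun p t => ?_)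
  · intro p; simp [Dat.ins]
  · intro p l r
    simp [Dat.ins]
  · have := Dat.size_ins_le p t
    omega

@[fun_prop] theorem sortD (ha : PolyTime a) : PolyTime fun w => Dat.sort (a w) := by
  refine PolyTime.comp₂ (F := fun _ t => Dat.sort t) ?_ nil ha
  refine listRec (F := fun _ t => Dat.sort t) (z := fun p => Dat.nil) (g := fun p l r y => Dat.ins l y)
    ?_ ?_ (by fun_prop) (by fun_prop)
    (exists_pow_bound' 1 fun p t => ?_)
  · intro p; simp [Dat.sort]
  · intro p l r; simp [Dat.sort]
  · have := Dat.size_sort_le t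
    omega

end PolyTime

/-! ### Operations on states, clause lists and items, with size bounds -/

namespace Dat

def append : Dat → Dat → Dat
  | nil, b => b
  | cons l r, b => cons l (append r b)

def filterNe (m : Dat) : Dat → Dat
  | nil => nil
  | cons l r => if l = m then filterNe m r else cons l (filterNe m r)

def reverse : Dat → Dat
  | nil => nil
  | cons l r => append (reverse r) (cons l nil)

@[simp] theorem toList_append (a b : Dat) : (append a b).toList = a.toList ++ b.toList := by
  induction a with
  | nil => rfl
  | cons l r _ ih => simp [append, ih]

@[simp] theorem toList_filterNe (m a : Dat) :
    (filterNe m a).toList = a.toList.filter fun x => x ≠ m := by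
  induction a with
  | nil => rfl
  | cons l r _ ih => by_cases h : l = m <;> simp [filterNe, ih, h]

@[simp] theorem toList_reverse (a : Dat) : (reverse a).toList = a.toList.reverse := by
  induction a with
  | nil => rfl
  | cons l r _ ih => simp [reverse, ih]

theorem size_append (a b : Dat) : (append a b).size + 1 = a.size + b.size := by
  induction a with
  | nil => simp [append]; omega
  | cons l r _ ih => simp [append]; omega

theorem size_filterNe_le (m a : Dat) : (filterNe m a).size ≤ a.size := by
  induction a with
  | nil => rfl
  | cons l r _ ih => simp only [filterNe]; split_ifs <;> simp <;> omega

theorem size_reverse (a : Dat) : (reverse a).size = a.size := by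
  induction a with
  | nil => rfl
  | cons l r _ ih =>
    have := size_append (reverse r) (cons l nil)
    simp [reverse] at this ⊢; omega

/-- Assigning a literal in a clause list: clauses containing the satisfied literal `p` are dropped,
the falsified literal `m` is removed. -/
def cnfAssign (lits : Dat) : Dat → Dat
  | nil => nil
  | cons c r =>
    if lits.fst ∈ c.toList then cnfAssign lits r
    else cons (filterNe lits.snd c) (cnfAssign lits r)

/-- A clause list as a state; `nil` stands for a clause list with an empty clause. -/
def leaf (T : Dat) : Dat := if nil ∈ T.toList then nil else cons nil T

def leafAssign (lits s : Dat) : Dat := ite s (leaf (cnfAssign lits s.snd)) nil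

/-- The canonical state for a list of states below a quantifier. -/
def collect (Q raw : Dat) : Dat :=
  ite Q (if nil ∈ raw.toList then nil else sort raw) (sort (filterNe nil raw))

theorem size_cnfAssign_le (lits a : Dat) : (cnfAssign lits a).size ≤ a.size := by
  induction a with
  | nil => rfl
  | cons l r _ ih =>
    have := size_filterNe_le lits.snd l
    simp only [cnfAssign]; split_ifs <;> simp <;> omega

theorem size_leaf_le (T : Dat) : (leaf T).size ≤ T.size + 2 := by
  simp only [leaf]; split_ifs <;> simp; omega

theorem size_leafAssign_le (lits s : Dat) : (leafAssign lits s).size ≤ s.size := by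
  cases s with
  | nil => simp [leafAssign]
  | cons l r =>
    have h1 := size_leaf_le (cnfAssign lits r)
    have h2 := size_cnfAssign_le lits r
    have h3 := l.size_pos
    simp only [leafAssign, ite_cons, snd_cons, size_cons]; omega

theorem size_collect_le (Q raw : Dat) : (collect Q raw).size ≤ raw.size := by
  have h1 := size_sort_le raw
  have h2 := size_sort_le (filterNe nil raw)
  have h3 := size_filterNe_le nil raw
  have h4 := raw.size_pos
  cases Q
  · simp only [collect, ite_nil]; omega
  · simp only [collect, ite_cons]; split_ifs
    · simp; omega
    · exact h1

/-- The state above the raw list `raw` of successors; `p` consists of the list of levels and the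
pair of the satisfied and the falsified literal. -/
def finish (p e raw : Dat) : Dat :=
  ite p.fst (collect p.fst.fst.fst raw) (leafAssign p.snd e)

def dropLevel : Dat → Dat
  | nil => nil
  | cons ls lits => cons ls.snd lits

/-- One tree recursion handles all levels at once: the left subtree is an element of the set, one
level further down, and the right subtree is the rest of the set. Below the last level the recursive
value is meaningless, and `finish` ignores it. -/
def assignRaw : Dat → Dat → Dat
  | _, nil => nil
  | p, cons e r => cons (finish (dropLevel p) e (assignRaw (dropLevel p) e)) (assignRaw p r)

/-- The state after assigning a literal. -/
def assign (p s : Dat) : Dat := finish p s (assignRaw p s)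

def swapLits (p : Dat) : Dat := cons p.fst (cons p.snd.snd p.snd.fst)

/-- A variable is quantified on at most one level. On that level every element is replaced by its
two cofactors, computed by `assign`; the opposite value is obtained by swapping the satisfied and
the falsified literal. Above that level the recursion only passes through. -/
def stepRaw : Dat → Dat → Dat
  | _, nil => nil
  | p, cons e r =>
    if p.snd.fst.fst ∈ p.fst.fst.snd.toList then
      cons (assign (dropLevel p) e) (cons (assign (swapLits (dropLevel p)) e) (stepRaw p r))
    else cons (finish (dropLevel p) e (stepRaw (dropLevel p) e)) (stepRaw p r)

/-- The state after reading a variable: both values are taken into account if the variable is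
quantified on some level, otherwise the first literal is set to true. -/
def step (p s : Dat) : Dat := finish p s (stepRaw p s)

theorem size_finish_le {p e raw : Dat} {m : ℕ} (h : raw.size ≤ m) (h' : e.size ≤ m) :
    (finish p e raw).size ≤ m := by
  have h1 := size_leafAssign_le p.snd e
  have h2 := size_collect_le p.fst.fst.fst raw
  simp only [finish]
  cases hp : p.fst
  · simp only [ite_nil]; omega
  · rw [← hp, hp, ite_cons, ← hp]; omega

theorem size_assignRaw_le (p s : Dat) : (assignRaw p s).size ≤ s.size := by
  induction s generalizing p with
  | nil => simp [assignRaw]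
  | cons e r ih₁ ih₂ =>
    have := size_finish_le (p := dropLevel p) (ih₁ (dropLevel p)) le_rfl
    have := ih₂ p
    simp only [assignRaw, size_cons]; omega

theorem size_assign_le (p s : Dat) : (assign p s).size ≤ s.size :=
  size_finish_le (size_assignRaw_le p s) le_rfl

/-- Elements are doubled only where the recursion meets the level of the variable; below it `assign`
takes over and does not enlarge anything. Hence the factor 2 does not accumulate over the levels. -/
theorem size_stepRaw_le (p s : Dat) : (stepRaw p s).size ≤ 2 * s.size := by
  induction s generalizing p with
  | nil => simp [stepRaw]
  | cons e r ih₁ ih₂ =>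
    have h1 := size_finish_le (p := dropLevel p) (e := e) (ih₁ (dropLevel p)) (by omega)
    have h2 := ih₂ p
    have h3 := size_assign_le (dropLevel p) e
    have h4 := size_assign_le (swapLits (dropLevel p)) e
    simp only [stepRaw]
    split_ifs <;> simp only [size_cons] <;> omega

theorem size_step_le (p s : Dat) : (step p s).size ≤ 2 * s.size :=
  size_finish_le (size_stepRaw_le p s) (by omega)

/-- The preorder traversal is a prefix-free code; it turns pairs of data into keys of binary tries.
-/
def serBits : Dat → List Bool
  | nil => [false]
  | cons l r => true :: (serBits l ++ serBits r)

theorem serBits_append_inj : ∀ {a b : Dat} {u v : List Bool},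
    serBits a ++ u = serBits b ++ v → a = b ∧ u = v
  | nil, nil, _, _, h => by simpa [serBits] using h
  | nil, cons _ _, _, _, h => by simp [serBits] at h
  | cons _ _, nil, _, _, h => by simp [serBits] at h
  | cons a b, cons c d, u, v, h => by
    simp only [serBits, List.cons_append, List.append_assoc, List.cons.injEq, true_and] at h
    obtain ⟨h₁, h⟩ := serBits_append_inj h
    obtain ⟨h₂, h⟩ := serBits_append_inj h
    exact ⟨by rw [h₁, h₂], h⟩

theorem serBits_injective : Function.Injective serBits := fun a b h =>
  (serBits_append_inj (u := []) (v := []) (by simpa using h)).1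

theorem length_serBits (a : Dat) : (serBits a).length = a.size := by
  induction a <;> simp_all [serBits]

/-- The serialization of a tree as a list of bits. -/
def ser (a : Dat) : Dat := encList encBool (serBits a)

theorem ser_cons (l r : Dat) : ser (cons l r) = cons (encBool true) (append (ser l) (ser r)) := by
  apply toList_injective; simp [ser, serBits]

theorem size_encList_le {α : Type*} {f : α → Dat} {l : List α} {m : ℕ}
    (h : ∀ x ∈ l, (f x).size ≤ m) : (encList f l).size ≤ l.length * (m + 1) + 1 := by
  induction l with
  | nil => simp [encList]
  | cons x l ih =>
    have h1 := h x (by simp)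
    have h2 := ih fun y hy => h y (by simp [hy])
    simp [encList, add_mul]; omega

theorem size_ser_le (a : Dat) : (ser a).size ≤ 4 * a.size + 1 := by
  have := size_encList_le (f := encBool) (l := serBits a) (m := 3) fun x _ => size_encBool_le x
  rw [length_serBits] at this
  simp only [ser]; omega

/-- The successor of a binary number. -/
def inc : Dat → Dat
  | nil => cons (encBool true) nil
  | cons b r => ite b (cons (encBool false) (inc r)) (cons (encBool true) r)

theorem inc_encNat (m : ℕ) : inc (encNat m) = encNat (m + 1) := by
  induction m using Nat.binaryRec' with
  | zero => simp [encNat, encList, inc]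
  | bit b m h ih =>
    rw [encNat, Nat.bits_append_bit _ _ h]
    cases b with
    | false =>
      have : Nat.bit false m + 1 = Nat.bit true m := by simp [Nat.bit]
      rw [this, encNat, Nat.bits_append_bit _ _ (by simp)]
      simp [encList, inc, encBool]
    | true =>
      have : Nat.bit true m + 1 = Nat.bit false (m + 1) := by simp [Nat.bit]; ring
      rw [this, encNat, Nat.bits_append_bit _ _ (by simp)]
      simp only [encList, inc, ite_encBool, if_true]
      exact congrArg _ ih

theorem size_inc_le (m : Dat) : (inc m).size ≤ m.size + 4 := by
  induction m with
  | nil => simp [inc, encBool]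
  | cons b r _ ih =>
    cases b
    · simp [inc, encBool]; omega
    · simp [inc, encBool]; omega

/-- Adding a variable to the left of a list of levels. -/
def addLevel (x Q ls : Dat) : Dat :=
  ite ls (if Q = ls.fst.fst then cons (cons Q (cons x ls.fst.snd)) ls.snd
    else cons (cons Q (cons x nil)) ls) (cons (cons Q (cons x nil)) nil)

/-- A false state stays `nil` instead of becoming the singleton of `nil`, since `nil` is never an
element of a canonical state. -/
def wrap (s : Dat) : Dat → Dat
  | nil => s
  | cons _ r => ite (wrap s r) (cons (wrap s r) nil) nil

/-- The initial state for a list of levels and a list of clauses. -/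
def initState (ls T : Dat) : Dat := wrap (leaf T) ls

/-- The clauses of the items that contain the variable `x`; an item consists of a list of clauses
and a list of variables. -/
def bucketClauses (x : Dat) : Dat → Dat
  | nil => nil
  | cons it r =>
    if x ∈ it.snd.toList then append it.fst (bucketClauses x r) else bucketClauses x r

/-- The items that do not contain the variable `x`. -/
def otherItems (x : Dat) : Dat → Dat
  | nil => nil
  | cons it r => if x ∈ it.snd.toList then otherItems x r else cons it (otherItems x r)

def allClauses : Dat → Dat
  | nil => nil
  | cons it r => append it.fst (allClauses r)

def clauseVars : Dat → Dat
  | nil => nil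
  | cons l r => cons l.fst (clauseVars r)

def clauseItems : Dat → Dat
  | nil => nil
  | cons c r => cons (cons (cons c nil) (clauseVars c)) (clauseItems r)

/-- Numbers the elements of a list from the right; the second component is the length. -/
def enumRight : Dat → Dat
  | nil => cons nil nil
  | cons q r =>
    cons (cons (cons (enumRight r).snd q) (enumRight r).fst) (inc (enumRight r).snd)

theorem size_wrap_le (s ls : Dat) : (wrap s ls).size ≤ s.size + 2 * ls.size := by
  induction ls with
  | nil => simp [wrap]
  | cons a r _ ih =>
    simp only [wrap]
    cases h : wrap s r <;> simp [h] at ih ⊢ <;> omega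

theorem size_initState_le (ls T : Dat) : (initState ls T).size ≤ T.size + 2 * ls.size + 2 := by
  have := size_wrap_le (leaf T) ls
  have := size_leaf_le T
  simp only [initState]; omega

theorem size_bucketClauses_le (x t : Dat) : (bucketClauses x t).size ≤ t.size := by
  induction t with
  | nil => simp [bucketClauses]
  | cons it r _ ih =>
    have := size_append it.fst (bucketClauses x r)
    have := it.size_fst_le
    simp only [bucketClauses]; split_ifs <;> simp <;> omega

theorem size_otherItems_le (x t : Dat) : (otherItems x t).size ≤ t.size := by
  induction t with
  | nil => simp [otherItems]
  | cons it r _ ih => simp only [otherItems]; split_ifs <;> simp <;> omega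

theorem size_allClauses_le (t : Dat) : (allClauses t).size ≤ t.size := by
  induction t with
  | nil => simp [allClauses]
  | cons it r _ ih =>
    have := size_append it.fst (allClauses r)
    have := it.size_fst_le
    simp only [allClauses, size_cons]; omega

theorem size_clauseVars_le (t : Dat) : (clauseVars t).size ≤ t.size := by
  induction t with
  | nil => simp [clauseVars]
  | cons it r _ ih =>
    have := it.size_fst_le
    simp only [clauseVars, size_cons]; omega

theorem size_clauseItems_le (t : Dat) : (clauseItems t).size ≤ 5 * t.size := by
  induction t with
  | nil => simp [clauseItems]
  | cons it r _ ih =>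
    have := size_clauseVars_le it
    have := it.size_pos
    simp only [clauseItems, size_cons, size_nil]; omega

theorem size_enumRight_le (t : Dat) :
    (enumRight t).snd.size ≤ 4 * t.size ∧ (enumRight t).fst.size ≤ 6 * t.size * t.size := by
  induction t with
  | nil => simp [enumRight]
  | cons q r _ ih =>
    have := size_inc_le (enumRight r).snd
    have := q.size_pos
    have := r.size_pos
    simp only [enumRight, size_cons, fst_cons, snd_cons]
    exact ⟨by omega, by nlinarith⟩

end Dat

/-! ### Polynomial time for these operations -/

namespace PolyTime

variable {a b c d : Dat → Dat}

@[fun_prop] theorem iteDecide {p : Dat → Prop} [DecidablePred p]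
    (hp : PolyTime fun w => encBool (decide (p w))) (ha : PolyTime a) (hb : PolyTime b) :
    PolyTime fun w => if p w then a w else b w := by
  simpa using hp.ite ha hb

theorem ifMem (ha : PolyTime a) (hb : PolyTime b) (hc : PolyTime c) (hd : PolyTime d) :
    PolyTime fun w => if a w ∈ (b w).toList then c w else d w :=
  iteDecide (memD ha hb) hc hd

theorem ifEq (ha : PolyTime a) (hb : PolyTime b) (hc : PolyTime c) (hd : PolyTime d) :
    PolyTime fun w => if a w = b w then c w else d w :=
  iteDecide (eqD ha hb) hc hd

@[fun_prop] theorem appendD (ha : PolyTime a) (hb : PolyTime b) :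
    PolyTime fun w => Dat.append (a w) (b w) := by
  refine PolyTime.comp₂ (F := fun p t => Dat.append t p) ?_ hb ha
  refine listRec (F := fun p t => Dat.append t p) (z := fun p => p) (g := fun p l r y => Dat.cons l y)
    (fun p => rfl) (fun p l r => rfl) (by fun_prop) (by fun_prop)
    (exists_pow_bound' 1 fun p t => ?_)
  have := Dat.size_append t p
  omega

@[fun_prop] theorem filterNeD (ha : PolyTime a) (hb : PolyTime b) :
    PolyTime fun w => Dat.filterNe (a w) (b w) := by
  refine PolyTime.comp₂ (F := Dat.filterNe) ?_ ha hb
  refine listRec (F := Dat.filterNe) (z := fun p => Dat.nil) (g := fun p l r y => if l = p then y else Dat.cons l y)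
    (fun p => rfl) (fun p l r => rfl) (by fun_prop)
    (ifEq (by fun_prop) (by fun_prop) (by fun_prop) (by fun_prop))
    (exists_pow_bound' 1 fun p t => ?_)
  have := Dat.size_filterNe_le p t
  omega

@[fun_prop] theorem reverseD (ha : PolyTime a) : PolyTime fun w => Dat.reverse (a w) := by
  refine PolyTime.comp₂ (F := fun _ t => Dat.reverse t) ?_ nil ha
  refine listRec (F := fun _ t => Dat.reverse t) (z := fun p => Dat.nil)
    (g := fun p l r y => Dat.append y (Dat.cons l Dat.nil))
    (fun p => rfl) (fun p l r => rfl) (by fun_prop) (by fun_prop)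
    (exists_pow_bound' 1 fun p t => ?_)
  have := Dat.size_reverse t
  omega

@[fun_prop] theorem cnfAssignD (ha : PolyTime a) (hb : PolyTime b) :
    PolyTime fun w => Dat.cnfAssign (a w) (b w) := by
  refine PolyTime.comp₂ (F := Dat.cnfAssign) ?_ ha hb
  refine listRec (F := Dat.cnfAssign) (z := fun p => Dat.nil)
    (g := fun p l r y => if p.fst ∈ l.toList then y else Dat.cons (Dat.filterNe p.snd l) y)
    (fun p => rfl) (fun p l r => rfl) (by fun_prop)
    (ifMem (by fun_prop) (by fun_prop) (by fun_prop) (by fun_prop))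
    (exists_pow_bound' 1 fun p t => ?_)
  have := Dat.size_cnfAssign_le p t
  omega

@[fun_prop] theorem leafD (ha : PolyTime a) : PolyTime fun w => Dat.leaf (a w) :=
  ifMem (by fun_prop) (by fun_prop) (by fun_prop) (by fun_prop)

@[fun_prop] theorem leafAssignD (ha : PolyTime a) (hb : PolyTime b) :
    PolyTime fun w => Dat.leafAssign (a w) (b w) := by
  unfold Dat.leafAssign; fun_prop

@[fun_prop] theorem collectD (ha : PolyTime a) (hb : PolyTime b) :
    PolyTime fun w => Dat.collect (a w) (b w) :=
  ite ha (ifMem (by fun_prop) (by fun_prop) (by fun_prop) (by fun_prop)) (by fun_prop)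

@[fun_prop] theorem finishD (ha : PolyTime a) (hb : PolyTime b) (hc : PolyTime c) :
    PolyTime fun w => Dat.finish (a w) (b w) (c w) := by
  unfold Dat.finish; fun_prop

@[fun_prop] theorem dropLevelD (ha : PolyTime a) : PolyTime fun w => Dat.dropLevel (a w) := by
  have : ∀ p, Dat.dropLevel p = Dat.ite p (Dat.cons p.fst.snd p.snd) Dat.nil := fun p => by
    cases p <;> rfl
  simp only [this]; fun_prop

@[fun_prop] theorem swapLitsD (ha : PolyTime a) : PolyTime fun w => Dat.swapLits (a w) := by
  unfold Dat.swapLits; fun_prop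

theorem size_dropLevel_le (p : Dat) : (Dat.dropLevel p).size ≤ p.size := by
  cases p with
  | nil => rfl
  | cons l r => have := l.size_snd_le; simp [Dat.dropLevel]; omega


@[fun_prop] theorem assignD (ha : PolyTime a) (hb : PolyTime b) :
    PolyTime fun w => Dat.assign (a w) (b w) := by
  have : PolyTime fun w => Dat.assignRaw w.fst w.snd := by
    refine treeRec (F := Dat.assignRaw) (z := fun p => Dat.nil) (h₁ := Dat.dropLevel)
      (h₂ := fun p => p) (g := fun p l r x y => Dat.cons (Dat.finish (Dat.dropLevel p) l x) y)
      (fun p => rfl) (fun p l r => rfl) (by fun_prop) (by fun_prop) (by fun_prop) (by fun_prop)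
      size_dropLevel_le (fun _ => le_rfl) (exists_pow_bound' 1 fun p t => ?_)
    have := Dat.size_assignRaw_le p t
    omega
  exact PolyTime.finishD ha hb (comp₂ this ha hb)

@[fun_prop] theorem stepD (ha : PolyTime a) (hb : PolyTime b) :
    PolyTime fun w => Dat.step (a w) (b w) := by
  have : PolyTime fun w => Dat.stepRaw w.fst w.snd := by
    refine treeRec (F := Dat.stepRaw) (z := fun p => Dat.nil) (h₁ := Dat.dropLevel)
      (h₂ := fun p => p) (g := fun p l r x y =>
        if p.snd.fst.fst ∈ p.fst.fst.snd.toList then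
          Dat.cons (Dat.assign (Dat.dropLevel p) l)
            (Dat.cons (Dat.assign (Dat.swapLits (Dat.dropLevel p)) l) y)
        else Dat.cons (Dat.finish (Dat.dropLevel p) l x) y)
      (fun p => rfl) (fun p l r => rfl) (by fun_prop)
      (ifMem (by fun_prop) (by fun_prop) (by fun_prop) (by fun_prop)) (by fun_prop) (by fun_prop)
      size_dropLevel_le (fun _ => le_rfl) (exists_pow_bound' 2 fun p t => ?_)
    have := Dat.size_stepRaw_le p t
    omega
  exact PolyTime.finishD ha hb (comp₂ this ha hb)

@[fun_prop] theorem serD (ha : PolyTime a) : PolyTime fun w => Dat.ser (a w) := by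
  refine PolyTime.comp₂ (F := fun _ t => Dat.ser t) ?_ nil ha
  refine treeRec (F := fun _ t => Dat.ser t) (z := fun p => Dat.cons (encBool false) Dat.nil)
    (h₁ := fun p => p) (h₂ := fun p => p)
    (g := fun p l r x y => Dat.cons (encBool true) (Dat.append x y))
    (fun p => rfl) (fun p l r => Dat.ser_cons l r) (by fun_prop) (by fun_prop) (by fun_prop)
    (by fun_prop) (fun _ => le_rfl) (fun _ => le_rfl) (exists_pow_bound' 4 fun p t => ?_)
  have := Dat.size_ser_le t
  omega

@[fun_prop] theorem incD (ha : PolyTime a) : PolyTime fun w => Dat.inc (a w) := by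
  refine PolyTime.comp₂ (F := fun _ t => Dat.inc t) ?_ nil ha
  refine listRec (F := fun _ t => Dat.inc t) (z := fun p => Dat.cons (encBool true) Dat.nil)
    (g := fun p l r y => Dat.ite l (Dat.cons (encBool false) y) (Dat.cons (encBool true) r))
    (fun p => rfl) (fun p l r => rfl) (by fun_prop) (by fun_prop)
    (exists_pow_bound' 4 fun p t => ?_)
  have := Dat.size_inc_le t
  omega

@[fun_prop] theorem addLevelD (ha : PolyTime a) (hb : PolyTime b) (hc : PolyTime c) :
    PolyTime fun w => Dat.addLevel (a w) (b w) (c w) :=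
  ite hc (ifEq (by fun_prop) (by fun_prop) (by fun_prop) (by fun_prop)) (by fun_prop)

@[fun_prop] theorem initStateD (ha : PolyTime a) (hb : PolyTime b) :
    PolyTime fun w => Dat.initState (a w) (b w) := by
  refine PolyTime.comp₂ (F := fun s t => Dat.wrap s t) ?_ (leafD hb) ha
  refine listRec (F := fun s t => Dat.wrap s t) (z := fun p => p)
    (g := fun p l r y => Dat.ite y (Dat.cons y Dat.nil) Dat.nil)
    (fun p => rfl) (fun p l r => rfl) (by fun_prop) (by fun_prop)
    (exists_pow_bound' 2 fun p t => ?_)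
  have := Dat.size_wrap_le p t
  omega

@[fun_prop] theorem bucketClausesD (ha : PolyTime a) (hb : PolyTime b) :
    PolyTime fun w => Dat.bucketClauses (a w) (b w) := by
  refine PolyTime.comp₂ (F := Dat.bucketClauses) ?_ ha hb
  refine listRec (F := Dat.bucketClauses) (z := fun p => Dat.nil)
    (g := fun p l r y => if p ∈ l.snd.toList then Dat.append l.fst y else y)
    (fun p => rfl) (fun p l r => rfl) (by fun_prop)
    (ifMem (by fun_prop) (by fun_prop) (by fun_prop) (by fun_prop))
    (exists_pow_bound' 1 fun p t => ?_)
  have := Dat.size_bucketClauses_le p t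
  omega

@[fun_prop] theorem otherItemsD (ha : PolyTime a) (hb : PolyTime b) :
    PolyTime fun w => Dat.otherItems (a w) (b w) := by
  refine PolyTime.comp₂ (F := Dat.otherItems) ?_ ha hb
  refine listRec (F := Dat.otherItems) (z := fun p => Dat.nil)
    (g := fun p l r y => if p ∈ l.snd.toList then y else Dat.cons l y)
    (fun p => rfl) (fun p l r => rfl) (by fun_prop)
    (ifMem (by fun_prop) (by fun_prop) (by fun_prop) (by fun_prop))
    (exists_pow_bound' 1 fun p t => ?_)
  have := Dat.size_otherItems_le p t
  omega

@[fun_prop] theorem allClausesD (ha : PolyTime a) :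
    PolyTime fun w => Dat.allClauses (a w) := by
  refine PolyTime.comp₂ (F := fun _ t => Dat.allClauses t) ?_ nil ha
  refine listRec (F := fun _ t => Dat.allClauses t) (z := fun p => Dat.nil)
    (g := fun p l r y => Dat.append l.fst y)
    (fun p => rfl) (fun p l r => rfl) (by fun_prop) (by fun_prop)
    (exists_pow_bound' 1 fun p t => ?_)
  have := Dat.size_allClauses_le t
  omega

@[fun_prop] theorem clauseVarsD (ha : PolyTime a) :
    PolyTime fun w => Dat.clauseVars (a w) := by
  refine PolyTime.comp₂ (F := fun _ t => Dat.clauseVars t) ?_ nil ha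
  refine listRec (F := fun _ t => Dat.clauseVars t) (z := fun p => Dat.nil)
    (g := fun p l r y => Dat.cons l.fst y)
    (fun p => rfl) (fun p l r => rfl) (by fun_prop) (by fun_prop)
    (exists_pow_bound' 1 fun p t => ?_)
  have := Dat.size_clauseVars_le t
  omega

@[fun_prop] theorem clauseItemsD (ha : PolyTime a) :
    PolyTime fun w => Dat.clauseItems (a w) := by
  refine PolyTime.comp₂ (F := fun _ t => Dat.clauseItems t) ?_ nil ha
  refine listRec (F := fun _ t => Dat.clauseItems t) (z := fun p => Dat.nil)
    (g := fun p l r y => Dat.cons (Dat.cons (Dat.cons l Dat.nil) (Dat.clauseVars l)) y)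
    (fun p => rfl) (fun p l r => rfl) (by fun_prop) (by fun_prop)
    (exists_pow_bound' 5 fun p t => ?_)
  have := Dat.size_clauseItems_le t
  omega

@[fun_prop] theorem enumRightD (ha : PolyTime a) :
    PolyTime fun w => Dat.enumRight (a w) := by
  refine PolyTime.comp₂ (F := fun _ t => Dat.enumRight t) ?_ nil ha
  refine listRec (F := fun _ t => Dat.enumRight t) (z := fun p => Dat.cons Dat.nil Dat.nil)
    (g := fun p l r y => Dat.cons (Dat.cons (Dat.cons y.snd l) y.fst) (Dat.inc y.snd))
    (fun p => rfl) (fun p l r => rfl) (by fun_prop) (by fun_prop)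
    (exists_pow_bound 12 fun p t => ?_)
  have := Dat.size_enumRight_le t
  have h : (Dat.enumRight t).size ≤ (Dat.enumRight t).fst.size + (Dat.enumRight t).snd.size + 1 := by
    cases Dat.enumRight t <;> simp
  have h' : (t.size + 2) ^ 2 ≤ (p.size + t.size + 2) ^ 2 := Nat.pow_le_pow_left (by omega) 2
  nlinarith

end PolyTime

/-! ### Reduced node lists -/

variable {n : ℕ}

/-- A reference to a sink or to a position in a list of nodes. -/
abbrev Ref := Bool ⊕ ℕ

/-- A node with its label, its `false`-child and its `true`-child. -/
abbrev Node (n : ℕ) := Fin n × Ref × Ref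

/-- `Den N r f`: in the node list `N`, the reference `r` denotes the function `f`. -/
inductive Den (N : List (Node n)) : Ref → (Assignment n → Bool) → Prop
  | sink (b : Bool) : Den N (Sum.inl b) fun _ => b
  | node (i : ℕ) (y : Fin n) (r₀ r₁ : Ref) (f₀ f₁ : Assignment n → Bool) :
      N[i]? = some (y, r₀, r₁) → Den N r₀ f₀ → Den N r₁ f₁ →
      Den N (Sum.inr i) fun a => if a y then f₁ a else f₀ a

theorem getElem?_of_prefix {α : Type*} {l l' : List α} (h : l <+: l') {i : ℕ} {x : α}
    (hx : l[i]? = some x) : l'[i]? = some x := by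
  obtain ⟨t, rfl⟩ := h
  obtain ⟨hi, hv⟩ := List.getElem?_eq_some_iff.1 hx
  rw [List.getElem?_append_left hi, hx]

theorem Den.mono {N N' : List (Node n)} (hN : N <+: N') {r : Ref} {f : Assignment n → Bool}
    (h : Den N r f) : Den N' r f := by
  induction h with
  | sink b => exact Den.sink b
  | node i y r₀ r₁ f₀ f₁ hi _ _ ih₀ ih₁ =>
    exact Den.node i y r₀ r₁ f₀ f₁ (getElem?_of_prefix hN hi) ih₀ ih₁

theorem Den.det {N : List (Node n)} {r : Ref} {f g : Assignment n → Bool}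
    (h : Den N r f) (h' : Den N r g) : f = g := by
  induction h generalizing g with
  | sink b => cases h'; rfl
  | node i y r₀ r₁ f₀ f₁ hi _ _ ih₀ ih₁ =>
    cases h' with
    | node _ y' r₀' r₁' g₀ g₁ hi' h₀ h₁ =>
      rw [hi] at hi'
      simp only [Option.some.injEq, Prod.mk.injEq] at hi'
      obtain ⟨rfl, rfl, rfl⟩ := hi'
      rw [ih₀ h₀, ih₁ h₁]

/-- All labels of `r` are at position `p` or later. -/
def RefFrom (π : VarOrder n) (N : List (Node n)) (p : ℕ) (r : Ref) : Prop :=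
  ∀ j, r = Sum.inr j → ∃ nd, N[j]? = some nd ∧ p ≤ π nd.1

theorem RefFrom.mono {π : VarOrder n} {N N' : List (Node n)} (hN : N <+: N') {p : ℕ} {r : Ref}
    (h : RefFrom π N p r) : RefFrom π N' p r := fun j hj =>
  let ⟨nd, h₁, h₂⟩ := h j hj
  ⟨nd, getElem?_of_prefix hN h₁, h₂⟩

/-- The node list is ordered and reduced. -/
structure Reduced (π : VarOrder n) (N : List (Node n)) : Prop where
  nodup : N.Nodup
  ne : ∀ {i : ℕ} {y : Fin n} {r₀ r₁ : Ref}, N[i]? = some (y, r₀, r₁) → r₀ ≠ r₁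
  lt₀ : ∀ {i : ℕ} {y : Fin n} {j : ℕ} {r₁ : Ref}, N[i]? = some (y, Sum.inr j, r₁) → j < i
  lt₁ : ∀ {i : ℕ} {y : Fin n} {r₀ : Ref} {j : ℕ}, N[i]? = some (y, r₀, Sum.inr j) → j < i
  from₀ : ∀ {i : ℕ} {y : Fin n} {r₀ r₁ : Ref}, N[i]? = some (y, r₀, r₁) → RefFrom π N (π y + 1) r₀
  from₁ : ∀ {i : ℕ} {y : Fin n} {r₀ r₁ : Ref}, N[i]? = some (y, r₀, r₁) → RefFrom π N (π y + 1) r₁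

theorem Reduced.indep {π : VarOrder n} {N : List (Node n)} (hN : Reduced π N) {r : Ref}
    {f : Assignment n → Bool} (h : Den N r f) {p : ℕ} (hr : RefFrom π N p r)
    {a b : Assignment n} (hab : ∀ z, p ≤ π z → a z = b z) : f a = f b := by
  induction h generalizing p with
  | sink b => rfl
  | node i y r₀ r₁ f₀ f₁ hi _ _ ih₀ ih₁ =>
    obtain ⟨nd, hnd, hp⟩ := hr i rfl
    rw [hi] at hnd
    obtain rfl := Option.some.inj hnd
    simp only at hp
    have h₀ := ih₀ (hN.from₀ hi) fun z hz => hab z (by omega)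
    have h₁ := ih₁ (hN.from₁ hi) fun z hz => hab z (by omega)
    simp [hab y hp, h₀, h₁]

theorem Reduced.update {π : VarOrder n} {N : List (Node n)} (hN : Reduced π N) {r : Ref}
    {f : Assignment n → Bool} (h : Den N r f) {y : Fin n} (hr : RefFrom π N (π y + 1) r)
    (a : Assignment n) (c : Bool) : f (Function.update a y c) = f a :=
  hN.indep h hr fun z hz => Function.update_of_ne (by rintro rfl; omega) _ _

/-- Different references denote different functions. -/
theorem Reduced.canonical {π : VarOrder n} {N : List (Node n)} (hN : Reduced π N)
    {r r' : Ref} {f : Assignment n → Bool} (h : Den N r f) (h' : Den N r' f) : r = r' := by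
  -- Induction on a common bound for the indices of the two references; the children of a node have
  -- smaller indices.
  have key : ∀ m, ∀ r r' f, (∀ j, r = Sum.inr j → j < m) → (∀ j, r' = Sum.inr j → j < m) →
      Den N r f → Den N r' f → r = r' := by
    intro m
    induction m with
    | zero =>
      intro r r' f hr hr' h h'
      cases h with
      | node i => exact absurd (hr i rfl) (by omega)
      | sink b =>
        generalize hg : (fun _ : Assignment n => b) = g at h'
        cases h' with
        | node i => exact absurd (hr' i rfl) (by omega)
        | sink c => rw [show b = c from congrFun hg fun _ => false]
    | succ m ih =>
      have ne : ∀ (i : ℕ) (y : Fin n) (r₀ r₁ : Ref) (f₀ f₁ : Assignment n → Bool), i < m + 1 → N[i]? = some (y, r₀, r₁) → Den N r₀ f₀ →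
          Den N r₁ f₁ → f₀ ≠ f₁ := by
        intro i y r₀ r₁ f₀ f₁ him hi h₀ h₁ he
        subst he
        refine hN.ne hi (ih _ _ _ ?_ ?_ h₀ h₁)
        · rintro j rfl; have := hN.lt₀ hi; omega
        · rintro j rfl; have := hN.lt₁ hi; omega
      -- If the function of a node did not depend on its label, both children would denote the same
      -- function and be equal by induction, which is excluded in a reduced list.
      have indep_ne : ∀ (i : ℕ) (y : Fin n) (r₀ r₁ : Ref) (f₀ f₁ : Assignment n → Bool), i < m + 1 → N[i]? = some (y, r₀, r₁) → Den N r₀ f₀ →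
          Den N r₁ f₁ → (∀ a c, (fun a => if a y then f₁ a else f₀ a) (Function.update a y c) =
            (fun a => if a y then f₁ a else f₀ a) a) → False := by
        intro i y r₀ r₁ f₀ f₁ him hi h₀ h₁ hu
        refine ne i y r₀ r₁ f₀ f₁ him hi h₀ h₁ (funext fun a => ?_)
        have u₀ := hu a false
        have u₁ := hu a true
        simp only [Function.update_self] at u₀ u₁
        rw [hN.update h₀ (hN.from₀ hi)] at u₀
        rw [hN.update h₁ (hN.from₁ hi)] at u₁
        simp only [if_true, Bool.false_eq_true, if_false] at u₀ u₁
        exact u₀.trans u₁.symm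
      have child : ∀ (i : ℕ) (y : Fin n) (r₀ r₁ : Ref) (f₀ f₁ : Assignment n → Bool), N[i]? = some (y, r₀, r₁) → Den N r₀ f₀ → Den N r₁ f₁ →
          ∀ a, f₀ a = (fun a => if a y then f₁ a else f₀ a) (Function.update a y false) ∧
            f₁ a = (fun a => if a y then f₁ a else f₀ a) (Function.update a y true) := by
        intro i y r₀ r₁ f₀ f₁ hi h₀ h₁ a
        simp [hN.update h₀ (hN.from₀ hi), hN.update h₁ (hN.from₁ hi)]
      intro r r' f hr hr' h h'
      cases h with
      | sink b =>
        generalize hg : (fun _ : Assignment n => b) = g at h'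
        cases h' with
        | sink c => rw [show b = c from congrFun hg fun _ => false]
        | node i y r₀ r₁ f₀ f₁ hi h₀ h₁ =>
          exact (indep_ne i y r₀ r₁ f₀ f₁ (hr' i rfl) hi h₀ h₁ fun a c => by rw [← hg]).elim
      | node i y r₀ r₁ f₀ f₁ hi h₀ h₁ =>
        have hD := Den.node i y r₀ r₁ f₀ f₁ hi h₀ h₁
        have hD' := h'
        generalize hg : (fun a : Assignment n => if a y then f₁ a else f₀ a) = g at h' hD hD'
        cases h' with
        | sink c =>
          exact (indep_ne i y r₀ r₁ f₀ f₁ (hr i rfl) hi h₀ h₁ fun a c => by rw [hg]).elim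
        | node i' y' r₀' r₁' g₀ g₁ hi' h₀' h₁' =>
          have fr : RefFrom π N (π y) (Sum.inr i) := by
            rintro j ⟨⟩; exact ⟨_, hi, le_rfl⟩
          have fr' : RefFrom π N (π y') (Sum.inr i') := by
            rintro j ⟨⟩; exact ⟨_, hi', le_rfl⟩
          -- The function depends on the label of each node, but on no variable before the label of
          -- the other node; hence the labels agree. Then the children denote the same cofactors and
          -- agree by induction.
          rcases lt_trichotomy (π y) (π y') with hlt | heq | hlt
          · refine (indep_ne i y r₀ r₁ f₀ f₁ (hr i rfl) hi h₀ h₁ fun a c => ?_).elim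
            rw [hg]
            exact hN.indep hD' fr' fun z hz => Function.update_of_ne (by
              rintro rfl; exact absurd hz (by simpa using hlt)) _ _
          · obtain rfl := π.injective heq
            have e₀ : f₀ = g₀ := funext fun a => by
              rw [(child i y r₀ r₁ f₀ f₁ hi h₀ h₁ a).1, hg,
                (child i' y r₀' r₁' g₀ g₁ hi' h₀' h₁' a).1]
            have e₁ : f₁ = g₁ := funext fun a => by
              rw [(child i y r₀ r₁ f₀ f₁ hi h₀ h₁ a).2, hg,
                (child i' y r₀' r₁' g₀ g₁ hi' h₀' h₁' a).2]
            subst e₀ e₁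
            have hi_lt := hr i rfl
            have hi_lt' := hr' i' rfl
            have q₀ : r₀ = r₀' := ih _ _ _
              (by rintro j rfl; have := hN.lt₀ hi; omega)
              (by rintro j rfl; have := hN.lt₀ hi'; omega) h₀ h₀'
            have q₁ : r₁ = r₁' := ih _ _ _
              (by rintro j rfl; have := hN.lt₁ hi; omega)
              (by rintro j rfl; have := hN.lt₁ hi'; omega) h₁ h₁'
            subst q₀ q₁
            obtain ⟨hl, hv⟩ := List.getElem?_eq_some_iff.1 hi
            obtain ⟨hl', hv'⟩ := List.getElem?_eq_some_iff.1 hi'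
            rw [(List.Nodup.getElem_inj_iff hN.nodup).1 (hv.trans hv'.symm)]
          · refine (indep_ne i' y' r₀' r₁' g₀ g₁ (hr' i' rfl) hi' h₀' h₁' fun a c => ?_).elim
            exact hN.indep hD fr fun z hz => Function.update_of_ne (by
              rintro rfl; exact absurd hz (by simpa using hlt)) _ _
  have bound : ∀ r : Ref, ∃ m, ∀ j, r = Sum.inr j → j < m := by
    rintro (b | i)
    · exact ⟨0, by simp⟩
    · exact ⟨i + 1, by simp⟩
  obtain ⟨m, hm⟩ := bound r
  obtain ⟨m', hm'⟩ := bound r'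
  exact key (max m m') r r' f (fun j hj => (hm j hj).trans_le (le_max_left _ _))
    (fun j hj => (hm' j hj).trans_le (le_max_right _ _)) h h'

/-- The children are different references, hence denote different functions, and these functions are
the two cofactors with respect to the label. -/
theorem Reduced.essential {π : VarOrder n} {N : List (Node n)} (hN : Reduced π N) {i : ℕ}
    {y : Fin n} {r₀ r₁ : Ref} (hi : N[i]? = some (y, r₀, r₁)) {f : Assignment n → Bool}
    (h : Den N (Sum.inr i) f) :
    ∃ a, f (Function.update a y false) ≠ f (Function.update a y true) := by
  cases h with
  | node _ y' r₀' r₁' f₀ f₁ hi' h₀ h₁ =>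
    rw [hi] at hi'
    simp only [Option.some.injEq, Prod.mk.injEq] at hi'
    obtain ⟨rfl, rfl, rfl⟩ := hi'
    have hne : f₀ ≠ f₁ := fun he => hN.ne hi (hN.canonical h₀ (he ▸ h₁))
    obtain ⟨a, ha⟩ := Function.ne_iff.1 hne
    refine ⟨a, ?_⟩
    simpa [hN.update h₀ (hN.from₀ hi), hN.update h₁ (hN.from₁ hi)] using ha

/-! ### Evaluation of ordered branching programs -/

namespace OBDD

/-- The value of a reference. -/
def evalFrom (B : OBDD n) (r : Bool ⊕ Fin B.numNodes) (a : Assignment n) : Bool :=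
  decide ((B.step a)^[n] r = Sum.inl true)

theorem step_iterate_inl (B : OBDD n) (a : Assignment n) (b : Bool) (m : ℕ) :
    (B.step a)^[m] (Sum.inl b) = Sum.inl b := by
  induction m with
  | zero => rfl
  | succ m ih => rw [Function.iterate_succ_apply]; exact ih

/-- Positions strictly increase along a path, so `m` steps suffice if at most `m` positions remain,
the current one included. -/
theorem IsOrdered.reaches_sink {π : VarOrder n} {B : OBDD n} (hB : B.IsOrdered π)
    (a : Assignment n) (m : ℕ) (r : Bool ⊕ Fin B.numNodes)
    (hr : ∀ v, r = Sum.inr v → n ≤ π (B.label v) + m) : ∃ b, (B.step a)^[m] r = Sum.inl b := by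
  induction m generalizing r with
  | zero =>
    cases r with
    | inl b => exact ⟨b, rfl⟩
    | inr v => have := hr v rfl; have := (π (B.label v)).isLt; omega
  | succ m ih =>
    rw [Function.iterate_succ_apply]
    cases r with
    | inl b => exact ⟨b, step_iterate_inl B a b m⟩
    | inr v =>
      refine ih _ fun w hw => ?_
      have h₁ := hB v _ w hw
      have h₂ := hr v rfl
      have h₃ : (π (B.label v) : ℕ) < π (B.label w) := h₁
      omega

@[simp] theorem evalFrom_inl (B : OBDD n) (b : Bool) (a : Assignment n) :
    B.evalFrom (Sum.inl b) a = b := by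
  simp [evalFrom, step_iterate_inl]

/-- `n` steps from the node already end in a sink, so one further step changes nothing, although
evaluation from the child spends `n` steps again. -/
theorem IsOrdered.evalFrom_inr {π : VarOrder n} {B : OBDD n} (hB : B.IsOrdered π)
    (v : Fin B.numNodes) (a : Assignment n) :
    B.evalFrom (Sum.inr v) a = B.evalFrom (B.child v (a (B.label v))) a := by
  obtain ⟨b, hb⟩ := hB.reaches_sink a n (Sum.inr v) fun w _ => Nat.le_add_left _ _
  have h : (B.step a)^[n] (B.child v (a (B.label v))) = Sum.inl b := by
    change (B.step a)^[n] (B.step a (Sum.inr v)) = _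
    rw [← Function.iterate_succ_apply, Function.iterate_succ_apply', hb]
    rfl
  simp [evalFrom, hb, h]

theorem IsOrdered.evalFrom_congr {π : VarOrder n} {B : OBDD n} (hB : B.IsOrdered π) (p : ℕ)
    {a b : Assignment n} (hab : ∀ z, p ≤ π z → a z = b z) (r : Bool ⊕ Fin B.numNodes)
    (hr : ∀ v, r = Sum.inr v → p ≤ π (B.label v)) : B.evalFrom r a = B.evalFrom r b := by
  have key : ∀ m r, (∀ v, r = Sum.inr v → n ≤ π (B.label v) + m ∧ p ≤ π (B.label v)) →
      B.evalFrom r a = B.evalFrom r b := by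
    intro m
    induction m with
    | zero =>
      intro r h
      cases r with
      | inl c => simp
      | inr v => have := h v rfl; have := (π (B.label v)).isLt; omega
    | succ m ih =>
      intro r h
      cases r with
      | inl c => simp
      | inr v =>
        have h₂ := h v rfl
        rw [hB.evalFrom_inr, hB.evalFrom_inr, hab _ h₂.2]
        refine ih _ fun w hw => ?_
        have h₃ : (π (B.label v) : ℕ) < π (B.label w) := hB v _ w hw
        omega
  exact key n r fun v hv => ⟨Nat.le_add_left _ _, hr v hv⟩

/-- A variable that is not a label is not essential. -/
theorem eval_update {B : OBDD n} {x : Fin n} (hx : x ∉ B.vars) (a : Assignment n) (c : Bool) :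
    B.eval (Function.update a x c) = B.eval a := by
  have : B.step (Function.update a x c) = B.step a := by
    funext r
    cases r with
    | inl b => rfl
    | inr v =>
      have : B.label v ≠ x := fun h => hx (by simp [vars, ← h])
      simp [step, this]
  simp [eval, this]

end OBDD

/-- The assignment that agrees with `a` before position `p` and with `b` from `p` on. -/
def mixAt (π : VarOrder n) (p : ℕ) (a b : Assignment n) : Assignment n :=
  fun z => if (π z : ℕ) < p then a z else b z

theorem mixAt_update (π : VarOrder n) (y : Fin n) (a b : Assignment n) (d : Bool) :
    mixAt π (π y) a (Function.update b y d) = Function.update (mixAt π (π y) a b) y d := by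
  funext z
  by_cases hz : z = y
  · subst hz; simp [mixAt]
  · simp [mixAt, hz]

/-- The reference is found by following the path of `a` as long as the labels lie before position
`p`. -/
theorem OBDD.IsOrdered.exists_cofactor {π : VarOrder n} {B : OBDD n} (hB : B.IsOrdered π) (p : ℕ)
    (a : Assignment n) (r : Bool ⊕ Fin B.numNodes) :
    ∃ r' : Bool ⊕ Fin B.numNodes, (∀ v, r' = Sum.inr v → p ≤ π (B.label v)) ∧
      ∀ b, B.evalFrom r' b = B.evalFrom r (mixAt π p a b) := by
  have key : ∀ (m : ℕ) (r : Bool ⊕ Fin B.numNodes),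
      (∀ v, r = Sum.inr v → n ≤ π (B.label v) + m) →
      ∃ r' : Bool ⊕ Fin B.numNodes, (∀ v, r' = Sum.inr v → p ≤ π (B.label v)) ∧
        ∀ b, B.evalFrom r' b = B.evalFrom r (mixAt π p a b) := by
    intro m
    induction m with
    | zero =>
      intro r h
      cases r with
      | inl c => exact ⟨Sum.inl c, by simp, by simp⟩
      | inr v => have := h v rfl; have := (π (B.label v)).isLt; omega
    | succ m ih =>
      intro r h
      cases r with
      | inl c => exact ⟨Sum.inl c, by simp, by simp⟩
      | inr v =>
        by_cases hv : p ≤ π (B.label v)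
        · refine ⟨Sum.inr v, fun w hw => by obtain rfl := Sum.inr.inj hw; exact hv, fun b => ?_⟩
          refine hB.evalFrom_congr p (fun z hz => ?_) _
            fun w hw => by obtain rfl := Sum.inr.inj hw; exact hv
          simp [mixAt, hz]
        · have h₂ := h v rfl
          obtain ⟨r', h₃, h₄⟩ := ih (B.child v (a (B.label v))) fun w hw => by
            have h₃ : (π (B.label v) : ℕ) < π (B.label w) := hB v _ w hw
            omega
          refine ⟨r', h₃, fun b => ?_⟩
          rw [h₄, hB.evalFrom_inr]
          simp [mixAt, not_le.1 hv]
  exact key n r fun v _ => Nat.le_add_left _ _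

/-! ### From node lists to branching programs -/

/-- A valid reference as a reference of a branching program. -/
def Ref.toFin (m : ℕ) : Ref → Bool ⊕ Fin m
  | Sum.inl b => Sum.inl b
  | Sum.inr j => if h : j < m then Sum.inr ⟨j, h⟩ else Sum.inl false

def nodesToOBDD (N : List (Node n)) (r : Ref) : OBDD n where
  numNodes := N.length
  label v := (N[v]).1
  child v c := Ref.toFin N.length (if c then (N[v]).2.2 else (N[v]).2.1)
  root := Ref.toFin N.length r

theorem toFin_eq_inr {m : ℕ} {r : Ref} {v : Fin m} (h : Ref.toFin m r = Sum.inr v) :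
    r = Sum.inr v.val := by
  cases r with
  | inl b => simp [Ref.toFin] at h
  | inr j =>
    simp only [Ref.toFin] at h
    split_ifs at h
    rw [← Sum.inr.inj h]

theorem Reduced.isOrdered {π : VarOrder n} {N : List (Node n)} (hN : Reduced π N) (r : Ref) :
    (nodesToOBDD N r).IsOrdered π := by
  intro v c w h
  have hv : N[v.val]? = some ((N[v]).1, (N[v]).2.1, (N[v]).2.2) :=
    List.getElem?_eq_getElem (show v.val < N.length from v.isLt)
  have hw := toFin_eq_inr h
  have : RefFrom π N (π (N[v]).1 + 1) (Sum.inr w.val) := by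
    rw [← hw]
    cases c
    · exact hN.from₀ hv
    · exact hN.from₁ hv
  obtain ⟨nd, hnd, hlt⟩ := this _ rfl
  have : nd = N[w] := by
    have hw' : w.val < N.length := w.isLt
    rw [List.getElem?_eq_getElem hw'] at hnd
    exact (Option.some.inj hnd).symm
  subst this
  exact Fin.lt_def.2 hlt

theorem Reduced.evalFrom_eq {π : VarOrder n} {N : List (Node n)} (hN : Reduced π N) (root : Ref)
    {r : Ref} {f : Assignment n → Bool} (h : Den N r f) (a : Assignment n) :
    (nodesToOBDD N root).evalFrom (Ref.toFin N.length r) a = f a := by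
  induction h with
  | sink b => exact OBDD.evalFrom_inl _ _ _
  | node i y r₀ r₁ f₀ f₁ hi _ _ ih₀ ih₁ =>
    obtain ⟨hl, hv⟩ := List.getElem?_eq_some_iff.1 hi
    have : Ref.toFin N.length (Sum.inr i) = Sum.inr ⟨i, hl⟩ := by simp [Ref.toFin, hl]
    rw [this]
    refine ((hN.isOrdered root).evalFrom_inr (B := nodesToOBDD N root) ⟨i, hl⟩ a).trans ?_
    have hlab : (nodesToOBDD N root).label ⟨i, hl⟩ = y := by simp [nodesToOBDD, hv]
    rw [hlab]
    cases ha : a y with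
    | false =>
      simp only [ha, Bool.false_eq_true, if_false, ← ih₀]
      simp [nodesToOBDD, hv]
    | true =>
      simp only [ha, if_true, ← ih₁]
      simp [nodesToOBDD, hv]

/-- A reduced node list all of whose nodes denote cofactors is a minimized OBDD. -/
theorem Reduced.represents {π : VarOrder n} {N : List (Node n)} (hN : Reduced π N) {r : Ref}
    {f : Assignment n → Bool} (h : Den N r f)
    (hsub : ∀ i nd, N[i]? = some nd → ∃ g a, Den N (Sum.inr i) g ∧
      ∀ b, g b = f (mixAt π (π nd.1) a b)) :
    (nodesToOBDD N r).Represents π f := by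
  refine ⟨⟨hN.isOrdered r, fun a => hN.evalFrom_eq r h a⟩, fun B' hB' => ?_⟩
  -- A competitor has a reference for every cofactor. The reference is not a sink, because the
  -- function of a node depends on its label. Sending nodes to nodes with the same function is
  -- injective by canonicity.
  have key : ∀ i : Fin N.length, ∃ v : Fin B'.numNodes, ∃ g, Den N (Sum.inr i.val) g ∧
      ∀ b, B'.evalFrom (Sum.inr v) b = g b := by
    intro i
    have hi : N[i.val]? = some ((N[i]).1, (N[i]).2.1, (N[i]).2.2) := by simp
    obtain ⟨g, a, hg, hga⟩ := hsub i _ hi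
    obtain ⟨c, hc⟩ := hN.essential hi hg
    obtain ⟨r', hr', he⟩ := hB'.1.exists_cofactor (π (N[i]).1) a B'.root
    have he' : ∀ b, B'.evalFrom r' b = g b := fun b => by
      rw [he, hga]; exact hB'.2 _
    cases r' with
    | inl b => simp [← he'] at hc
    | inr v => exact ⟨v, g, hg, he'⟩
  choose φ g hg hφ using key
  have hinj : Function.Injective φ := fun i j hij => by
    have : g i = g j := funext fun b => by rw [← hφ, ← hφ, hij]
    have := hN.canonical (hg i) (this ▸ hg j)
    exact Fin.ext (Sum.inr.inj this)
  have := Fintype.card_le_of_injective φ hinj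
  simpa [OBDD.size, nodesToOBDD] using this

/-- A label is essential for the function of its node, which is a cofactor of `f`, and hence for
`f`. So the rightmost label of a minimized OBDD is the rightmost essential variable. -/
theorem Reduced.essential_of_mem_vars {π : VarOrder n} {N : List (Node n)} (hN : Reduced π N)
    {r : Ref} {f : Assignment n → Bool}
    (hsub : ∀ i nd, N[i]? = some nd → ∃ g a, Den N (Sum.inr i) g ∧
      ∀ b, g b = f (mixAt π (π nd.1) a b)) {x : Fin n} (hx : x ∈ (nodesToOBDD N r).vars) :
    ∃ a, f (Function.update a x false) ≠ f (Function.update a x true) := by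
  simp only [OBDD.vars, Finset.mem_image, Finset.mem_univ, true_and] at hx
  obtain ⟨v, rfl⟩ := hx
  have hv : N[v.val]? = some ((N[v]).1, (N[v]).2.1, (N[v]).2.2) :=
    List.getElem?_eq_getElem (show v.val < N.length from v.isLt)
  obtain ⟨g, a, hg, hga⟩ := hsub _ _ hv
  obtain ⟨c, hc⟩ := hN.essential hv hg
  refine ⟨mixAt π (π (N[v]).1) a c, ?_⟩
  rw [hga, hga, mixAt_update, mixAt_update] at hc
  exact hc

/-! ### Construction of the minimized OBDD of a layered automaton -/

/-- A deterministic automaton that reads the values of the variables. -/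
structure Automaton (n : ℕ) (σ : Type*) where
  step : Fin n → Bool → σ → σ
  accept : σ → Bool

namespace Automaton

variable {σ : Type*} (A : Automaton n σ)

/-- The state after reading the variables in `l`. -/
def run (l : List (Fin n)) (a : Assignment n) (s : σ) : σ :=
  l.foldl (fun s y => A.step y (a y) s) s

/-- The function accepted from a state when the variables in `l` are still to be read. -/
def value (l : List (Fin n)) (s : σ) (a : Assignment n) : Bool := A.accept (A.run l a s)

theorem value_nil (s : σ) : A.value [] s = fun _ => A.accept s := rfl

theorem value_cons (y : Fin n) (l : List (Fin n)) (s : σ) :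
    A.value (y :: l) s = fun a =>
      if a y then A.value l (A.step y true s) a else A.value l (A.step y false s) a := by
  funext a
  cases h : a y <;> simp [value, run, h]

theorem run_append (l l' : List (Fin n)) (a : Assignment n) (s : σ) :
    A.run (l ++ l') a s = A.run l' a (A.run l a s) := by
  simp [run]

theorem run_congr {l : List (Fin n)} {a b : Assignment n} (h : ∀ z ∈ l, a z = b z) (s : σ) :
    A.run l a s = A.run l b s := by
  induction l generalizing s with
  | nil => rfl
  | cons y l ih =>
    simp only [List.mem_cons, forall_eq_or_imp] at h
    simp only [run, List.foldl_cons, h.1]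
    exact ih h.2 _

end Automaton

/-- The state of the construction: the results known so far and the nodes. -/
structure BuildState (n : ℕ) (σ : Type*) where
  memo : List (Fin n) × σ → Option Ref
  keys : List (List (Fin n) × σ)
  nodes : List (Node n)

instance : BEq (Node n) := instBEqOfDecidableEq

/-- A reference with the given label and children. -/
def mkNode (y : Fin n) (r₀ r₁ : Ref) (N : List (Node n)) : Ref × List (Node n) :=
  if r₀ = r₁ then (r₀, N)
  else if (y, r₀, r₁) ∈ N then (Sum.inr (N.idxOf (y, r₀, r₁)), N)
  else (Sum.inr N.length, N ++ [(y, r₀, r₁)])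

namespace Automaton

variable {σ : Type*} [DecidableEq σ] (A : Automaton n σ)

/-- The list `keys` plays no part in the computation. It records the domain of the memo, that is,
the calls that were not answered from it, and both the size of the OBDD and the running time are
measured by its length. -/
def build : List (Fin n) → σ → BuildState n σ → Ref × BuildState n σ
  | [], s, st => (Sum.inl (A.accept s), st)
  | y :: l, s, st =>
    match st.memo (y :: l, s) with
    | some r => (r, st)
    | none =>
      let p₀ := build l (A.step y false s) st
      let p₁ := build l (A.step y true s) p₀.2
      let m := mkNode y p₀.1 p₁.1 p₁.2.nodes
      (m.1, ⟨Function.update p₁.2.memo (y :: l, s) (some m.1), (y :: l, s) :: p₁.2.keys, m.2⟩)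

def initBuild : BuildState n σ := ⟨fun _ => none, [], []⟩

/-- `s` is a state in which the variables in `l` are still to be read. -/
def Reach (ord : List (Fin n)) (s₀ : σ) (k : List (Fin n) × σ) : Prop :=
  ∃ pre a, ord = pre ++ k.1 ∧ k.2 = A.run pre a s₀

-- Without repetitions in the order, the next variable has not been read yet, so its value in the
-- witnessing assignment can be changed.
omit [DecidableEq σ] in
theorem Reach.step {A : Automaton n σ} {ord : List (Fin n)} (hord : ord.Nodup) {s₀ : σ}
    {y : Fin n} {l : List (Fin n)}
    {s : σ} (h : A.Reach ord s₀ (y :: l, s)) (c : Bool) : A.Reach ord s₀ (l, A.step y c s) := by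
  obtain ⟨pre, a, h₁, h₂⟩ := h
  refine ⟨pre ++ [y], Function.update a y c, by simp [h₁], ?_⟩
  simp only at h₁ h₂
  subst h₂
  change A.step y c (A.run pre a s₀) = _
  rw [run_append, A.run_congr (l := pre) (a := Function.update a y c) (b := a)]
  · simp [run]
  · intro z hz
    refine Function.update_of_ne ?_ _ _
    rintro rfl
    rw [h₁] at hord
    exact (List.nodup_append.1 hord).2.2 _ hz _ (by simp) rfl

/-- The labels of `r` occur in `l`. -/
def RefIn (N : List (Node n)) (l : List (Fin n)) (r : Ref) : Prop :=
  ∀ j, r = Sum.inr j → ∃ nd, N[j]? = some nd ∧ nd.1 ∈ l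

/-- The field `node` says that nodes denote values of reachable states, thus cofactors of the
represented function, as needed for minimality. The field `length` holds because each new key comes
with at most one new node. -/
structure BuildInv (π : VarOrder n) (ord : List (Fin n)) (s₀ : σ) (st : BuildState n σ) : Prop where
  red : Reduced π st.nodes
  memo : ∀ k r, st.memo k = some r → Den st.nodes r (A.value k.1 k.2) ∧ RefIn st.nodes k.1 r
  keys : ∀ k, st.memo k ≠ none ↔ k ∈ st.keys
  nodup : st.keys.Nodup
  reach : ∀ k ∈ st.keys, A.Reach ord s₀ k
  node : ∀ i nd, st.nodes[i]? = some nd → ∃ l s, A.Reach ord s₀ (nd.1 :: l, s) ∧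
    Den st.nodes (Sum.inr i) (A.value (nd.1 :: l) s)
  length : st.nodes.length ≤ st.keys.length

theorem RefIn.mono {N N' : List (Node n)} (hN : N <+: N') {l l' : List (Fin n)} (hl : l ⊆ l')
    {r : Ref} (h : RefIn N l r) : RefIn N' l' r := fun j hj =>
  let ⟨nd, h₁, h₂⟩ := h j hj
  ⟨nd, getElem?_of_prefix hN h₁, hl h₂⟩

theorem mkNode_spec {π : VarOrder n} {N : List (Node n)} (hN : Reduced π N) {y : Fin n}
    {l : List (Fin n)} (hl : ∀ z ∈ l, π y < π z) {r₀ r₁ : Ref} {f₀ f₁ : Assignment n → Bool}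
    (h₀ : Den N r₀ f₀) (h₁ : Den N r₁ f₁) (i₀ : RefIn N l r₀) (i₁ : RefIn N l r₁) :
    N <+: (mkNode y r₀ r₁ N).2 ∧ Reduced π (mkNode y r₀ r₁ N).2 ∧
    Den (mkNode y r₀ r₁ N).2 (mkNode y r₀ r₁ N).1 (fun a => if a y then f₁ a else f₀ a) ∧
    RefIn (mkNode y r₀ r₁ N).2 (y :: l) (mkNode y r₀ r₁ N).1 ∧
    (∀ i nd, (mkNode y r₀ r₁ N).2[i]? = some nd → N[i]? = some nd ∨
      nd.1 = y ∧ (mkNode y r₀ r₁ N).1 = Sum.inr i) ∧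
    (mkNode y r₀ r₁ N).2.length ≤ N.length + 1 := by
  unfold mkNode
  split_ifs with h h'
  · subst h
    refine ⟨List.prefix_refl _, hN, ?_, i₀.mono (List.prefix_refl _) (by simp),
      fun i nd hi => Or.inl hi, by simp⟩
    rw [h₀.det h₁]; simpa using h₁
  · have hlt := List.idxOf_lt_length_iff.2 h'
    have hi : N[N.idxOf (y, r₀, r₁)]? = some (y, r₀, r₁) := by
      rw [List.getElem?_eq_getElem hlt, List.getElem_idxOf]
    refine ⟨List.prefix_refl _, hN, Den.node _ _ _ _ _ _ hi h₀ h₁, ?_,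
      fun i nd hi => Or.inl hi, by simp⟩
    rintro j hj
    rw [← Sum.inr.inj hj]
    exact ⟨_, hi, by simp⟩
  · have hp : N <+: N ++ [(y, r₀, r₁)] := List.prefix_append _ _
    have hi : (N ++ [(y, r₀, r₁)])[N.length]? = some (y, r₀, r₁) := by simp
    have hcases : ∀ {i : ℕ} {nd : Node n}, (N ++ [(y, r₀, r₁)])[i]? = some nd →
        N[i]? = some nd ∨ nd = (y, r₀, r₁) ∧ i = N.length := by
      intro i nd hnd
      rcases lt_trichotomy i N.length with hlt | rfl | hgt
      · rw [List.getElem?_append_left hlt] at hnd; exact Or.inl hnd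
      · rw [hi] at hnd; exact Or.inr ⟨(Option.some.inj hnd).symm, rfl⟩
      · rw [List.getElem?_eq_none (by simp; omega)] at hnd; simp at hnd
    have hlt : ∀ {j : ℕ} {r : Ref}, r = Sum.inr j → RefIn N l r → j < N.length := by
      intro j r hr hin
      obtain ⟨nd, hnd, -⟩ := hin j hr
      exact (List.getElem?_eq_some_iff.1 hnd).1
    have hfrom : ∀ {r : Ref}, RefIn N l r → RefFrom π N (π y + 1) r := by
      intro r hin j hj
      obtain ⟨nd, hnd, hmem⟩ := hin j hj
      exact ⟨nd, hnd, Fin.lt_def.1 (hl _ hmem)⟩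
    refine ⟨hp, ⟨?_, ?_, ?_, ?_, ?_, ?_⟩, Den.node _ _ _ _ _ _ hi (h₀.mono hp) (h₁.mono hp), ?_, ?_,
      by simp⟩
    · rw [List.nodup_append]
      exact ⟨hN.nodup, by simp, fun a ha b hb => by
        rw [List.mem_singleton] at hb; rintro rfl; exact h' (hb ▸ ha)⟩
    · intro i y' s₀ s₁ hs
      rcases hcases hs with hs | ⟨he, rfl⟩
      · exact hN.ne hs
      · simp only [Prod.mk.injEq] at he
        rw [he.2.1, he.2.2]; exact h
    · intro i y' j s₁ hs
      rcases hcases hs with hs | ⟨he, rfl⟩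
      · exact hN.lt₀ hs
      · simp only [Prod.mk.injEq] at he
        exact hlt he.2.1.symm i₀
    · intro i y' s₀ j hs
      rcases hcases hs with hs | ⟨he, rfl⟩
      · exact hN.lt₁ hs
      · simp only [Prod.mk.injEq] at he
        exact hlt he.2.2.symm i₁
    · intro i y' s₀ s₁ hs
      rcases hcases hs with hs | ⟨he, rfl⟩
      · exact (hN.from₀ hs).mono hp
      · simp only [Prod.mk.injEq] at he
        rw [he.1, he.2.1]; exact (hfrom i₀).mono hp
    · intro i y' s₀ s₁ hs
      rcases hcases hs with hs | ⟨he, rfl⟩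
      · exact (hN.from₁ hs).mono hp
      · simp only [Prod.mk.injEq] at he
        rw [he.1, he.2.2]; exact (hfrom i₁).mono hp
    · rintro j hj
      rw [← Sum.inr.inj hj]
      exact ⟨_, hi, by simp⟩
    · intro i nd hnd
      rcases hcases hnd with hnd | ⟨rfl, rfl⟩
      · exact Or.inl hnd
      · exact Or.inr ⟨rfl, rfl⟩

variable {A}

/-- The last claim is needed for the absence of repetitions in `keys`: the recursive calls only
enter keys with fewer unread variables, hence not the key of the current call. -/
theorem build_spec {π : VarOrder n} {ord : List (Fin n)} (hord : ord.Pairwise fun x y => π x < π y)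
    {s₀ : σ} : ∀ (l : List (Fin n)) (s : σ) (st : BuildState n σ), A.BuildInv π ord s₀ st →
      A.Reach ord s₀ (l, s) →
      A.BuildInv π ord s₀ (A.build l s st).2 ∧
      Den (A.build l s st).2.nodes (A.build l s st).1 (A.value l s) ∧
      RefIn (A.build l s st).2.nodes l (A.build l s st).1 ∧
      st.nodes <+: (A.build l s st).2.nodes ∧
      st.keys <:+ (A.build l s st).2.keys ∧
      ∀ k ∈ (A.build l s st).2.keys, k ∈ st.keys ∨ k.1.length ≤ l.length
  | [], s, st, hst, hr => by
    refine ⟨hst, Den.sink _, fun j hj => ?_, List.prefix_refl _, List.suffix_refl _,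
      fun k hk => Or.inl hk⟩
    simp [build] at hj
  | y :: l, s, st, hst, hr => by
    have hnd : ord.Nodup := hord.imp fun h => by rintro rfl; exact lt_irrefl _ h
    cases hm : st.memo (y :: l, s) with
    | some r =>
      have : A.build (y :: l) s st = (r, st) := by simp [build, hm]
      rw [this]
      obtain ⟨h₁, h₂⟩ := hst.memo _ _ hm
      exact ⟨hst, h₁, h₂, List.prefix_refl _, List.suffix_refl _, fun k hk => Or.inl hk⟩
    | none =>
      have hlt : ∀ z ∈ l, π y < π z := by
        obtain ⟨pre, a, h₁, -⟩ := hr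
        rw [h₁, List.pairwise_append] at hord
        exact (List.pairwise_cons.1 hord.2.1).1
      obtain ⟨I₀, D₀, R₀, P₀, K₀, L₀⟩ := build_spec hord l (A.step y false s) st hst
        (hr.step hnd false)
      obtain ⟨I₁, D₁, R₁, P₁, K₁, L₁⟩ := build_spec hord l (A.step y true s)
        (A.build l (A.step y false s) st).2 I₀ (hr.step hnd true)
      obtain ⟨N₁, N₂, N₃, N₄, N₅, N₆⟩ := mkNode_spec I₁.red hlt (D₀.mono P₁) D₁
        (R₀.mono P₁ (List.Subset.refl _)) R₁
      have e : A.build (y :: l) s st =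
          (let p₀ := A.build l (A.step y false s) st
           let p₁ := A.build l (A.step y true s) p₀.2
           let m := mkNode y p₀.1 p₁.1 p₁.2.nodes
           (m.1, ⟨Function.update p₁.2.memo (y :: l, s) (some m.1), (y :: l, s) :: p₁.2.keys,
            m.2⟩)) := by
        rw [build, hm]
      rw [e]
      simp only
      set p₀ := A.build l (A.step y false s) st
      set p₁ := A.build l (A.step y true s) p₀.2
      set m := mkNode y p₀.1 p₁.1 p₁.2.nodes
      rw [← value_cons] at N₃
      refine ⟨⟨N₂, ?_, ?_, ?_, ?_, ?_, ?_⟩, N₃, N₄, (P₀.trans P₁).trans N₁,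
        (K₀.trans K₁).trans (List.suffix_cons _ _), ?_⟩
      · intro k r hk
        simp only at hk ⊢
        by_cases hkey : k = (y :: l, s)
        · subst hkey
          rw [Function.update_self] at hk
          rw [← Option.some.inj hk]
          exact ⟨N₃, N₄⟩
        · rw [Function.update_of_ne hkey] at hk
          obtain ⟨h₁, h₂⟩ := I₁.memo _ _ hk
          exact ⟨h₁.mono N₁, h₂.mono N₁ (List.Subset.refl _)⟩
      · intro k
        by_cases hkey : k = (y :: l, s)
        · subst hkey; simp
        · simp [hkey, ← I₁.keys k]
      · refine List.nodup_cons.2 ⟨fun hmem => ?_, I₁.nodup⟩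
        have : (y :: l, s) ∉ st.keys := fun h => (hst.keys _).2 h hm
        rcases L₁ _ hmem with h | h
        · rcases L₀ _ h with h | h
          · exact this h
          · simp at h
        · simp at h
      · intro k hk
        rcases List.mem_cons.1 hk with rfl | hk
        · exact hr
        · exact I₁.reach k hk
      · intro i nd hnd
        rcases N₅ i nd hnd with h | ⟨rfl, h⟩
        · obtain ⟨l', s', h₁, h₂⟩ := I₁.node i nd h
          exact ⟨l', s', h₁, h₂.mono N₁⟩
        · exact ⟨l, s, hr, h ▸ N₃⟩
      · have := I₁.length
        simp only [List.length_cons]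
        omega
      · intro k hk
        rcases List.mem_cons.1 hk with rfl | hk
        · exact Or.inr le_rfl
        · rcases L₁ k hk with h | h
          · rcases L₀ k h with h | h
            · exact Or.inl h
            · exact Or.inr (by simp; omega)
          · exact Or.inr (by simp; omega)

omit [DecidableEq σ] in
theorem buildInv_init (π : VarOrder n) (ord : List (Fin n)) (s₀ : σ) :
    A.BuildInv π ord s₀ initBuild :=
  ⟨⟨by simp [initBuild], by simp [initBuild], by simp [initBuild], by simp [initBuild],
    by simp [initBuild], by simp [initBuild]⟩, by simp [initBuild], by simp [initBuild],
    by simp [initBuild], by simp [initBuild], by simp [initBuild], by simp [initBuild]⟩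

end Automaton

/-- The variables in the order `π`. -/
def orderList (π : VarOrder n) : List (Fin n) := List.ofFn fun i => π.symm i

theorem orderList_pairwise (π : VarOrder n) :
    (orderList π).Pairwise fun x y => π x < π y := by
  rw [orderList, List.pairwise_ofFn]
  intro i j h
  simpa using h

theorem mem_orderList (π : VarOrder n) (x : Fin n) : x ∈ orderList π := by
  rw [orderList, List.mem_ofFn]
  exact ⟨π x, by simp⟩

namespace Automaton

variable {σ : Type*} [DecidableEq σ] (A : Automaton n σ)

/-- The result of the construction from the state `s`. -/
def result (π : VarOrder n) (s : σ) : Ref × BuildState n σ := A.build (orderList π) s initBuild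

def toOBDD (π : VarOrder n) (s : σ) : OBDD n :=
  nodesToOBDD (A.result π s).2.nodes (A.result π s).1

theorem result_spec (π : VarOrder n) (s : σ) :
    A.BuildInv π (orderList π) s (A.result π s).2 ∧
    Den (A.result π s).2.nodes (A.result π s).1 (A.value (orderList π) s) :=
  have h := build_spec (orderList_pairwise π) (orderList π) s initBuild
    (buildInv_init π (orderList π) s) ⟨[], fun _ => false, rfl, rfl⟩
  ⟨h.1, h.2.1⟩

variable {A}

omit [DecidableEq σ] in
theorem BuildInv.cofactor {π : VarOrder n} {s₀ : σ} {st : BuildState n σ}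
    (h : A.BuildInv π (orderList π) s₀ st) (i : ℕ) (nd : Node n) (hi : st.nodes[i]? = some nd) :
    ∃ g a, Den st.nodes (Sum.inr i) g ∧
      ∀ b, g b = A.value (orderList π) s₀ (mixAt π (π nd.1) a b) := by
  obtain ⟨l, s, ⟨pre, a, h₁, h₂⟩, h₃⟩ := h.node i nd hi
  simp only at h₁ h₂
  refine ⟨_, a, h₃, fun b => ?_⟩
  have hp := orderList_pairwise π
  rw [h₁, List.pairwise_append, List.pairwise_cons] at hp
  rw [h₁, value, value, run_append, h₂]
  congr 1
  rw [A.run_congr (l := pre) (a := mixAt π _ a b) (b := a),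
    A.run_congr (l := nd.1 :: l) (a := mixAt π _ a b) (b := b)]
  · intro z hz
    have : ¬ ((π z : ℕ) < π nd.1) := by
      rcases List.mem_cons.1 hz with rfl | hz
      · exact lt_irrefl _
      · exact not_lt.2 (Fin.le_def.1 (hp.2.1.1 z hz).le)
    simp [mixAt, this]
  · intro z hz
    have : (π z : ℕ) < π nd.1 := hp.2.2 z hz nd.1 (by simp)
    simp [mixAt, this]

variable (A)

theorem toOBDD_represents (π : VarOrder n) (s : σ) :
    (A.toOBDD π s).Represents π (A.value (orderList π) s) :=
  have ⟨h, h'⟩ := A.result_spec π s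
  h.red.represents h' h.cofactor

theorem essential_of_mem_vars_toOBDD {π : VarOrder n} {s : σ} {x : Fin n}
    (hx : x ∈ (A.toOBDD π s).vars) :
    ∃ a, A.value (orderList π) s (Function.update a x false) ≠
      A.value (orderList π) s (Function.update a x true) :=
  have ⟨h, _⟩ := A.result_spec π s
  h.red.essential_of_mem_vars h.cofactor hx

/-- The states reachable after reading `c` variables. -/
noncomputable def layer (π : VarOrder n) (s : σ) (c : ℕ) : Finset σ :=
  Finset.univ.image fun a => A.run ((orderList π).take c) a s

/-- A key is determined by the number `c` of variables read, with `c ≤ n`, and a state of the layer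
`c`. -/
theorem length_keys_le (π : VarOrder n) (s : σ) (W : ℕ) (hW : ∀ c, (A.layer π s c).card ≤ W) :
    (A.result π s).2.keys.length ≤ (n + 1) * W := by
  have h := (A.result_spec π s).1
  rw [← List.toFinset_card_of_nodup h.nodup]
  have hsub : (A.result π s).2.keys.toFinset ⊆ (Finset.range (n + 1)).biUnion fun c =>
      (A.layer π s c).image fun t => ((orderList π).drop c, t) := by
    intro k hk
    obtain ⟨pre, a, h₁, h₂⟩ := h.reach k (List.mem_toFinset.1 hk)
    have hlen : pre.length + k.1.length = n := by
      have := congrArg List.length h₁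
      simpa [orderList] using this.symm
    simp only [Finset.mem_biUnion, Finset.mem_range, Finset.mem_image, layer, Finset.mem_univ,
      true_and, exists_exists_eq_and]
    refine ⟨pre.length, by omega, a, ?_⟩
    rw [h₁]
    simp [← h₂]
  calc _ ≤ _ := Finset.card_le_card hsub
    _ ≤ _ := Finset.card_biUnion_le_card_mul _ _ W fun c _ => Finset.card_image_le.trans (hW c)
    _ = _ := by simp

theorem size_toOBDD_le (π : VarOrder n) (s : σ) (W : ℕ) (hW : ∀ c, (A.layer π s c).card ≤ W) :
    (A.toOBDD π s).size ≤ (n + 1) * W + 2 :=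
  Nat.add_le_add_right ((A.result_spec π s).1.length.trans (A.length_keys_le π s W hW)) 2

end Automaton

/-! ### The meaning of states -/

/-- The levels of a prefix: a quantifier and a list of variables for every block. -/
abbrev Levels (n : ℕ) := List (Quantifier × List (Fin n))

def encLevels (ls : Levels n) : Dat :=
  encList (fun l => Dat.cons (encQuantifier l.1) (encList encFin l.2)) ls

/-- The literals that are satisfied and falsified by setting `y` to `b`. -/
def litPair (y : Fin n) (b : Bool) : Dat := Dat.cons (encLiteral (y, b)) (encLiteral (y, !b))

def stateParam (ls : Levels n) (y : Fin n) (b : Bool) : Dat :=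
  Dat.cons (encLevels ls) (litPair y b)

/-- The automaton on the canonical states. -/
def stateAut (ls : Levels n) : Automaton n Dat where
  step y b s := Dat.step (stateParam ls y b) s
  accept s := decide (s ≠ Dat.nil)

namespace Dat

variable {ls : Levels n} {Q : Quantifier} {X : List (Fin n)} {y : Fin n} {b : Bool}

theorem dropLevel_stateParam :
    dropLevel (stateParam ((Q, X) :: ls) y b) = stateParam ls y b := rfl

theorem swapLits_stateParam : swapLits (stateParam ls y b) = stateParam ls y (!b) := by
  simp [swapLits, stateParam, litPair]

theorem finish_cons (e raw : Dat) :
    finish (stateParam ((Q, X) :: ls) y b) e raw = collect (encQuantifier Q) raw := rfl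

theorem toList_assignRaw (p s : Dat) :
    (assignRaw p s).toList = s.toList.map (assign (dropLevel p)) := by
  induction s with
  | nil => rfl
  | cons e r _ ih => simp [assignRaw, ih, assign]

theorem assign_nil (s : Dat) : assign (stateParam [] y b) s = leafAssign (litPair y b) s := rfl

theorem assign_cons (s : Dat) : assign (stateParam ((Q, X) :: ls) y b) s =
    collect (encQuantifier Q) (encList (assign (stateParam ls y b)) s.toList) := by
  rw [assign, finish_cons]
  congr 1
  apply toList_injective
  rw [toList_assignRaw, toList_encList, dropLevel_stateParam]

theorem step_nil (s : Dat) : step (stateParam [] y b) s = leafAssign (litPair y b) s := rfl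

theorem step_cons_of_mem (h : y ∈ X) (s : Dat) : step (stateParam ((Q, X) :: ls) y b) s =
    collect (encQuantifier Q) (encList id (s.toList.flatMap fun e =>
      [assign (stateParam ls y b) e, assign (stateParam ls y (!b)) e])) := by
  rw [step, finish_cons]
  congr 1
  apply toList_injective
  have h' : (stateParam ((Q, X) :: ls) y b).snd.fst.fst ∈
      (stateParam ((Q, X) :: ls) y b).fst.fst.snd.toList := by
    simp only [stateParam, encLevels, encList, litPair, encLiteral, fst_cons, snd_cons,
      toList_encList]
    exact List.mem_map_of_mem h
  induction s with
  | nil => rfl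
  | cons e r _ ih =>
    simp only [stepRaw, h', if_true, toList_cons, ih, dropLevel_stateParam, swapLits_stateParam]
    simp

theorem step_cons_of_notMem (h : y ∉ X) (s : Dat) : step (stateParam ((Q, X) :: ls) y b) s =
    collect (encQuantifier Q) (encList (step (stateParam ls y b)) s.toList) := by
  rw [step, finish_cons]
  congr 1
  apply toList_injective
  have h' : (stateParam ((Q, X) :: ls) y b).snd.fst.fst ∉
      (stateParam ((Q, X) :: ls) y b).fst.fst.snd.toList := by
    simp only [stateParam, encLevels, encList, litPair, encLiteral, fst_cons, snd_cons,
      toList_encList]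
    rw [List.mem_map_of_injective encFin_injective]
    exact h
  induction s with
  | nil => rfl
  | cons e r _ ih =>
    simp only [stepRaw, h', if_false, toList_cons, ih, dropLevel_stateParam]
    simp [step]

theorem mem_collect_ex {raw x : Dat} :
    x ∈ (collect (encQuantifier Quantifier.ex) raw).toList ↔ x ∈ raw.toList ∧ x ≠ nil := by
  simp [collect, encQuantifier, encBool, mem_sort]

theorem mem_collect_all {raw x : Dat} :
    x ∈ (collect (encQuantifier Quantifier.all) raw).toList ↔
      x ∈ raw.toList ∧ nil ∉ raw.toList := by
  simp only [collect, encQuantifier, encBool, ite_cons]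
  split_ifs with h <;> simp [mem_sort, h]

theorem collect_sorted (Q raw : Dat) :
    (collect Q raw).toList.Pairwise fun a b => lt a b = true := by
  cases Q
  · exact sort_sorted _
  · simp only [collect, ite_cons]
    split_ifs
    · simp
    · exact sort_sorted _

theorem mem_collect {Q raw x : Dat} (h : x ∈ (collect Q raw).toList) :
    x ∈ raw.toList ∧ x ≠ nil := by
  cases Q with
  | nil => simpa [collect, mem_sort] using h
  | cons l r =>
    simp only [collect, ite_cons] at h
    split_ifs at h with h'
    · simp at h
    · rw [mem_sort] at h
      exact ⟨h, by rintro rfl; exact h' h⟩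

end Dat

/-- The evaluation of a literal. -/
def LitHolds (d : Dat) (a : Assignment n) : Prop :=
  ∃ (x : Fin n) (b : Bool), d = encLiteral (x, b) ∧ a x = b

def LeafHolds (s : Dat) (a : Assignment n) : Prop :=
  s ≠ Dat.nil ∧ ∀ c ∈ s.snd.toList, ∃ l ∈ c.toList, LitHolds l a

/-- `b` arises from `a` by changing variables in `X`. -/
def AgreeOff (X : List (Fin n)) (a b : Assignment n) : Prop := ∀ z, z ∉ X → b z = a z

/-- The value of a state under an assignment of the variables that are still to be read. -/
def StateHolds : Levels n → Dat → Assignment n → Prop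
  | [], s, a => LeafHolds s a
  | (Quantifier.ex, X) :: ls, s, a =>
    ∃ b, AgreeOff X a b ∧ ∃ e ∈ s.toList, StateHolds ls e b
  | (Quantifier.all, X) :: ls, s, a =>
    s ≠ Dat.nil ∧ ∀ b, AgreeOff X a b → ∀ e ∈ s.toList, StateHolds ls e b

theorem AgreeOff.refl (X : List (Fin n)) (a : Assignment n) : AgreeOff X a a := fun _ _ => rfl

theorem not_stateHolds_nil (ls : Levels n) (a : Assignment n) : ¬ StateHolds ls Dat.nil a := by
  rcases ls with _ | ⟨⟨_ | _, X⟩, ls⟩ <;> simp [StateHolds, LeafHolds]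

theorem litHolds_encLiteral {x : Fin n} {b : Bool} {a : Assignment n} :
    LitHolds (encLiteral (x, b)) a ↔ a x = b := by
  refine ⟨fun ⟨y, c, h, h'⟩ => ?_, fun h => ⟨x, b, rfl, h⟩⟩
  have := Dat.encLiteral_injective h
  simp only [Prod.mk.injEq] at this
  rw [this.1, this.2, h']

theorem leafHolds_cons {T : Dat} {a : Assignment n} {x : Dat} :
    LeafHolds (Dat.cons x T) a ↔ ∀ c ∈ T.toList, ∃ l ∈ c.toList, LitHolds l a := by
  simp [LeafHolds]

theorem leafHolds_leaf {T : Dat} {a : Assignment n} :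
    LeafHolds (Dat.leaf T) a ↔ ∀ c ∈ T.toList, ∃ l ∈ c.toList, LitHolds l a := by
  unfold Dat.leaf
  split_ifs with h
  · refine iff_of_false (by simp [LeafHolds]) fun h' => ?_
    simpa using h' _ h
  · exact leafHolds_cons

theorem mem_cnfAssign {lits T c : Dat} : c ∈ (Dat.cnfAssign lits T).toList ↔
    ∃ d ∈ T.toList, lits.fst ∉ d.toList ∧ c = Dat.filterNe lits.snd d := by
  induction T with
  | nil => simp [Dat.cnfAssign]
  | cons d r _ ih =>
    simp only [Dat.cnfAssign]
    split_ifs with h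
    · simp [ih, h]
    · simp [ih, h]

theorem leafHolds_leafAssign (y : Fin n) (b : Bool) (s : Dat) (a : Assignment n) :
    LeafHolds (Dat.leafAssign (litPair y b) s) a ↔ LeafHolds s (Function.update a y b) := by
  cases s with
  | nil => simp [Dat.leafAssign, LeafHolds]
  | cons x T =>
    simp only [Dat.leafAssign, Dat.ite_cons, Dat.snd_cons, leafHolds_leaf, leafHolds_cons,
      mem_cnfAssign, litPair, Dat.fst_cons]
    constructor
    · intro h d hd
      by_cases hp : encLiteral (y, b) ∈ d.toList
      · exact ⟨_, hp, litHolds_encLiteral.2 (by simp)⟩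
      · obtain ⟨l, hl, z, c, rfl, hz⟩ := h _ ⟨d, hd, hp, rfl⟩
        simp only [Dat.toList_filterNe, List.mem_filter, decide_eq_true_eq] at hl
        refine ⟨_, hl.1, litHolds_encLiteral.2 ?_⟩
        have : z ≠ y := by
          rintro rfl
          by_cases hc : c = b
          · exact hp (hc ▸ hl.1)
          · exact hl.2 (by rw [(by cases c <;> cases b <;> simp_all : c = !b)])
        rw [Function.update_of_ne this, hz]
    · rintro h c ⟨d, hd, hp, rfl⟩
      obtain ⟨l, hl, z, c, rfl, hz⟩ := h d hd
      have : z ≠ y := by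
        rintro rfl
        rw [Function.update_self] at hz
        exact hp (hz ▸ hl)
      refine ⟨_, ?_, litHolds_encLiteral.2 ((Function.update_of_ne this _ _).symm.trans hz)⟩
      simp only [Dat.toList_filterNe, List.mem_filter, decide_eq_true_eq]
      refine ⟨hl, fun he => this ?_⟩
      exact congrArg Prod.fst (Dat.encLiteral_injective he)

theorem stateHolds_collect_ex {X : List (Fin n)} {ls : Levels n} {raw : Dat} {a : Assignment n} :
    StateHolds ((Quantifier.ex, X) :: ls) (Dat.collect (encQuantifier Quantifier.ex) raw) a ↔
      ∃ b, AgreeOff X a b ∧ ∃ e ∈ raw.toList, StateHolds ls e b := by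
  simp only [StateHolds, Dat.mem_collect_ex]
  refine exists_congr fun b => and_congr_right fun _ => exists_congr fun e => ?_
  refine ⟨fun h => ⟨h.1.1, h.2⟩, fun h => ⟨⟨h.1, ?_⟩, h.2⟩⟩
  rintro rfl
  exact not_stateHolds_nil _ _ h.2

/-- A false element falsifies a universal set, so collapsing the set to `nil` is sound. Otherwise
sorting keeps the elements, and in particular nonemptiness. -/
theorem stateHolds_collect_all {X : List (Fin n)} {ls : Levels n} {raw : Dat} {a : Assignment n} :
    StateHolds ((Quantifier.all, X) :: ls) (Dat.collect (encQuantifier Quantifier.all) raw) a ↔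
      raw ≠ Dat.nil ∧ ∀ b, AgreeOff X a b → ∀ e ∈ raw.toList, StateHolds ls e b := by
  simp only [StateHolds, Dat.mem_collect_all]
  by_cases h : Dat.nil ∈ raw.toList
  · refine iff_of_false ?_ fun h' => not_stateHolds_nil _ _ (h'.2 a (AgreeOff.refl X a) _ h)
    simp [Dat.collect, encQuantifier, encBool, h]
  · have hne : Dat.collect (encQuantifier Quantifier.all) raw ≠ Dat.nil ↔ raw ≠ Dat.nil := by
      simp only [Dat.collect, encQuantifier, encBool, Dat.ite_cons, if_neg h]
      rw [← not_iff_not, not_not, not_not, ← Dat.toList_eq_nil, ← Dat.toList_eq_nil,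
        List.eq_nil_iff_forall_not_mem, List.eq_nil_iff_forall_not_mem]
      simp [Dat.mem_sort]
    rw [hne]
    simp [h]

theorem AgreeOff.update {X : List (Fin n)} {a b : Assignment n} {y : Fin n} {c : Bool}
    (hy : y ∉ X) (h : AgreeOff X (Function.update a y c) b) :
    ∃ b', AgreeOff X a b' ∧ b = Function.update b' y c := by
  refine ⟨Function.update b y (a y), fun z hz => ?_, ?_⟩
  · by_cases hzy : z = y
    · subst hzy; simp
    · rw [Function.update_of_ne hzy, h z hz, Function.update_of_ne hzy]
  · have := h y hy
    rw [Function.update_self] at this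
    simp [← this]

theorem AgreeOff.update' {X : List (Fin n)} {a b : Assignment n} {y : Fin n} {c : Bool}
    (h : AgreeOff X a b) : AgreeOff X (Function.update a y c) (Function.update b y c) := by
  intro z hz
  by_cases hzy : z = y
  · subst hzy; simp
  · rw [Function.update_of_ne hzy, h z hz, Function.update_of_ne hzy]

theorem agreeOff_update_iff {X : List (Fin n)} {a b : Assignment n} {y : Fin n} {c : Bool}
    (hy : y ∈ X) : AgreeOff X (Function.update a y c) b ↔ AgreeOff X a b := by
  refine forall_congr' fun z => imp_congr_right fun hz => ?_
  rw [Function.update_of_ne (by rintro rfl; exact hz hy)]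

theorem exists_agreeOff_update {X : List (Fin n)} {a : Assignment n} {y : Fin n} {c : Bool}
    (hy : y ∉ X) {p : Assignment n → Prop} :
    (∃ b, AgreeOff X (Function.update a y c) b ∧ p b) ↔
      ∃ b, AgreeOff X a b ∧ p (Function.update b y c) := by
  constructor
  · rintro ⟨b, hb, hp⟩
    obtain ⟨b', hb', rfl⟩ := hb.update hy
    exact ⟨b', hb', hp⟩
  · rintro ⟨b, hb, hp⟩
    exact ⟨_, hb.update', hp⟩

theorem forall_agreeOff_update {X : List (Fin n)} {a : Assignment n} {y : Fin n} {c : Bool}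
    (hy : y ∉ X) {p : Assignment n → Prop} :
    (∀ b, AgreeOff X (Function.update a y c) b → p b) ↔
      ∀ b, AgreeOff X a b → p (Function.update b y c) := by
  constructor
  · intro h b hb
    exact h _ hb.update'
  · intro h b hb
    obtain ⟨b', hb', rfl⟩ := hb.update hy
    exact h b' hb'

/-- The case of a level whose block does not contain `y`: changing variables of the block commutes
with updating `y`, so the substitution can be carried out elementwise. -/
theorem stateHolds_map (ls : Levels n) (Q : Quantifier) {X : List (Fin n)} {y : Fin n} {b : Bool}
    (hy : y ∉ X) (s : Dat) (a : Assignment n) (F : Dat → Dat)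
    (hF : ∀ e a, StateHolds ls (F e) a ↔ StateHolds ls e (Function.update a y b)) :
    StateHolds ((Q, X) :: ls) (Dat.collect (encQuantifier Q) (encList F s.toList)) a ↔
      StateHolds ((Q, X) :: ls) s (Function.update a y b) := by
  cases Q with
  | ex =>
    rw [stateHolds_collect_ex]
    simp only [StateHolds, exists_agreeOff_update hy]
    simp [hF]
  | all =>
    rw [stateHolds_collect_all]
    simp only [StateHolds, forall_agreeOff_update hy]
    refine and_congr ?_ (by simp [hF])
    cases s <;> simp [encList]

theorem stateHolds_assign (ls : Levels n) {y : Fin n} {b : Bool} (hy : ∀ l ∈ ls, y ∉ l.2)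
    (s : Dat) (a : Assignment n) :
    StateHolds ls (Dat.assign (stateParam ls y b) s) a ↔
      StateHolds ls s (Function.update a y b) := by
  induction ls generalizing s a with
  | nil => rw [Dat.assign_nil]; exact leafHolds_leafAssign y b s a
  | cons l ls ih =>
    obtain ⟨Q, X⟩ := l
    simp only [List.mem_cons, forall_eq_or_imp] at hy
    rw [Dat.assign_cons]
    exact stateHolds_map ls Q hy.1 s a _ (ih hy.2)

/-- On the level that quantifies `y` the value read is irrelevant. Both cofactors of every element
are present, and a choice `c` for the block is matched by the cofactor with `y` set to `c y`. The
other cofactor does no harm, as `c` may be changed at `y` within the block. -/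
theorem stateHolds_step (ls : Levels n) (hls : ls.Pairwise fun l l' => ∀ x ∈ l.2, x ∉ l'.2)
    {y : Fin n} {b : Bool} (s : Dat) (a : Assignment n) :
    StateHolds ls (Dat.step (stateParam ls y b) s) a ↔
      StateHolds ls s (Function.update a y b) := by
  induction ls generalizing s a with
  | nil => rw [Dat.step_nil]; exact leafHolds_leafAssign y b s a
  | cons l ls ih =>
    obtain ⟨Q, X⟩ := l
    rw [List.pairwise_cons] at hls
    by_cases hy : y ∈ X
    · have hyl : ∀ l ∈ ls, y ∉ l.2 := fun l hl => hls.1 l hl y hy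
      rw [Dat.step_cons_of_mem hy]
      have key : ∀ c : Bool, c = b ∨ c = !b := by cases b <;> decide
      cases Q with
      | ex =>
        rw [stateHolds_collect_ex]
        simp only [StateHolds, agreeOff_update_iff hy]
        constructor
        · rintro ⟨c, hc, e, he, h⟩
          simp only [Dat.toList_encList, List.map_id, List.mem_flatMap, List.mem_cons,
            List.not_mem_nil, or_false] at he
          obtain ⟨e', he', rfl | rfl⟩ := he
          · rw [stateHolds_assign ls hyl] at h
            exact ⟨_, (agreeOff_update_iff hy).1 hc.update', e', he', h⟩
          · rw [stateHolds_assign ls hyl] at h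
            exact ⟨_, (agreeOff_update_iff hy).1 hc.update', e', he', h⟩
        · rintro ⟨c, hc, e, he, h⟩
          refine ⟨c, hc, Dat.assign (stateParam ls y (c y)) e, ?_, ?_⟩
          · simp only [Dat.toList_encList, List.map_id, List.mem_flatMap, List.mem_cons,
              List.not_mem_nil, or_false]
            refine ⟨e, he, ?_⟩
            rcases key (c y) with h' | h' <;> rw [h'] <;> simp
          · rw [stateHolds_assign ls hyl]
            simpa using h
      | all =>
        rw [stateHolds_collect_all]
        simp only [StateHolds, agreeOff_update_iff hy]
        refine and_congr ?_ ⟨fun h c hc e he => ?_, fun h c hc e he => ?_⟩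
        · cases s <;> simp [encList]
        · have := h c hc (Dat.assign (stateParam ls y (c y)) e) (by
            simp only [Dat.toList_encList, List.map_id, List.mem_flatMap, List.mem_cons,
              List.not_mem_nil, or_false]
            refine ⟨e, he, ?_⟩
            rcases key (c y) with h' | h' <;> rw [h'] <;> simp)
          rw [stateHolds_assign ls hyl] at this
          simpa using this
        · simp only [Dat.toList_encList, List.map_id, List.mem_flatMap, List.mem_cons,
            List.not_mem_nil, or_false] at he
          obtain ⟨e', he', rfl | rfl⟩ := he
          · rw [stateHolds_assign ls hyl]
            exact h _ ((agreeOff_update_iff hy).1 hc.update') e' he'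
          · rw [stateHolds_assign ls hyl]
            exact h _ ((agreeOff_update_iff hy).1 hc.update') e' he'
    · rw [Dat.step_cons_of_notMem hy]
      exact stateHolds_map ls Q hy s a _ (ih hls.2)

/-! ### Well-formed states -/

/-- The literals that occur in the state belong to variables in `R`, and no clause and no proper
substate is empty. -/
def WellFormed (R : Fin n → Prop) : List (Quantifier × List (Fin n)) → Dat → Prop
  | [], s => ∀ c ∈ s.snd.toList, c ≠ Dat.nil ∧
    ∀ l ∈ c.toList, ∃ (x : Fin n) (b : Bool), l = encLiteral (x, b) ∧ R x
  | _ :: ls, s => ∀ e ∈ s.toList, e ≠ Dat.nil ∧ WellFormed R ls e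

theorem wellFormed_leaf {R : Fin n → Prop} {T : Dat}
    (h : ∀ c ∈ T.toList, ∀ l ∈ c.toList, ∃ (x : Fin n) (b : Bool), l = encLiteral (x, b) ∧ R x) :
    WellFormed R [] (Dat.leaf T) := by
  unfold Dat.leaf
  split_ifs with h'
  · simp [WellFormed]
  · exact fun c hc => ⟨by rintro rfl; exact h' hc, h c hc⟩

theorem wellFormed_leafAssign {R : Fin n → Prop} {s : Dat} (h : WellFormed R [] s) (y : Fin n)
    (b : Bool) : WellFormed (fun x => R x ∧ x ≠ y) [] (Dat.leafAssign (litPair y b) s) := by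
  cases s with
  | nil => simp [WellFormed, Dat.leafAssign]
  | cons x T =>
    refine wellFormed_leaf fun c hc l hl => ?_
    obtain ⟨d, hd, hp, rfl⟩ := mem_cnfAssign.1 hc
    simp only [Dat.toList_filterNe, List.mem_filter, decide_eq_true_eq, litPair,
      Dat.snd_cons, Dat.fst_cons] at hl hp
    obtain ⟨x, c, rfl, hx⟩ := (h d hd).2 l hl.1
    refine ⟨x, c, rfl, hx, ?_⟩
    rintro rfl
    by_cases hc : c = b
    · exact hp (hc ▸ hl.1)
    · exact hl.2 (by rw [(by cases c <;> cases b <;> simp_all : c = !b)])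

theorem wellFormed_assign {R : Fin n → Prop} (ls : Levels n) {s : Dat} (h : WellFormed R ls s)
    (y : Fin n) (b : Bool) :
    WellFormed (fun x => R x ∧ x ≠ y) ls (Dat.assign (stateParam ls y b) s) := by
  induction ls generalizing s with
  | nil => exact wellFormed_leafAssign h y b
  | cons l ls ih =>
    intro e he
    rw [Dat.assign_cons] at he
    obtain ⟨h₁, h₂⟩ := Dat.mem_collect he
    rw [Dat.toList_encList, List.mem_map] at h₁
    obtain ⟨e', he', rfl⟩ := h₁
    exact ⟨h₂, ih (h e' he').2⟩

theorem wellFormed_step {R : Fin n → Prop} (ls : Levels n) {s : Dat} (h : WellFormed R ls s)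
    (y : Fin n) (b : Bool) :
    WellFormed (fun x => R x ∧ x ≠ y) ls (Dat.step (stateParam ls y b) s) := by
  induction ls generalizing s with
  | nil => exact wellFormed_leafAssign h y b
  | cons l ls ih =>
    intro e he
    by_cases hy : y ∈ l.2
    · rw [Dat.step_cons_of_mem hy] at he
      obtain ⟨h₁, h₂⟩ := Dat.mem_collect he
      simp only [Dat.toList_encList, List.map_id, List.mem_flatMap, List.mem_cons,
        List.not_mem_nil, or_false] at h₁
      obtain ⟨e', he', rfl | rfl⟩ := h₁
      · exact ⟨h₂, wellFormed_assign ls (h e' he').2 y b⟩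
      · exact ⟨h₂, wellFormed_assign ls (h e' he').2 y _⟩
    · rw [Dat.step_cons_of_notMem hy] at he
      obtain ⟨h₁, h₂⟩ := Dat.mem_collect he
      rw [Dat.toList_encList, List.mem_map] at h₁
      obtain ⟨e', he', rfl⟩ := h₁
      exact ⟨h₂, ih (h e' he').2⟩

/-- Without variables there is no literal, so a nonempty clause is impossible, and a leaf other than
`nil` has no clauses left and is true. As `nil` is not an element of any set, truth propagates
through all levels. This is why acceptance can be the test for `nil`. -/
theorem stateHolds_of_wellFormed {R : Fin n → Prop} (hR : ∀ x, ¬ R x) (ls : Levels n) {s : Dat}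
    (h : WellFormed R ls s) (a : Assignment n) : StateHolds ls s a ↔ s ≠ Dat.nil := by
  refine ⟨by rintro h rfl; exact not_stateHolds_nil _ _ h, fun hs => ?_⟩
  induction ls generalizing s a with
  | nil =>
    refine ⟨hs, fun c hc => ?_⟩
    obtain ⟨h₁, h₂⟩ := h c hc
    cases c with
    | nil => exact absurd rfl h₁
    | cons l r =>
      obtain ⟨x, -, -, hx⟩ := h₂ l (by simp)
      exact absurd hx (hR x)
  | cons l ls ih =>
    obtain ⟨_ | _, X⟩ := l
    · cases s with
      | nil => exact absurd rfl hs
      | cons e r =>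
        obtain ⟨h₁, h₂⟩ := h e (by simp)
        exact ⟨a, AgreeOff.refl X a, e, by simp, ih h₂ a h₁⟩
    · exact ⟨hs, fun b _ e he => ih (h e he).2 b (h e he).1⟩

/-- The automaton computes the value of its states. -/
theorem stateAut_value (ls : Levels n) (hls : ls.Pairwise fun l l' => ∀ x ∈ l.2, x ∉ l'.2)
    (l : List (Fin n)) (s : Dat) (h : WellFormed (fun x => x ∈ l) ls s) (a : Assignment n) :
    (stateAut ls).value l s a = true ↔ StateHolds ls s a := by
  -- The set of possible variables is a separate predicate `R`, because a step yields the variables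
  -- of `R` other than `y`, which need not be all variables of the remaining list.
  have key : ∀ (l : List (Fin n)) (R : Fin n → Prop) (s : Dat), WellFormed R ls s →
      (∀ x, R x → x ∈ l) → ((stateAut ls).value l s a = true ↔ StateHolds ls s a) := by
    intro l
    induction l with
    | nil =>
      intro R s h hR
      rw [stateHolds_of_wellFormed (fun x hx => List.not_mem_nil (hR x hx)) ls h a]
      simp [Automaton.value_nil, stateAut]
    | cons y l ih =>
      intro R s h hR
      have h₁ : (stateAut ls).value (y :: l) s a =
          (stateAut ls).value l (Dat.step (stateParam ls y (a y)) s) a := rfl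
      rw [h₁, ih _ _ (wellFormed_step ls h y (a y)) fun x hx => by
        simpa [hx.2] using hR x hx.1]
      refine (stateHolds_step ls hls s a).trans ?_
      rw [Function.update_eq_self]
  exact key l _ s h fun _ hx => hx

/-! ### The initial state -/

def PrefixHolds : Levels n → (Assignment n → Prop) → Assignment n → Prop
  | [], g, a => g a
  | (Quantifier.ex, X) :: ls, g, a => ∃ b, AgreeOff X a b ∧ PrefixHolds ls g b
  | (Quantifier.all, X) :: ls, g, a => ∀ b, AgreeOff X a b → PrefixHolds ls g b

theorem stateHolds_wrap (ls : Levels n) (s : Dat) (a : Assignment n) :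
    StateHolds ls (Dat.wrap s (encLevels ls)) a ↔ PrefixHolds ls (LeafHolds s) a := by
  induction ls generalizing a with
  | nil => rfl
  | cons l ls ih =>
    have e : Dat.wrap s (encLevels (l :: ls)) = Dat.ite (Dat.wrap s (encLevels ls))
      (Dat.cons (Dat.wrap s (encLevels ls)) Dat.nil) Dat.nil := rfl
    rw [e]
    cases h : Dat.wrap s (encLevels ls) with
    | nil =>
      rw [h] at ih
      refine iff_of_false (not_stateHolds_nil _ _) ?_
      obtain ⟨_ | _, X⟩ := l
      · rintro ⟨b, -, hb⟩
        exact not_stateHolds_nil _ _ ((ih b).2 hb)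
      · intro hb
        exact not_stateHolds_nil _ _ ((ih a).2 (hb a (AgreeOff.refl X a)))
    | cons u v =>
      rw [h] at ih
      obtain ⟨_ | _, X⟩ := l <;> simp [StateHolds, PrefixHolds, ih]

theorem wellFormed_wrap {R : Fin n → Prop} (ls : Levels n) {s : Dat} (h : WellFormed R [] s) :
    WellFormed R ls (Dat.wrap s (encLevels ls)) := by
  induction ls with
  | nil => exact h
  | cons l ls ih =>
    have e : Dat.wrap s (encLevels (l :: ls)) = Dat.ite (Dat.wrap s (encLevels ls))
      (Dat.cons (Dat.wrap s (encLevels ls)) Dat.nil) Dat.nil := rfl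
    rw [e]
    intro e he
    cases h : Dat.wrap s (encLevels ls) with
    | nil => simp [h] at he
    | cons u v =>
      rw [h] at ih he
      simp only [Dat.ite_cons, Dat.toList_cons, Dat.toList_nil, List.mem_singleton] at he
      subst he
      exact ⟨by simp, ih⟩

/-! ### Quantifier prefixes -/

/-- The function `Q₁x₁ … Qₘxₘ. f`. -/
def quantifyList (quant : Fin n → Quantifier) (xs : List (Fin n)) (f : Assignment n → Bool) :
    Assignment n → Bool :=
  xs.foldr (fun x g => quantifyFun (quant x) x g) f

def addVar (x : Fin n) (Q : Quantifier) : Levels n → Levels n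
  | [] => [(Q, [x])]
  | (Q', X) :: ls => if Q = Q' then (Q', x :: X) :: ls else (Q, [x]) :: (Q', X) :: ls

def levelsOf (quant : Fin n → Quantifier) (xs : List (Fin n)) : Levels n :=
  xs.foldr (fun x ls => addVar x (quant x) ls) []

theorem encLevels_addVar (x : Fin n) (Q : Quantifier) (ls : Levels n) :
    encLevels (addVar x Q ls) = Dat.addLevel (encFin x) (encQuantifier Q) (encLevels ls) := by
  rcases ls with _ | ⟨⟨Q', X⟩, ls⟩
  · rfl
  · simp only [addVar, Dat.addLevel, encLevels, encList, Dat.ite_cons, Dat.fst_cons, Dat.snd_cons,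
      Dat.encQuantifier_injective.eq_iff]
    split_ifs with h
    · subst h; rfl
    · rfl

theorem flatMap_addVar (x : Fin n) (Q : Quantifier) (ls : Levels n) :
    (addVar x Q ls).flatMap Prod.snd = x :: ls.flatMap Prod.snd := by
  rcases ls with _ | ⟨⟨Q', X⟩, ls⟩
  · rfl
  · simp only [addVar]
    split_ifs <;> simp

theorem flatMap_levelsOf (quant : Fin n → Quantifier) (xs : List (Fin n)) :
    (levelsOf quant xs).flatMap Prod.snd = xs := by
  induction xs with
  | nil => rfl
  | cons x xs ih => rw [levelsOf, List.foldr_cons, flatMap_addVar]; exact congrArg _ ih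

theorem levelsOf_disjoint (quant : Fin n → Quantifier) {xs : List (Fin n)} (h : xs.Nodup) :
    (levelsOf quant xs).Pairwise fun l l' => ∀ x ∈ l.2, x ∉ l'.2 := by
  rw [← flatMap_levelsOf quant xs, List.nodup_flatMap] at h
  exact h.2.imp fun hd x hx hx' => hd hx hx'

theorem agreeOff_nil {a b : Assignment n} : AgreeOff [] a b ↔ b = a :=
  ⟨fun h => funext fun z => h z (by simp), fun h z _ => by rw [h]⟩

theorem agreeOff_cons {x : Fin n} {X : List (Fin n)} {a b : Assignment n} :
    AgreeOff (x :: X) a b ↔ ∃ c, AgreeOff X (Function.update a x c) b := by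
  constructor
  · intro h
    refine ⟨b x, fun z hz => ?_⟩
    by_cases hzx : z = x
    · subst hzx; simp
    · rw [Function.update_of_ne hzx, h z (by simp [hzx, hz])]
  · rintro ⟨c, h⟩ z hz
    simp only [List.mem_cons, not_or] at hz
    rw [h z hz.2, Function.update_of_ne hz.1]

theorem quantifyFun_eq_true {Q : Quantifier} {x : Fin n} {f : Assignment n → Bool}
    {a : Assignment n} : quantifyFun Q x f a = true ↔
      match Q with
      | Quantifier.ex => ∃ c, f (Function.update a x c) = true
      | Quantifier.all => ∀ c, f (Function.update a x c) = true := by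
  cases Q <;> simp [quantifyFun, restrictFun, Bool.exists_bool, Bool.forall_bool]

/-- If the next block has the same quantifier, `x` joins it: changing `x` and then the variables of
the block is changing the variables of the enlarged block. -/
theorem prefixHolds_addVar (x : Fin n) (Q : Quantifier) (ls : Levels n) (g : Assignment n → Prop)
    (f : Assignment n → Bool) (h : ∀ a, PrefixHolds ls g a ↔ f a = true) (a : Assignment n) :
    PrefixHolds (addVar x Q ls) g a ↔ quantifyFun Q x f a = true := by
  have new : PrefixHolds ((Q, [x]) :: ls) g a ↔ quantifyFun Q x f a = true := by
    rw [quantifyFun_eq_true]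
    cases Q with
    | ex =>
      simp only [PrefixHolds, agreeOff_cons, agreeOff_nil, h]
      exact ⟨fun ⟨b, ⟨c, hc⟩, hb⟩ => ⟨c, hc ▸ hb⟩, fun ⟨c, hc⟩ => ⟨_, ⟨c, rfl⟩, hc⟩⟩
    | all =>
      simp only [PrefixHolds, agreeOff_cons, agreeOff_nil, h]
      exact ⟨fun h c => h _ ⟨c, rfl⟩, fun h b ⟨c, hc⟩ => hc ▸ h c⟩
  rcases ls with _ | ⟨⟨Q', X⟩, ls⟩
  · exact new
  · simp only [addVar]
    split_ifs with hQ
    · subst hQ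
      rw [quantifyFun_eq_true]
      cases Q with
      | ex =>
        simp only [PrefixHolds, agreeOff_cons] at h ⊢
        simp only [← h]
        exact ⟨fun ⟨b, ⟨c, hc⟩, hb⟩ => ⟨c, b, hc, hb⟩, fun ⟨c, b, hc, hb⟩ => ⟨b, ⟨c, hc⟩, hb⟩⟩
      | all =>
        simp only [PrefixHolds, agreeOff_cons] at h ⊢
        simp only [← h]
        exact ⟨fun h c b hb => h b ⟨c, hb⟩, fun h b ⟨c, hc⟩ => h c b hc⟩
    · exact new

theorem prefixHolds_levelsOf (quant : Fin n → Quantifier) (xs : List (Fin n))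
    (f : Assignment n → Bool) (g : Assignment n → Prop) (hg : ∀ a, g a ↔ f a = true)
    (a : Assignment n) :
    PrefixHolds (levelsOf quant xs) g a ↔ quantifyList quant xs f a = true := by
  induction xs generalizing a with
  | nil => exact hg a
  | cons x xs ih => exact prefixHolds_addVar x (quant x) _ g _ ih a

/-- The conjunction of a list of clauses. -/
def cnfFun (T : List (Clause n)) : Assignment n → Bool := fun a => T.all fun C => C.eval a

theorem leafHolds_encClauses (T : List (Clause n)) (a : Assignment n) :
    LeafHolds (Dat.leaf (encList encClause T)) a ↔ cnfFun T a = true := by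
  rw [leafHolds_leaf]
  simp only [Dat.toList_encList, List.forall_mem_map, cnfFun, List.all_eq_true]
  refine forall₂_congr fun C _ => ?_
  simp only [encClause, Dat.toList_encList, List.mem_map, exists_exists_and_eq_and, Clause.eval,
    List.any_eq_true, beq_iff_eq]
  exact exists_congr fun l => and_congr_right fun _ => litHolds_encLiteral

/-- The initial state for a list of variables to be eliminated and a list of clauses. -/
def startState (ls : Levels n) (T : List (Clause n)) : Dat :=
  Dat.initState (encLevels ls) (encList encClause T)

/-- The automaton computes the quantified conjunction of the clauses. -/
theorem stateAut_value_startState (quant : Fin n → Quantifier) {xs : List (Fin n)} (h : xs.Nodup)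
    (T : List (Clause n)) (π : VarOrder n) :
    (stateAut (levelsOf quant xs)).value (orderList π) (startState (levelsOf quant xs) T) =
      quantifyList quant xs (cnfFun T) := by
  funext a
  rw [Bool.eq_iff_iff, stateAut_value _ (levelsOf_disjoint quant h)]
  · rw [startState, Dat.initState, stateHolds_wrap]
    exact prefixHolds_levelsOf quant xs _ _ (leafHolds_encClauses T) a
  · refine wellFormed_wrap _ (wellFormed_leaf ?_)
    simp only [Dat.toList_encList, List.forall_mem_map, encClause]
    exact fun C _ l _ => ⟨l.1, l.2, rfl, mem_orderList π _⟩

/-! ### Towers -/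

theorem tower_le_succ (k h : ℕ) : tower k h ≤ tower k (h + 1) := Nat.lt_two_pow_self.le

theorem tower_mono (k : ℕ) {h h' : ℕ} (hh : h ≤ h') : tower k h ≤ tower k h' :=
  monotone_nat_of_le_succ (tower_le_succ k) hh

theorem tower_succ_pos (k h : ℕ) : 1 ≤ tower k (h + 1) := Nat.one_le_two_pow

/-- The exponent 3 is reproduced from one level to the next in `size_le_of_mem_stateSet`: with M =
2^m, the product M · (M² + 3M) consists of the two leading terms of (M + 1)³. -/
theorem succ_pow_three_le (m : ℕ) : (m + 1) ^ 3 ≤ (2 ^ m) ^ 2 + 3 * 2 ^ m := by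
  rcases Nat.lt_or_ge m 3 with h | h
  · interval_cases m <;> norm_num
  · induction m, h using Nat.le_induction with
    | base => norm_num
    | succ m hm ih =>
      have : (m + 1 + 1) ^ 3 ≤ 2 * (m + 1) ^ 3 := by nlinarith [Nat.mul_le_mul hm hm]
      have h2 : 2 ^ (m + 1) = 2 * 2 ^ m := by ring
      rw [h2]
      nlinarith

/-! ### Counting states -/

/-- The sorted list of the elements of a finite set. -/
noncomputable def Dat.ofSet (S : Finset Dat) : Dat := Dat.sort (encList id S.toList)

/-- The possible states with `h` levels, where `Λ` contains the possible leaves. -/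
noncomputable def stateSet (Λ : Finset Dat) : ℕ → Finset Dat
  | 0 => insert Dat.nil Λ
  | h + 1 => ((stateSet Λ h).erase Dat.nil).powerset.image Dat.ofSet

theorem mem_stateSet_succ {Λ : Finset Dat} {h : ℕ} {s : Dat} :
    s ∈ stateSet Λ (h + 1) ↔ (s.toList.Pairwise fun a b => Dat.lt a b = true) ∧
      ∀ x ∈ s.toList, x ∈ stateSet Λ h ∧ x ≠ Dat.nil := by
  simp only [stateSet, Finset.mem_image, Finset.mem_powerset]
  constructor
  · rintro ⟨S, hS, rfl⟩
    refine ⟨Dat.sort_sorted _, fun x hx => ?_⟩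
    rw [Dat.ofSet, Dat.mem_sort] at hx
    simp only [Dat.toList_encList, List.map_id, Finset.mem_toList] at hx
    exact (Finset.mem_erase.1 (hS hx)).symm
  · rintro ⟨h₁, h₂⟩
    refine ⟨s.toList.toFinset, fun x hx => ?_, ?_⟩
    · obtain ⟨h₃, h₄⟩ := h₂ x (List.mem_toFinset.1 hx)
      exact Finset.mem_erase.2 ⟨h₄, h₃⟩
    · refine Dat.eq_of_sorted (Dat.sort_sorted _) h₁ fun x => ?_
      rw [Dat.ofSet, Dat.mem_sort]
      simp

theorem collect_mem_stateSet {Λ : Finset Dat} {h : ℕ} {Q raw : Dat}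
    (hraw : ∀ x ∈ raw.toList, x ∈ stateSet Λ h) : Dat.collect Q raw ∈ stateSet Λ (h + 1) :=
  mem_stateSet_succ.2 ⟨Dat.collect_sorted _ _, fun x hx =>
    let ⟨h₁, h₂⟩ := Dat.mem_collect hx
    ⟨hraw x h₁, h₂⟩⟩

section Step

variable {Λ Λ' : Finset Dat} {y : Fin n}

theorem assign_mem_stateSet
    (hΛ : ∀ t ∈ insert Dat.nil Λ, ∀ b, Dat.leafAssign (litPair y b) t ∈ insert Dat.nil Λ')
    (ls : Levels n) (b : Bool) {s : Dat} (hs : s ∈ stateSet Λ ls.length) :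
    Dat.assign (stateParam ls y b) s ∈ stateSet Λ' ls.length := by
  induction ls generalizing s with
  | nil => exact hΛ s hs b
  | cons l ls ih =>
    rw [Dat.assign_cons]
    refine collect_mem_stateSet fun x hx => ?_
    rw [Dat.toList_encList, List.mem_map] at hx
    obtain ⟨e, he, rfl⟩ := hx
    exact ih ((mem_stateSet_succ.1 hs).2 e he).1

theorem step_mem_stateSet
    (hΛ : ∀ t ∈ insert Dat.nil Λ, ∀ b, Dat.leafAssign (litPair y b) t ∈ insert Dat.nil Λ')
    (ls : Levels n) (b : Bool) {s : Dat} (hs : s ∈ stateSet Λ ls.length) :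
    Dat.step (stateParam ls y b) s ∈ stateSet Λ' ls.length := by
  induction ls generalizing s with
  | nil => exact hΛ s hs b
  | cons l ls ih =>
    by_cases hy : y ∈ l.2
    · rw [Dat.step_cons_of_mem hy]
      refine collect_mem_stateSet fun x hx => ?_
      simp only [Dat.toList_encList, List.map_id, List.mem_flatMap, List.mem_cons,
        List.not_mem_nil, or_false] at hx
      obtain ⟨e, he, rfl | rfl⟩ := hx
      · exact assign_mem_stateSet hΛ ls _ ((mem_stateSet_succ.1 hs).2 e he).1
      · exact assign_mem_stateSet hΛ ls _ ((mem_stateSet_succ.1 hs).2 e he).1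
    · rw [Dat.step_cons_of_notMem hy]
      refine collect_mem_stateSet fun x hx => ?_
      rw [Dat.toList_encList, List.mem_map] at hx
      obtain ⟨e, he, rfl⟩ := hx
      exact ih ((mem_stateSet_succ.1 hs).2 e he).1

end Step

theorem wrap_mem_stateSet {Λ : Finset Dat} {s : Dat} (hs : s ∈ insert Dat.nil Λ) (ls : Levels n) :
    Dat.wrap s (encLevels ls) ∈ stateSet Λ ls.length := by
  induction ls with
  | nil => exact hs
  | cons l ls ih =>
    have e : Dat.wrap s (encLevels (l :: ls)) = Dat.ite (Dat.wrap s (encLevels ls))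
      (Dat.cons (Dat.wrap s (encLevels ls)) Dat.nil) Dat.nil := rfl
    rw [e, List.length_cons, mem_stateSet_succ]
    cases h : Dat.wrap s (encLevels ls) with
    | nil => simp
    | cons u v => rw [h] at ih; simp [ih]

/-- The leaves that are reachable when the variables in `pre` have been read. -/
noncomputable def leafLayer (T : List (Clause n)) (pre : List (Fin n)) : Finset Dat :=
  Finset.univ.image fun a =>
    (stateAut ([] : Levels n)).run pre a (Dat.leaf (encList encClause T))

/-- The leaves of a state stem from many assignments of `pre`, as quantified variables take both
values; hence `leafLayer` ranges over all assignments. The hypothesis `hA` allows for automata that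
use a value other than the one read, as `restrictAut` does. -/
theorem run_mem_stateSet (T : List (Clause n)) (ls : Levels n) (pre : List (Fin n))
    (hpre : pre.Nodup) (a : Assignment n) (A : Automaton n Dat)
    (hA : ∀ y b s, ∃ c, A.step y b s = Dat.step (stateParam ls y c) s) :
    A.run pre a (startState ls T) ∈ stateSet (leafLayer T pre) ls.length := by
  induction pre using List.reverseRecOn with
  | nil =>
    refine wrap_mem_stateSet (Finset.mem_insert_of_mem ?_) ls
    exact Finset.mem_image.2 ⟨a, Finset.mem_univ _, rfl⟩
  | append_singleton pre y ih =>
    rw [Automaton.run_append]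
    obtain ⟨c, hc⟩ := hA y (a y) (A.run pre a (startState ls T))
    have : A.run [y] a (A.run pre a (startState ls T)) = _ := hc
    rw [this]
    rw [List.nodup_append] at hpre
    refine step_mem_stateSet (fun t ht b => ?_) ls _ (ih hpre.1)
    rcases Finset.mem_insert.1 ht with rfl | ht
    · simp [Dat.leafAssign]
    · obtain ⟨a', -, rfl⟩ := Finset.mem_image.1 ht
      refine Finset.mem_insert_of_mem (Finset.mem_image.2 ⟨Function.update a' y b,
        Finset.mem_univ _, ?_⟩)
      rw [Automaton.run_append, Automaton.run_congr (l := pre) (b := a')]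
      · simp [Automaton.run, stateAut, Dat.step_nil]
      · intro z hz
        exact Function.update_of_ne (fun h => hpre.2.2 z hz y (by simp) h) _ _

/-- One power set per level, starting from 2^k leaves. Only nonfalse states can be elements, so
`nil` does not count in the exponent and the bound is an exact tower. -/
theorem card_erase_stateSet {Λ : Finset Dat} {k : ℕ} (hΛ : (Λ.erase Dat.nil).card ≤ 2 ^ k)
    (h : ℕ) : ((stateSet Λ h).erase Dat.nil).card ≤ tower k (h + 1) := by
  induction h with
  | zero =>
    refine le_trans (Finset.card_le_card fun x hx => ?_) hΛ
    simp only [stateSet, Finset.mem_erase, Finset.mem_insert] at hx ⊢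
    tauto
  | succ h ih =>
    calc _ ≤ (stateSet Λ (h + 1)).card := Finset.card_le_card (Finset.erase_subset _ _)
      _ ≤ ((stateSet Λ h).erase Dat.nil).powerset.card := Finset.card_image_le
      _ = 2 ^ ((stateSet Λ h).erase Dat.nil).card := Finset.card_powerset _
      _ ≤ 2 ^ tower k (h + 1) := Nat.pow_le_pow_right (by omega) ih

theorem card_stateSet {Λ : Finset Dat} {k : ℕ} (hΛ : (Λ.erase Dat.nil).card ≤ 2 ^ k)
    (h : ℕ) : (stateSet Λ h).card ≤ 2 * tower k (h + 1) := by
  have h1 := card_erase_stateSet hΛ h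
  have h2 := tower_succ_pos k h
  have h3 := Finset.pred_card_le_card_erase (s := stateSet Λ h) (a := Dat.nil)
  omega

/-- The size is governed by the number of elements of the outermost set, which is one exponential
below the number of states of this level. The elements have size polynomial in the previous tower,
which is only logarithmic in their number. -/
theorem size_le_of_mem_stateSet {Λ : Finset Dat} {k F : ℕ} (hF : 1 ≤ F)
    (hΛ : (Λ.erase Dat.nil).card ≤ 2 ^ k) (hsize : ∀ t ∈ Λ, t.size ≤ F) (h : ℕ) {s : Dat}
    (hs : s ∈ stateSet Λ h) : s.size ≤ 8 * F * (tower k h + 1) ^ 3 := by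
  induction h generalizing s with
  | zero =>
    have : s.size ≤ F := by
      rcases Finset.mem_insert.1 hs with rfl | hs
      · exact hF
      · exact hsize s hs
    have h2 : 1 ≤ (tower k 0 + 1) ^ 3 := Nat.one_le_pow _ _ (by omega)
    nlinarith
  | succ h ih =>
    obtain ⟨h₁, h₂⟩ := mem_stateSet_succ.1 hs
    have hlen : s.toList.length ≤ tower k (h + 1) := by
      have hnd : s.toList.Nodup := h₁.imp fun {a b} hab he => by
        subst he; simp [Dat.lt_irrefl] at hab
      rw [← List.toFinset_card_of_nodup hnd]
      refine (Finset.card_le_card fun x hx => ?_).trans (card_erase_stateSet hΛ h)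
      obtain ⟨h₃, h₄⟩ := h₂ x (List.mem_toFinset.1 hx)
      exact Finset.mem_erase.2 ⟨h₄, h₃⟩
    have hsz := Dat.size_encList_le (f := id) (l := s.toList) (m := 8 * F * (tower k h + 1) ^ 3)
      fun x hx => ih (h₂ x hx).1
    rw [Dat.encList_toList] at hsz
    have key := succ_pow_three_le (tower k h)
    have e : tower k (h + 1) = 2 ^ tower k h := rfl
    rw [e] at hlen ⊢
    have hm : 1 ≤ 2 ^ tower k h := Nat.one_le_two_pow
    generalize 2 ^ tower k h = m at *
    generalize (tower k h + 1) ^ 3 = u at *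
    generalize s.toList.length = ℓ at *
    have h1 : ℓ * (8 * F * u + 1) ≤ m * (8 * F * u + 1) := Nat.mul_le_mul_right _ hlen
    have h2 : 8 * F * (m * u) ≤ 8 * F * (m * (m ^ 2 + 3 * m)) := by gcongr
    have h3 : 8 * F * (m + 1) ^ 3 =
      8 * F * (m * (m ^ 2 + 3 * m)) + 8 * F * (3 * m + 1) := by ring
    have h4 : m + 1 ≤ 8 * F * (3 * m + 1) := by nlinarith
    nlinarith

theorem size_run_le (A : Automaton n Dat) (hA : ∀ y b s, (A.step y b s).size ≤ 2 * s.size)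
    (pre : List (Fin n)) (a : Assignment n) (s : Dat) :
    (A.run pre a s).size ≤ 2 ^ pre.length * s.size := by
  induction pre generalizing s with
  | nil => simp [Automaton.run]
  | cons y pre ih =>
    have h₁ := ih (A.step y (a y) s)
    have h₂ := hA y (a y) s
    have e : A.run (y :: pre) a s = A.run pre a (A.step y (a y) s) := rfl
    rw [e, List.length_cons, pow_succ]
    calc _ ≤ 2 ^ pre.length * (A.step y (a y) s).size := h₁
      _ ≤ 2 ^ pre.length * (2 * s.size) := Nat.mul_le_mul_left _ h₂
      _ = _ := by ring

theorem size_leafRun_le (T : List (Clause n)) (pre : List (Fin n)) {t : Dat}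
    (ht : t ∈ leafLayer T pre) : t.size ≤ (encList encClause T).size + 2 := by
  obtain ⟨a, -, rfl⟩ := Finset.mem_image.1 ht
  clear ht
  refine le_trans ?_ (Dat.size_leaf_le _)
  generalize Dat.leaf (encList encClause T) = s
  induction pre generalizing s with
  | nil => exact le_rfl
  | cons y pre ih => exact (ih _).trans (Dat.size_leafAssign_le _ s)

/-! ### Residual clauses -/

/-- The clause is satisfied by the variables in `pre`. -/
def SatBy (pre : List (Fin n)) (a : Assignment n) (C : Clause n) : Prop :=
  ∃ l ∈ C, l.1 ∈ pre ∧ a l.1 = l.2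

instance (pre : List (Fin n)) (a : Assignment n) (C : Clause n) : Decidable (SatBy pre a C) :=
  inferInstanceAs (Decidable (∃ l ∈ C, l.1 ∈ pre ∧ a l.1 = l.2))

def residualClauses (pre : List (Fin n)) (a : Assignment n) (T : List (Clause n)) : List (Clause n) :=
  (T.filter fun C => ¬ SatBy pre a C).map fun C => C.filter fun l => l.1 ∉ pre

theorem filterNe_encClause (l : Literal n) (C : Clause n) :
    Dat.filterNe (encLiteral l) (encClause C) = encClause (C.filter fun l' => l' ≠ l) := by
  induction C with
  | nil => rfl
  | cons l' C ih =>
    have e : encClause (l' :: C) = Dat.cons (encLiteral l') (encClause C) := rfl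
    rw [e, Dat.filterNe, ih]
    by_cases h : l' = l
    · rw [if_pos (by rw [h])]
      simp [h]
    · rw [if_neg (fun h' => h (Dat.encLiteral_injective h'))]
      simp [h, encClause, encList]

theorem cnfAssign_residualClauses (pre : List (Fin n)) (y : Fin n) (hy : y ∉ pre) (a : Assignment n)
    (T : List (Clause n)) :
    Dat.cnfAssign (litPair y (a y)) (encList encClause (residualClauses pre a T)) =
      encList encClause (residualClauses (pre ++ [y]) a T) := by
  induction T with
  | nil => rfl
  | cons C T ih =>
    by_cases h : SatBy pre a C
    · have h' : SatBy (pre ++ [y]) a C :=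
        let ⟨l, h₁, h₂, h₃⟩ := h
        ⟨l, h₁, by simp [h₂], h₃⟩
      have e₁ : residualClauses pre a (C :: T) = residualClauses pre a T := by simp [residualClauses, h]
      have e₂ : residualClauses (pre ++ [y]) a (C :: T) = residualClauses (pre ++ [y]) a T := by
        simp [residualClauses, h']
      rw [e₁, e₂, ih]
    · have e₁ : residualClauses pre a (C :: T) = C.filter (fun l => l.1 ∉ pre) :: residualClauses pre a T := by
        simp [residualClauses, h]
      have hmem : (litPair y (a y)).fst ∈ (encClause (C.filter fun l => l.1 ∉ pre)).toList ↔
          (y, a y) ∈ C := by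
        rw [litPair, Dat.fst_cons, encClause, Dat.toList_encList,
          List.mem_map_of_injective Dat.encLiteral_injective]
        simp [hy]
      rw [e₁, encList, Dat.cnfAssign, if_congr hmem rfl rfl, ih]
      split_ifs with hC
      · have h' : SatBy (pre ++ [y]) a C := ⟨_, hC, by simp, rfl⟩
        have e₂ : residualClauses (pre ++ [y]) a (C :: T) = residualClauses (pre ++ [y]) a T := by
          simp [residualClauses, h']
        rw [e₂]
      · have h' : ¬ SatBy (pre ++ [y]) a C := by
          rintro ⟨l, h₁, h₂, h₃⟩
          rcases List.mem_append.1 h₂ with h₂ | h₂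
          · exact h ⟨l, h₁, h₂, h₃⟩
          · rw [List.mem_singleton] at h₂
            refine hC ?_
            rwa [← h₂, h₃]
        have e₂ : residualClauses (pre ++ [y]) a (C :: T) =
            C.filter (fun l => l.1 ∉ pre ++ [y]) :: residualClauses (pre ++ [y]) a T := by
          simp [residualClauses, h']
        rw [e₂, encList, litPair, Dat.snd_cons, filterNe_encClause, List.filter_filter]
        congr 2
        refine List.filter_congr fun l hl => ?_
        -- The satisfied literal of `y` does not occur in `C`, so removing the falsified literal
        -- removes every occurrence of `y`.
        have : l.1 = y ↔ l = (y, !a y) := by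
          refine ⟨fun h₁ => Prod.ext h₁ ?_, fun h₁ => by rw [h₁]⟩
          have h₂ : l.2 ≠ a y := fun h₂ => hC (by rw [← h₁, ← h₂] at *; exact hl)
          revert h₂
          cases l.2 <;> cases a y <;> simp
        simp [this, Bool.and_comm]

theorem nil_mem_encClauses {T : List (Clause n)} :
    Dat.nil ∈ (encList encClause T).toList ↔ [] ∈ T := by
  rw [Dat.toList_encList]
  have : Dat.nil = encClause ([] : Clause n) := rfl
  rw [this, List.mem_map_of_injective Dat.encClause_injective]

theorem leafRun_eq (T : List (Clause n)) (pre : List (Fin n)) (hpre : pre.Nodup)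
    (a : Assignment n) :
    (stateAut ([] : Levels n)).run pre a (Dat.leaf (encList encClause T)) =
      Dat.leaf (encList encClause (residualClauses pre a T)) := by
  induction pre using List.reverseRecOn with
  | nil =>
    have : residualClauses [] a T = T := by
      simp only [residualClauses]
      rw [List.filter_eq_self.2 (by simp [SatBy])]
      simp
    rw [this]; rfl
  | append_singleton pre y ih =>
    rw [List.nodup_append] at hpre
    have hy : y ∉ pre := fun h => hpre.2.2 y h y (by simp) rfl
    rw [Automaton.run_append, ih hpre.1]
    change Dat.leafAssign (litPair y (a y)) (Dat.leaf (encList encClause (residualClauses pre a T))) = _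
    rw [← cnfAssign_residualClauses pre y hy a T]
    conv_lhs => arg 2; unfold Dat.leaf
    split_ifs with h
    · have : Dat.nil ∈ (Dat.cnfAssign (litPair y (a y))
          (encList encClause (residualClauses pre a T))).toList :=
        mem_cnfAssign.2 ⟨_, h, by simp, rfl⟩
      simp [Dat.leafAssign, Dat.leaf, this]
    · rfl

theorem Clause.mem_vars {C : Clause n} {x : Fin n} : x ∈ C.vars ↔ ∃ l ∈ C, l.1 = x := by
  simp [Clause.vars]

/-- The variables in `pre` that share a clause with a variable that is not in `pre`. -/
def separator (Φ : PCNF n) (pre : List (Fin n)) : Finset (Fin n) :=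
  Finset.univ.filter fun x => x ∈ pre ∧ ∃ z, z ∉ pre ∧ ∃ C ∈ Φ.clauses, x ∈ C.vars ∧ z ∈ C.vars

/-- A clause all of whose variables have been read must be satisfied, as it would leave an empty
clause otherwise. In a clause with an unread variable all variables that have been read belong to
the separator, so both assignments treat it alike. -/
theorem residualClauses_congr {Φ : PCNF n} {T : List (Clause n)} (hT : T ⊆ Φ.clauses)
    {pre : List (Fin n)} {a b : Assignment n} (hab : ∀ x ∈ separator Φ pre, a x = b x)
    (ha : [] ∉ residualClauses pre a T) (hb : [] ∉ residualClauses pre b T) :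
    residualClauses pre a T = residualClauses pre b T := by
  have full : ∀ {a : Assignment n}, [] ∉ residualClauses pre a T → ∀ C ∈ T, (∀ l ∈ C, l.1 ∈ pre) →
      SatBy pre a C := by
    intro a ha C hC hl
    by_contra h
    refine ha (List.mem_map.2 ⟨C, List.mem_filter.2 ⟨hC, by simpa using h⟩, ?_⟩)
    rw [List.filter_eq_nil_iff]
    simpa using hl
  simp only [residualClauses]
  congr 1
  refine List.filter_congr fun C hC => ?_
  by_cases hl : ∀ l ∈ C, l.1 ∈ pre
  · simp [full ha C hC hl, full hb C hC hl]
  · push Not at hl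
    obtain ⟨l, hl, hlp⟩ := hl
    have : SatBy pre a C ↔ SatBy pre b C := by
      refine exists_congr fun l' => and_congr_right fun hl' => and_congr_right fun hp => ?_
      rw [hab l'.1]
      simp only [separator, Finset.mem_filter, Finset.mem_univ, true_and]
      exact ⟨hp, l.1, hlp, C, hT hC, Clause.mem_vars.2 ⟨l', hl', rfl⟩,
        Clause.mem_vars.2 ⟨l, hl, rfl⟩⟩
    simp [this]

/-- By `residualClauses_congr`, the leaves other than `nil` inject into the assignments of the
separator. -/
theorem card_leafLayer {Φ : PCNF n} {T : List (Clause n)} (hT : T ⊆ Φ.clauses)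
    {pre : List (Fin n)} (hpre : pre.Nodup) :
    ((leafLayer T pre).erase Dat.nil).card ≤ 2 ^ (separator Φ pre).card := by
  have hfun : ∀ t ∈ (leafLayer T pre).erase Dat.nil, ∃ a : Assignment n,
      [] ∉ residualClauses pre a T ∧ t = Dat.cons Dat.nil (encList encClause (residualClauses pre a T)) := by
    intro t ht
    obtain ⟨h₁, h₂⟩ := Finset.mem_erase.1 ht
    obtain ⟨a, -, rfl⟩ := Finset.mem_image.1 h₂
    rw [leafRun_eq T pre hpre] at h₁ ⊢
    unfold Dat.leaf at h₁ ⊢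
    split_ifs at h₁ ⊢ with h
    · exact absurd rfl h₁
    · exact ⟨a, fun h' => h (nil_mem_encClauses.2 h'), rfl⟩
  choose! φ hφ₁ hφ₂ using hfun
  calc _ ≤ (Finset.univ : Finset (separator Φ pre → Bool)).card := by
        refine Finset.card_le_card_of_injOn (fun t x => φ t x.1) (fun _ _ => Finset.mem_univ _) ?_
        intro t ht t' ht' h
        rw [hφ₂ t ht, hφ₂ t' ht', residualClauses_congr hT (fun x hx => congrFun h ⟨x, hx⟩)
          (hφ₁ t ht) (hφ₁ t' ht')]
    _ = _ := by simp

/-! ### The order of a path decomposition -/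

theorem mem_take_orderList {π : VarOrder n} {c : ℕ} {x : Fin n} :
    x ∈ (orderList π).take c ↔ (π x : ℕ) < c := by
  rw [List.mem_take_iff_getElem]
  constructor
  · rintro ⟨i, hi, rfl⟩
    simp [orderList] at hi ⊢
    omega
  · intro h
    exact ⟨π x, by simp [orderList]; omega, by simp [orderList]⟩

theorem orderList_nodup (π : VarOrder n) : (orderList π).Nodup :=
  (orderList_pairwise π).imp fun h => by rintro rfl; exact lt_irrefl _ h

/-- The variables are sorted by the first bag that contains them. Let v be the next variable to be
read. A variable x of the separator starts no later than v and shares a bag with an unread z that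
starts no earlier than v; by the interval property x lies in the first bag of v. This bag also
contains v, which is not in the separator, and so the bound is the width rather than the size of a
bag. -/
theorem exists_order (Φ : PCNF n) :
    ∃ π : VarOrder n, ∀ c, (separator Φ ((orderList π).take c)).card ≤ Φ.pathwidth := by
  have hne : {w | ∃ D : PathDecomposition Φ.primalGraph, D.width = w}.Nonempty :=
    ⟨_, ⟨1, fun _ => Finset.univ, fun v => ⟨0, Finset.mem_univ _⟩,
      fun v w _ => ⟨0, Finset.mem_univ _, Finset.mem_univ _⟩,
      fun v i j k _ _ _ _ => Finset.mem_univ _⟩, rfl⟩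
  obtain ⟨D, hD⟩ := Nat.sInf_mem hne
  have hex : ∀ v : Fin n, ∃ i : ℕ, ∃ h : i < D.length, v ∈ D.bag ⟨i, h⟩ := fun v =>
    let ⟨i, hi⟩ := D.vertex_mem v
    ⟨i, i.isLt, hi⟩
  classical
  set f : Fin n → ℕ := fun v => Nat.find (hex v) with hf
  have hmin : ∀ v i, v ∈ D.bag i → f v ≤ i := fun v i hi =>
    Nat.find_min' (hex v) ⟨i.isLt, hi⟩
  set π : VarOrder n := (Tuple.sort f).symm with hπ
  have hmono : ∀ x y, π x ≤ π y → f x ≤ f y := fun x y h => by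
    have := Tuple.monotone_sort f h
    simpa [hπ] using this
  refine ⟨π, fun c => ?_⟩
  set S := separator Φ ((orderList π).take c) with hS
  have hmemS : ∀ x, x ∈ S ↔ (π x : ℕ) < c ∧ ∃ z, ¬ ((π z : ℕ) < c) ∧ ∃ C ∈ Φ.clauses,
      x ∈ C.vars ∧ z ∈ C.vars := fun x => by
    simp [hS, separator, mem_take_orderList]
  rcases S.eq_empty_or_nonempty with hSe | ⟨x₀, hx₀⟩
  · simp [hSe]
  have hcn : c < n := by
    obtain ⟨-, z, hz, -⟩ := (hmemS x₀).1 hx₀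
    have := (π z).isLt
    omega
  set v := π.symm ⟨c, hcn⟩ with hv
  have hπv : (π v : ℕ) = c := by simp [hv]
  obtain ⟨hlt, hvb⟩ := Nat.find_spec (hex v)
  set i₀ : Fin D.length := ⟨f v, hlt⟩ with hi₀
  have hsub : insert v S ⊆ D.bag i₀ := by
    intro x hx
    rcases Finset.mem_insert.1 hx with rfl | hx
    · exact hvb
    · obtain ⟨hxc, z, hz, C, hC, hxC, hzC⟩ := (hmemS x).1 hx
      have hxz : x ≠ z := by rintro rfl; exact hz hxc
      obtain ⟨i, hxi, hzi⟩ := D.edge_mem x z ⟨hxz, C, hC, hxC, hzC⟩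
      obtain ⟨hlx, hxb⟩ := Nat.find_spec (hex x)
      have h₁ : f x ≤ f v := hmono x v (by rw [Fin.le_def]; omega)
      have h₂ : f v ≤ f z := hmono v z (by rw [Fin.le_def]; omega)
      exact D.interval x ⟨f x, hlx⟩ i i₀ h₁ (h₂.trans (hmin z i hzi)) hxb hxi
  have hvS : v ∉ S := fun h => by
    have := ((hmemS v).1 h).1
    omega
  have h₁ := Finset.card_le_card hsub
  rw [Finset.card_insert_of_notMem hvS] at h₁
  have h₂ : (D.bag i₀).card ≤ Finset.univ.sup fun i => (D.bag i).card :=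
    Finset.le_sup (f := fun i => (D.bag i).card) (Finset.mem_univ i₀)
  have h₃ : D.width = (Finset.univ.sup fun i => (D.bag i).card) - 1 := rfl
  have h₄ : Φ.pathwidth = D.width := hD.symm
  omega

/-! ### The number of levels -/

theorem drop_finRange {i : ℕ} (hi : i < n) :
    (List.finRange n).drop i = ⟨i, hi⟩ :: (List.finRange n).drop (i + 1) := by
  rw [List.drop_eq_getElem_cons (by simpa using hi)]
  simp

/-- The suffix from `i` on meets the block of `i` and the blocks that start after `i`; the latter
are counted by `B i`. The block of `i` is paid for by position `0`, which starts a block but is not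
in `B i`. -/
theorem length_levelsOf_le (Φ : PCNF n) (i : ℕ) :
    (levelsOf Φ.quant ((List.finRange n).drop i)).length ≤ Φ.numBlocks := by
  set B : ℕ → Finset (Fin n) := fun i => Finset.univ.filter fun j : Fin n =>
    i < (j : ℕ) ∧ ∀ j' : Fin n, (j' : ℕ) + 1 = j → Φ.quant j' ≠ Φ.quant j with hB
  have hhead : ∀ i (hi : i < n), ∃ X ls,
      levelsOf Φ.quant ((List.finRange n).drop i) = (Φ.quant ⟨i, hi⟩, X) :: ls := by
    intro i hi
    rw [drop_finRange hi, levelsOf, List.foldr_cons]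
    generalize List.foldr _ _ _ = ls
    rcases ls with _ | ⟨⟨Q', X⟩, ls⟩
    · exact ⟨_, _, rfl⟩
    · simp only [addVar]
      split_ifs with h
      · exact ⟨_, _, by rw [h]⟩
      · exact ⟨_, _, rfl⟩
  have key : ∀ d i, n - i = d →
      (levelsOf Φ.quant ((List.finRange n).drop i)).length ≤ (B i).card + 1 := by
    intro d
    induction d with
    | zero =>
      intro i hi
      rw [List.drop_eq_nil_of_le (by simp; omega)]
      simp [levelsOf]
    | succ d ih =>
      intro i hi
      have hin : i < n := by omega
      have ih' := ih (i + 1) (by omega)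
      have hsub : B (i + 1) ⊆ B i := fun j hj => by
        simp only [hB, Finset.mem_filter, Finset.mem_univ, true_and] at hj ⊢
        exact ⟨by omega, hj.2⟩
      have e : levelsOf Φ.quant ((List.finRange n).drop i) = addVar ⟨i, hin⟩ (Φ.quant ⟨i, hin⟩)
          (levelsOf Φ.quant ((List.finRange n).drop (i + 1))) := by
        rw [drop_finRange hin]; rfl
      rw [e]
      rcases Nat.lt_or_ge (i + 1) n with h | h
      · obtain ⟨X, ls, hl⟩ := hhead (i + 1) h
        rw [hl] at ih' ⊢
        simp only [addVar]
        split_ifs with hQ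
        · have := Finset.card_le_card hsub
          simp only [List.length_cons] at ih' ⊢
          omega
        · have hmem : (⟨i + 1, h⟩ : Fin n) ∈ B i := by
            simp only [hB, Finset.mem_filter, Finset.mem_univ, true_and]
            refine ⟨Nat.lt_succ_self i, fun j' hj' => ?_⟩
            have : j' = ⟨i, hin⟩ := Fin.ext (Nat.succ_injective hj')
            rw [this]; exact hQ
          have hnmem : (⟨i + 1, h⟩ : Fin n) ∉ B (i + 1) := by
            simp [hB]
          have := Finset.card_lt_card (Finset.ssubset_iff_of_subset hsub |>.2 ⟨_, hmem, hnmem⟩)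
          simp only [List.length_cons] at ih' ⊢
          omega
      · rw [List.drop_eq_nil_of_le (by simp; omega)]
        simp [levelsOf, addVar]
  rcases Nat.lt_or_ge i n with hi | hi
  · refine (key _ i rfl).trans ?_
    refine Nat.succ_le_of_lt (Finset.card_lt_card ((Finset.ssubset_iff_of_subset ?_).2
      ⟨⟨0, by omega⟩, ?_, ?_⟩))
    · intro j hj
      simp only [hB, Finset.mem_filter, Finset.mem_univ, true_and] at hj ⊢
      exact hj.2
    · simp
    · simp [hB]
  · rw [List.drop_eq_nil_of_le (by simpa using hi)]
    simp [levelsOf]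

/-! ### Quantified conjunctions of clauses -/

theorem quantifyList_congr_off (quant : Fin n → Quantifier) (xs : List (Fin n))
    (f : Assignment n → Bool) {a b : Assignment n} (h : ∀ z, z ∉ xs → a z = b z) :
    quantifyList quant xs f a = quantifyList quant xs f b := by
  induction xs generalizing a b with
  | nil => exact congrArg f (funext fun z => h z (by simp))
  | cons x xs ih =>
    have key : ∀ c, quantifyList quant xs f (Function.update a x c) =
        quantifyList quant xs f (Function.update b x c) := fun c => ih fun z hz => by
      by_cases hzx : z = x
      · subst hzx; simp
      · rw [Function.update_of_ne hzx, Function.update_of_ne hzx, h z (by simp [hzx, hz])]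
    change quantifyFun (quant x) x (quantifyList quant xs f) a =
      quantifyFun (quant x) x (quantifyList quant xs f) b
    cases quant x <;> simp [quantifyFun, restrictFun, key]

/-! ### Truth of a formula as the value of its quantified matrix -/

namespace PCNF

variable (Φ : PCNF n)

/-- The conjunction of the clauses in `T`, with the variables `x_m, x_{m+1}, …` eliminated. -/
def tail (m : ℕ) (T : List (Clause n)) : Assignment n → Bool :=
  quantifyList Φ.quant ((List.finRange n).drop m) (cnfFun T)

theorem tail_of_lt {m : ℕ} (hm : m < n) (T : List (Clause n)) :
    Φ.tail m T = quantifyFun (Φ.quant ⟨m, hm⟩) ⟨m, hm⟩ (Φ.tail (m + 1) T) := by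
  rw [tail, drop_finRange hm]; rfl

theorem tail_of_ge {m : ℕ} (hm : n ≤ m) (T : List (Clause n)) : Φ.tail m T = cnfFun T := by
  rw [tail, List.drop_eq_nil_of_le (by simpa using hm)]; rfl

theorem mem_drop_finRange {m : ℕ} {z : Fin n} : z ∈ (List.finRange n).drop m ↔ m ≤ z := by
  rw [List.mem_drop_iff_getElem]
  constructor
  · rintro ⟨i, hi, rfl⟩; simp
  · intro h; exact ⟨z - m, by simp; omega, by ext; simp; omega⟩

theorem tail_congr {m : ℕ} {T : List (Clause n)} {a b : Assignment n}
    (h : ∀ z : Fin n, (z : ℕ) < m → a z = b z) : Φ.tail m T a = Φ.tail m T b :=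
  quantifyList_congr_off _ _ _ fun z hz => h z (by rw [mem_drop_finRange] at hz; omega)

theorem tail_perm {m : ℕ} {T T' : List (Clause n)} (h : T.Perm T') : Φ.tail m T = Φ.tail m T' := by
  have : cnfFun T = cnfFun T' := funext fun a => by
    rw [Bool.eq_iff_iff]; simp [cnfFun, h.mem_iff]
  rw [tail, tail, this]

/-- If the quantified matrix were true, existential variables could be chosen from left to right so
that the rest of the formula stays true, while universal ones follow the winning strategy. At the
end the matrix would be satisfied. -/
theorem tail_zero_eq_false (h : Φ.IsFalse) : Φ.tail 0 Φ.clauses = fun _ => false := by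
  obtain ⟨f, hf, hw⟩ := h
  funext a₀
  by_contra h₀
  rw [Bool.not_eq_false] at h₀
  have key : ∀ i ≤ n, ∃ a, Φ.tail i Φ.clauses a = true ∧
      ∀ u : Fin n, (u : ℕ) < i → Φ.quant u = Quantifier.all → a u = f u a := by
    intro i
    induction i with
    | zero => exact fun _ => ⟨a₀, h₀, fun u hu => absurd hu (Nat.not_lt_zero _)⟩
    | succ i ih =>
      intro hi
      obtain ⟨a, ha, hs⟩ := ih (by omega)
      rw [Φ.tail_of_lt hi, quantifyFun_eq_true] at ha
      set x : Fin n := ⟨i, hi⟩ with hx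
      obtain ⟨c, hc, hcf⟩ : ∃ c, Φ.tail (i + 1) Φ.clauses (Function.update a x c) = true ∧
          (Φ.quant x = Quantifier.all → c = f x a) := by
        cases hq : Φ.quant x with
        | ex => rw [hq] at ha; obtain ⟨c, hc⟩ := ha; exact ⟨c, hc, by simp⟩
        | all => rw [hq] at ha; exact ⟨f x a, ha _, fun _ => rfl⟩
      refine ⟨_, hc, fun u hu hq => ?_⟩
      have hfu : f u (Function.update a x c) = f u a := hf u hq _ _ fun y hy =>
        Function.update_of_ne (fun h => by
          rw [h, hx, Fin.lt_def] at hy; simp at hy; omega) _ _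
      rw [hfu]
      by_cases hux : u = x
      · subst hux; rw [Function.update_self]; exact hcf hq
      · rw [Function.update_of_ne hux]
        refine hs u ?_ hq
        have : (u : ℕ) ≠ i := fun h => hux (Fin.ext h)
        omega
  obtain ⟨a, ha, hs⟩ := key n le_rfl
  refine hw a (fun u hq => hs u u.isLt hq) fun C hC => ?_
  rw [Φ.tail_of_ge le_rfl, cnfFun, List.all_eq_true] at ha
  exact ha C hC

/-- The universal player sets `u` to the value that the rest of the formula takes for `u = 0`: thus
`0` is played exactly if it falsifies the rest, and otherwise `1` falsifies it. This value depends
only on variables left of `u`. -/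
theorem isFalse_of_tail (a₀ : Assignment n) (h : Φ.tail 0 Φ.clauses a₀ = false) : Φ.IsFalse := by
  refine ⟨fun u a => Φ.tail (u + 1) Φ.clauses (Function.update a u false), fun u _ a b hab => ?_,
    fun a ha hsat => ?_⟩
  · refine Φ.tail_congr fun z hz => ?_
    by_cases hzu : z = u
    · subst hzu; simp
    · rw [Function.update_of_ne hzu, Function.update_of_ne hzu]
      refine hab z (Fin.lt_def.2 ?_)
      have : (z : ℕ) ≠ u := fun h => hzu (Fin.ext h)
      omega
  · have key : ∀ i ≤ n, Φ.tail i Φ.clauses a = false := by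
      intro i
      induction i with
      | zero => intro _; rw [← h]; exact Φ.tail_congr fun z hz => absurd hz (Nat.not_lt_zero _)
      | succ i ih =>
        intro hi
        have h₁ := ih (by omega)
        rw [Φ.tail_of_lt hi] at h₁
        set x : Fin n := ⟨i, hi⟩
        have hself : Function.update a x (a x) = a := Function.update_eq_self _ _
        cases hq : Φ.quant x with
        | ex =>
          rw [hq] at h₁
          simp only [quantifyFun, restrictFun, Bool.or_eq_false_iff] at h₁
          cases hax : a x with
          | false => rw [← h₁.1, ← hax, hself]
          | true => rw [← h₁.2, ← hax, hself]
        | all =>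
          rw [hq] at h₁
          have h₂ := ha x hq
          simp only [quantifyFun, restrictFun, Bool.and_eq_false_iff] at h₁
          cases hax : a x with
          | false =>
            rw [hax] at h₂ hself
            simp only [hself] at h₂
            exact h₂.symm
          | true =>
            rw [hax] at h₂ hself
            rcases h₁ with h₁ | h₁
            · exact absurd (h₂.trans h₁) (by simp)
            · rwa [hself] at h₁
    have h₁ := key n le_rfl
    rw [Φ.tail_of_ge le_rfl] at h₁
    have h₂ : cnfFun Φ.clauses a = true := List.all_eq_true.2 fun C hC => hsat C hC
    rw [h₂] at h₁
    exact absurd h₁ (by simp)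

theorem tail_zero_eq_true (h : Φ.IsTrue) : Φ.tail 0 Φ.clauses = fun _ => true :=
  funext fun a => by
    by_contra h'
    exact h (Φ.isFalse_of_tail a (by simpa using h'))

end PCNF

/-! ### Bounds on states -/

/-- The levels of the prefix from `x_m` on. -/
def PCNF.levels (Φ : PCNF n) (m : ℕ) : Levels n := levelsOf Φ.quant ((List.finRange n).drop m)

/-- The order `π` has small separators. -/
def SmallSeparators (Φ : PCNF n) (π : VarOrder n) (k : ℕ) : Prop :=
  ∀ c, (separator Φ ((orderList π).take c)).card ≤ k

section Bounds

variable {Φ : PCNF n} {π : VarOrder n} {k q : ℕ} {T : List (Clause n)} {A : Automaton n Dat} {m : ℕ}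

theorem card_layer_le (hπ : SmallSeparators Φ π k) (hq : Φ.numBlocks ≤ q) (hT : T ⊆ Φ.clauses)
    (hA : ∀ y b s, ∃ c, A.step y b s = Dat.step (stateParam (Φ.levels m) y c) s) (c : ℕ) :
    (A.layer π (startState (Φ.levels m) T) c).card ≤ 2 * tower k (q + 1) := by
  have hnd : ((orderList π).take c).Nodup := (orderList_nodup π).sublist (List.take_sublist _ _)
  calc _ ≤ (stateSet (leafLayer T ((orderList π).take c)) (Φ.levels m).length).card := by
        refine Finset.card_le_card fun s hs => ?_
        obtain ⟨a, -, rfl⟩ := Finset.mem_image.1 hs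
        exact run_mem_stateSet T _ _ hnd a A hA
    _ ≤ 2 * tower k ((Φ.levels m).length + 1) := card_stateSet
        ((card_leafLayer hT hnd).trans (Nat.pow_le_pow_right (by omega) (hπ c))) _
    _ ≤ _ := Nat.mul_le_mul_left _ (tower_mono k
        (Nat.succ_le_succ ((length_levelsOf_le Φ m).trans hq)))

theorem size_run_le_tower (hπ : SmallSeparators Φ π k) (hq : Φ.numBlocks ≤ q) (hT : T ⊆ Φ.clauses)
    (hA : ∀ y b s, ∃ c, A.step y b s = Dat.step (stateParam (Φ.levels m) y c) s) (c : ℕ)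
    (a : Assignment n) :
    (A.run ((orderList π).take c) a (startState (Φ.levels m) T)).size ≤
      8 * ((encList encClause T).size + 2) * (tower k q + 1) ^ 3 := by
  have hnd : ((orderList π).take c).Nodup := (orderList_nodup π).sublist (List.take_sublist _ _)
  refine (size_le_of_mem_stateSet (F := (encList encClause T).size + 2) (by omega)
    ((card_leafLayer hT hnd).trans (Nat.pow_le_pow_right (by omega) (hπ c)))
    (fun t ht => size_leafRun_le T _ ht) _ (run_mem_stateSet T _ _ hnd a A hA)).trans ?_
  have := tower_mono k ((length_levelsOf_le Φ m).trans hq)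
  exact Nat.mul_le_mul_left _ (Nat.pow_le_pow_left (Nat.succ_le_succ this) 3)

theorem card_layer_le_two_pow (π : VarOrder n) (s : Dat) (c : ℕ) :
    (A.layer π s c).card ≤ 2 ^ n :=
  Finset.card_image_le.trans (by simp)

end Bounds

/-! ### The run of the elimination procedure -/

/-- The minimized OBDD of the conjunction of the clauses in `T` with the variables in `xs`
eliminated. -/
def elimOBDD (π : VarOrder n) (quant : Fin n → Quantifier) (xs : List (Fin n))
    (T : List (Clause n)) : OBDD n :=
  (stateAut (levelsOf quant xs)).toOBDD π (startState (levelsOf quant xs) T)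

theorem elimOBDD_represents (π : VarOrder n) (quant : Fin n → Quantifier) {xs : List (Fin n)}
    (h : xs.Nodup) (T : List (Clause n)) :
    (elimOBDD π quant xs T).Represents π (quantifyList quant xs (cnfFun T)) := by
  rw [← stateAut_value_startState quant h T π]
  exact Automaton.toOBDD_represents _ _ _

theorem nodup_drop_finRange (m : ℕ) : ((List.finRange n).drop m).Nodup :=
  (List.nodup_finRange n).sublist (List.drop_sublist _ _)

/-- The sorted list of the labels. -/
def OBDD.labelSet (B : OBDD n) : Dat :=
  Dat.sort (encList (fun v => encFin (B.label v)) (List.finRange B.numNodes))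

theorem OBDD.mem_labelSet {B : OBDD n} {x : Fin n} : encFin x ∈ B.labelSet.toList ↔ x ∈ B.vars := by
  simp [OBDD.labelSet, Dat.mem_sort, Dat.toList_encList, OBDD.vars, Dat.encFin_injective.eq_iff]

/-- An OBDD together with the clauses that it stems from and its set of variables. -/
structure Item (n : ℕ) where
  clauses : List (Clause n)
  vars : Dat
  obdd : OBDD n

namespace Item

def Contains (it : Item n) (x : Fin n) : Prop := encFin x ∈ it.vars.toList

instance (it : Item n) (x : Fin n) : Decidable (it.Contains x) :=
  inferInstanceAs (Decidable (_ ∈ _))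

def ofClause (π : VarOrder n) (quant : Fin n → Quantifier) (C : Clause n) : Item n :=
  ⟨[C], encList (fun l => encFin l.1) C, elimOBDD π quant [] [C]⟩

end Item

def bucketOf (x : Fin n) (L : List (Item n)) : List (Clause n) :=
  (L.filter fun it => it.Contains x).flatMap Item.clauses

def elimItem (π : VarOrder n) (quant : Fin n → Quantifier) (xs : List (Fin n))
    (T : List (Clause n)) : Item n :=
  ⟨T, (elimOBDD π quant xs T).labelSet, elimOBDD π quant xs T⟩

/-- The items that are left when the variables in `xs` have been eliminated. -/
def pending (Φ : PCNF n) (π : VarOrder n) : List (Fin n) → List (Item n)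
  | [] => Φ.clauses.map (Item.ofClause π Φ.quant)
  | x :: xs => elimItem π Φ.quant (x :: xs) (bucketOf x (pending Φ π xs)) ::
      (pending Φ π xs).filter fun it => ¬ it.Contains x

theorem Item.contains_ofClause {π : VarOrder n} {quant : Fin n → Quantifier} {C : Clause n}
    {x : Fin n} : (Item.ofClause π quant C).Contains x ↔ x ∈ C.vars := by
  simp [Item.Contains, Item.ofClause, Dat.toList_encList, Dat.encFin_injective.eq_iff,
    Clause.mem_vars]

section Run

variable (Φ : PCNF n) (π : VarOrder n)

/-- The items that are left when the variables `x_m, x_{m+1}, …` have been eliminated. -/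
def pendingFrom (m : ℕ) : List (Item n) := pending Φ π ((List.finRange n).drop m)

/-- The clauses that are collected for the elimination of `i`. -/
def bucketAt (i : Fin n) : List (Clause n) := bucketOf i (pendingFrom Φ π (i + 1))

/-- The item that results from the elimination of `i`. -/
def itemAt (i : Fin n) : Item n :=
  elimItem π Φ.quant ((List.finRange n).drop i) (bucketAt Φ π i)

theorem pendingFrom_of_lt {m : ℕ} (hm : m < n) : pendingFrom Φ π m =
    itemAt Φ π ⟨m, hm⟩ ::
      (pendingFrom Φ π (m + 1)).filter fun it => ¬ it.Contains ⟨m, hm⟩ := by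
  rw [pendingFrom, drop_finRange hm, pending, ← drop_finRange hm]; rfl

theorem pendingFrom_of_ge {m : ℕ} (hm : n ≤ m) :
    pendingFrom Φ π m = Φ.clauses.map (Item.ofClause π Φ.quant) := by
  rw [pendingFrom, List.drop_eq_nil_of_le (by simpa using hm)]; rfl

theorem obdd_itemAt_represents (i : Fin n) :
    (itemAt Φ π i).obdd.Represents π (Φ.tail i (bucketAt Φ π i)) :=
  elimOBDD_represents π Φ.quant (nodup_drop_finRange _) _

theorem obdd_ofClause_represents (C : Clause n) :
    (Item.ofClause π Φ.quant C).obdd.Represents π C.eval := by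
  have := elimOBDD_represents π Φ.quant List.nodup_nil [C]
  have e : quantifyList Φ.quant [] (cnfFun [C]) = C.eval := by
    funext a; simp [quantifyList, cnfFun]
  rwa [e] at this

theorem Clause.eval_update {C : Clause n} {x : Fin n} (hx : x ∉ C.vars) (a : Assignment n)
    (c : Bool) : C.eval (Function.update a x c) = C.eval a := by
  rw [Bool.eq_iff_iff]
  simp only [Clause.eval, List.any_eq_true]
  refine exists_congr fun l => and_congr_right fun hl => ?_
  rw [Function.update_of_ne fun h => hx (Clause.mem_vars.2 ⟨l, hl, h⟩)]

/-- Labels of this OBDD are essential variables, and the quantified variables are not essential. -/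
theorem lt_of_mem_vars_elimOBDD {m : ℕ} {T : List (Clause n)} {x : Fin n}
    (hx : x ∈ (elimOBDD π Φ.quant ((List.finRange n).drop m) T).vars) : (x : ℕ) < m := by
  by_contra hlt
  obtain ⟨a, ha⟩ := Automaton.essential_of_mem_vars_toOBDD _ hx
  rw [stateAut_value_startState _ (nodup_drop_finRange _)] at ha
  refine ha (Φ.tail_congr (m := m) fun z hz => ?_)
  have : z ≠ x := by rintro rfl; exact hlt hz
  rw [Function.update_of_ne this, Function.update_of_ne this]

/-- The recursion of the pending list is replaced by a description in the style of
`QBDDTrace.bucket`: everything created so far that contains only variables left of `x_m`. -/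
theorem mem_pendingFrom {m : ℕ} {it : Item n} : it ∈ pendingFrom Φ π m ↔
    ((∃ C ∈ Φ.clauses, it = Item.ofClause π Φ.quant C) ∨ ∃ j : Fin n, m ≤ j ∧ it = itemAt Φ π j) ∧
      ∀ x : Fin n, it.Contains x → (x : ℕ) < m := by
  have key : ∀ d m, n - m = d → (it ∈ pendingFrom Φ π m ↔
    ((∃ C ∈ Φ.clauses, it = Item.ofClause π Φ.quant C) ∨ ∃ j : Fin n, m ≤ j ∧ it = itemAt Φ π j) ∧
      ∀ x : Fin n, it.Contains x → (x : ℕ) < m) := by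
    intro d
    induction d with
    | zero =>
      intro m hm
      rw [pendingFrom_of_ge Φ π (by omega), List.mem_map]
      constructor
      · rintro ⟨C, hC, rfl⟩
        exact ⟨Or.inl ⟨C, hC, rfl⟩, fun x _ => by omega⟩
      · rintro ⟨⟨C, hC, rfl⟩ | ⟨j, hj, rfl⟩, -⟩
        · exact ⟨C, hC, rfl⟩
        · omega
    | succ d ih =>
      intro m hm
      have hmn : m < n := by omega
      rw [pendingFrom_of_lt Φ π hmn, List.mem_cons, List.mem_filter, ih (m + 1) (by omega)]
      simp only [decide_eq_true_eq]
      constructor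
      · rintro (rfl | ⟨⟨h₁, h₂⟩, h₃⟩)
        · exact ⟨Or.inr ⟨⟨m, hmn⟩, le_rfl, rfl⟩, fun x hx =>
            lt_of_mem_vars_elimOBDD Φ π (OBDD.mem_labelSet.1 hx)⟩
        · refine ⟨?_, fun x hx => ?_⟩
          · rcases h₁ with h₁ | ⟨j, hj, rfl⟩
            · exact Or.inl h₁
            · exact Or.inr ⟨j, by omega, rfl⟩
          · have := h₂ x hx
            have : (x : ℕ) ≠ m := by
              intro h
              have : x = ⟨m, hmn⟩ := Fin.ext h
              exact h₃ (this ▸ hx)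
            omega
      · rintro ⟨h₁, h₂⟩
        have h₃ : ¬ it.Contains ⟨m, hmn⟩ := fun h => lt_irrefl _ (h₂ _ h)
        have h₄ : ∀ x : Fin n, it.Contains x → (x : ℕ) < m + 1 := fun x hx => by
          have := h₂ x hx; omega
        rcases h₁ with h₁ | ⟨j, hj, rfl⟩
        · exact Or.inr ⟨⟨Or.inl h₁, h₄⟩, h₃⟩
        · by_cases hjm : (j : ℕ) = m
          · left
            congr 1
            exact Fin.ext hjm
          · exact Or.inr ⟨⟨Or.inr ⟨j, by omega, rfl⟩, h₄⟩, h₃⟩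
  exact key _ m rfl

theorem eval_update_of_mem_pendingFrom {m : ℕ} {it : Item n} (h : it ∈ pendingFrom Φ π m)
    {x : Fin n} (hx : ¬ it.Contains x) (a : Assignment n) (c : Bool) :
    it.obdd.eval (Function.update a x c) = it.obdd.eval a := by
  rcases ((mem_pendingFrom Φ π).1 h).1 with ⟨C, -, rfl⟩ | ⟨j, -, rfl⟩
  · have hr := (obdd_ofClause_represents Φ π C).1.2
    rw [hr, hr]
    exact Clause.eval_update (fun h' => hx (Item.contains_ofClause.2 h')) a c
  · exact OBDD.eval_update (fun h' => hx (OBDD.mem_labelSet.2 h')) a c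

theorem quantifyFun_of_indep {Q : Quantifier} {x : Fin n} {f : Assignment n → Bool}
    (h : ∀ a c, f (Function.update a x c) = f a) : quantifyFun Q x f = f := by
  cases Q <;> funext a <;> simp [quantifyFun, restrictFun, h]

theorem quantifyFun_and {Q : Quantifier} {x : Fin n} {f g : Assignment n → Bool}
    (h : ∀ a c, g (Function.update a x c) = g a) :
    quantifyFun Q x (fun a => f a && g a) = fun a => quantifyFun Q x f a && g a := by
  cases Q <;> funext a <;> simp [quantifyFun, restrictFun, h] <;>
  cases f (Function.update a x false) <;> cases f (Function.update a x true) <;> cases g a <;> rfl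

theorem conjFun_append (L L' : List (OBDD n)) :
    conjFun (L ++ L') = fun a => conjFun L a && conjFun L' a := by
  funext a; simp [conjFun]

theorem conjFun_congr {L L' : List (OBDD n)} (h : ∀ B, B ∈ L ↔ B ∈ L') :
    conjFun L = conjFun L' := by
  funext a; rw [Bool.eq_iff_iff]; simp [conjFun, h]

/-- The correctness of bucket elimination, by induction from the inside out. Arbitrary parts `S` of
the pending list are needed, because a bucket is such a part. -/
theorem tail_flatMap {m : ℕ} {S : List (Item n)} (hS : S.Subperm (pendingFrom Φ π m)) :
    Φ.tail m (S.flatMap Item.clauses) = conjFun (S.map Item.obdd) := by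
  have key : ∀ d m, n - m = d → ∀ S : List (Item n), S.Subperm (pendingFrom Φ π m) →
      Φ.tail m (S.flatMap Item.clauses) = conjFun (S.map Item.obdd) := by
    intro d
    induction d with
    | zero =>
      intro m hm S hS
      have hS' := hS.subset
      rw [pendingFrom_of_ge Φ π (by omega)] at hS'
      rw [Φ.tail_of_ge (by omega)]
      funext a
      rw [Bool.eq_iff_iff]
      simp only [cnfFun, conjFun, List.all_eq_true, List.mem_flatMap, List.mem_map,
        forall_exists_index, and_imp, forall_apply_eq_imp_iff₂]
      rw [forall_comm]
      refine forall_congr' fun it => ?_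
      constructor
      · intro h hit
        obtain ⟨C, hC, rfl⟩ := List.mem_map.1 (hS' hit)
        rw [(obdd_ofClause_represents Φ π C).1.2]
        exact h C hit (by simp [Item.ofClause])
      · intro h C hit hC
        obtain ⟨C', hC', rfl⟩ := List.mem_map.1 (hS' hit)
        have : C = C' := by simpa [Item.ofClause] using hC
        rw [this, ← (obdd_ofClause_represents Φ π C').1.2]
        exact h hit
    | succ d ih =>
      intro m hm S hS
      have hmn : m < n := by omega
      set x : Fin n := ⟨m, hmn⟩ with hx
      have hind : ∀ S' : List (Item n), S'.Sublist
          ((pendingFrom Φ π (m + 1)).filter fun it => ¬ it.Contains x) →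
          ∀ a c, conjFun (S'.map Item.obdd) (Function.update a x c) =
            conjFun (S'.map Item.obdd) a := by
        intro S' hS' a c
        rw [Bool.eq_iff_iff]
        simp only [conjFun, List.all_eq_true, List.mem_map, forall_exists_index, and_imp,
          forall_apply_eq_imp_iff₂]
        refine forall₂_congr fun it hit => ?_
        obtain ⟨h₁, h₂⟩ := List.mem_filter.1 (hS'.subset hit)
        rw [eval_update_of_mem_pendingFrom Φ π h₁ (by simpa using h₂)]
      obtain ⟨S₀, hp, hsub⟩ := hS
      have hperm : (S₀.flatMap Item.clauses).Perm (S.flatMap Item.clauses) := hp.flatMap_right _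
      rw [← Φ.tail_perm hperm, conjFun_congr (L := S.map Item.obdd) (L' := S₀.map Item.obdd)
        fun B => ((hp.map Item.obdd).mem_iff).symm]
      rw [pendingFrom_of_lt Φ π hmn] at hsub
      rw [Φ.tail_of_lt hmn]
      cases hsub with
      -- The newly created item is not used: nothing in `S₀` depends on `x`, and quantifying `x` has
      -- no effect.
      | cons _ hsub =>
        rw [ih (m + 1) (by omega) S₀ ((hsub.trans List.filter_sublist).subperm)]
        exact quantifyFun_of_indep (hind S₀ hsub)
      -- The newly created item is used: one stage earlier it is replaced by the items of the bucket
      -- of `x`, and `Q x` is moved past the remaining items, in which `x` does not occur.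
      | @cons_cons S' _ _ hsub =>
        have h₁ : ((pendingFrom Φ π (m + 1)).filter (fun it => it.Contains x) ++ S').Subperm
            (pendingFrom Φ π (m + 1)) := by
          refine (((List.Sublist.refl _).append hsub).subperm).trans (List.Perm.subperm ?_)
          have := List.filter_append_perm (fun it : Item n => decide (it.Contains x))
            (pendingFrom Φ π (m + 1))
          simpa using this
        have h₂ := ih (m + 1) (by omega) _ h₁
        have h₃ := ih (m + 1) (by omega) _
          (List.filter_sublist (p := fun it : Item n => decide (it.Contains x))
            (l := pendingFrom Φ π (m + 1))).subperm
        have e₁ : (itemAt Φ π x :: S').flatMap Item.clauses =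
            ((pendingFrom Φ π (m + 1)).filter (fun it => it.Contains x) ++ S').flatMap
              Item.clauses := by
          rw [List.flatMap_append, List.flatMap_cons]; rfl
        rw [e₁, h₂, List.map_append, conjFun_append, ← h₃, quantifyFun_and (hind S' hsub)]
        have h₄ : quantifyFun (Φ.quant x) x (Φ.tail (m + 1)
            (((pendingFrom Φ π (m + 1)).filter fun it => it.Contains x).flatMap Item.clauses)) =
            (itemAt Φ π x).obdd.eval := by
          rw [← Φ.tail_of_lt hmn]
          exact funext fun a => ((obdd_itemAt_represents Φ π x).1.2 a).symm
        rw [h₄]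
        rfl
  exact key _ m rfl S hS

/-- Eliminating a variable merges the clauses of its bucket into one item, so no clause is lost or
duplicated. Hence the items left at the end stand for the whole matrix, and every bucket holds a
part of it. -/
theorem flatMap_pendingFrom (m : ℕ) :
    ((pendingFrom Φ π m).flatMap Item.clauses).Perm Φ.clauses := by
  have key : ∀ d m, n - m = d → ((pendingFrom Φ π m).flatMap Item.clauses).Perm Φ.clauses := by
    intro d
    induction d with
    | zero =>
      intro m hm
      rw [pendingFrom_of_ge Φ π (by omega), List.flatMap_map]
      simp [Item.ofClause]
    | succ d ih =>
      intro m hm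
      have hmn : m < n := by omega
      refine List.Perm.trans ?_ (ih (m + 1) (by omega))
      rw [pendingFrom_of_lt Φ π hmn, List.flatMap_cons]
      have h₁ : (itemAt Φ π ⟨m, hmn⟩).clauses = ((pendingFrom Φ π (m + 1)).filter
        fun it => it.Contains ⟨m, hmn⟩).flatMap Item.clauses := rfl
      rw [h₁, ← List.flatMap_append]
      have := List.filter_append_perm (fun it : Item n => decide (it.Contains ⟨m, hmn⟩))
            (pendingFrom Φ π (m + 1))
      refine List.Perm.flatMap_right _ ?_
      simpa using this
  exact key _ m rfl

theorem bucketAt_subperm (i : Fin n) : (bucketAt Φ π i).Subperm Φ.clauses := by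
  refine List.Subperm.trans ?_ (flatMap_pendingFrom Φ π (i + 1)).subperm
  exact (List.Sublist.flatMap List.filter_sublist _).subperm

/-- The run of QBDD. -/
def qbddTrace : QBDDTrace n where
  clause := Φ.clauses.map fun C => (Item.ofClause π Φ.quant C).obdd
  conj i := elimOBDD π Φ.quant ((List.finRange n).drop (i + 1)) (bucketAt Φ π i)
  elim i := (itemAt Φ π i).obdd
  result := elimOBDD π Φ.quant (List.finRange n) ((pendingFrom Φ π 0).flatMap Item.clauses)

theorem zip_map_self {α β : Type*} (l : List α) (f : α → β) :
    l.zip (l.map f) = l.map fun x => (x, f x) := by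
  induction l with
  | nil => rfl
  | cons x l ih => simp [ih]

/-- Both kinds of buckets are covered: `m = x + 1` belongs to the bucket of `x`, and `m = 0` to the
bucket of constants. Being in a bucket means that no variable from `m` on occurs and, in the first
case, that `x` occurs. -/
theorem mem_bucket (i : WithBot (Fin n)) (m : ℕ) (hm : ∀ j : Fin n, i < j ↔ m ≤ j) (B : OBDD n) :
    B ∈ (qbddTrace Φ π).bucket Φ i ↔ ∃ it ∈ pendingFrom Φ π m,
      (∀ x : Fin n, i = x → it.Contains x) ∧ it.obdd = B := by
  have hmax : ∀ s : Finset (Fin n), s.max = i ↔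
      (∀ x ∈ s, (x : ℕ) < m) ∧ ∀ x : Fin n, i = x → x ∈ s := by
    intro s
    have hle : (∀ x ∈ s, (x : ℕ) < m) ↔ s.max ≤ i := by
      rw [Finset.max_le_iff]
      refine forall₂_congr fun x _ => ?_
      rw [← not_lt, hm, not_le]
    rw [hle]
    constructor
    · rintro rfl
      exact ⟨le_rfl, fun x hx => Finset.mem_of_max hx⟩
    · rintro ⟨h₁, h₂⟩
      refine le_antisymm h₁ ?_
      cases i with
      | bot => exact bot_le
      | coe x => exact Finset.le_max (h₂ x rfl)
  have hinit : B ∈ (qbddTrace Φ π).initialBucket Φ i ↔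
      ∃ C ∈ Φ.clauses, C.vars.max = i ∧ (Item.ofClause π Φ.quant C).obdd = B := by
    simp only [QBDDTrace.initialBucket, qbddTrace, zip_map_self, List.mem_map, List.mem_filter,
      decide_eq_true_eq]
    constructor
    · rintro ⟨p, ⟨⟨C, hC, rfl⟩, h⟩, rfl⟩
      exact ⟨C, hC, h, rfl⟩
    · rintro ⟨C, hC, h, rfl⟩
      exact ⟨_, ⟨⟨C, hC, rfl⟩, h⟩, rfl⟩
  have hder : B ∈ (qbddTrace Φ π).derivedBucket i ↔
      ∃ j : Fin n, (i < j ∧ (itemAt Φ π j).obdd.vars.max = i) ∧ (itemAt Φ π j).obdd = B := by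
    simp only [QBDDTrace.derivedBucket, List.mem_map, List.mem_filter, List.mem_finRange, true_and]
    exact exists_congr fun j => and_congr_left fun _ => decide_eq_true_iff
  rw [QBDDTrace.bucket, List.mem_append, hinit, hder]
  constructor
  · rintro (⟨C, hC, h₂, rfl⟩ | ⟨j, ⟨h₁, h₂⟩, rfl⟩)
    · obtain ⟨h₆, h₇⟩ := (hmax _).1 h₂
      exact ⟨_, (mem_pendingFrom Φ π).2 ⟨Or.inl ⟨C, hC, rfl⟩,
        fun x hx => h₆ x (Item.contains_ofClause.1 hx)⟩,
        fun x hx => Item.contains_ofClause.2 (h₇ x hx), rfl⟩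
    · obtain ⟨h₆, h₇⟩ := (hmax _).1 h₂
      exact ⟨_, (mem_pendingFrom Φ π).2 ⟨Or.inr ⟨j, (hm j).1 h₁, rfl⟩,
        fun x hx => h₆ x (OBDD.mem_labelSet.1 hx)⟩,
        fun x hx => OBDD.mem_labelSet.2 (h₇ x hx), rfl⟩
  · rintro ⟨it, h₁, h₂, rfl⟩
    obtain ⟨⟨C, hC, rfl⟩ | ⟨j, hj, rfl⟩, h₃⟩ := (mem_pendingFrom Φ π).1 h₁
    · exact Or.inl ⟨C, hC, (hmax _).2 ⟨fun x hx => h₃ x (Item.contains_ofClause.2 hx),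
        fun x hx => Item.contains_ofClause.1 (h₂ x hx)⟩, rfl⟩
    · exact Or.inr ⟨j, ⟨(hm j).2 hj, (hmax _).2 ⟨fun x hx => h₃ x (OBDD.mem_labelSet.2 hx),
        fun x hx => OBDD.mem_labelSet.1 (h₂ x hx)⟩⟩, rfl⟩

theorem conjFun_bucket_bot : conjFun ((qbddTrace Φ π).bucket Φ ⊥) = Φ.tail 0 Φ.clauses := by
  rw [← Φ.tail_perm (flatMap_pendingFrom Φ π 0), tail_flatMap Φ π (List.Subperm.refl _)]
  refine conjFun_congr fun B => ?_
  rw [mem_bucket Φ π ⊥ 0 (fun j => by simp [WithBot.bot_lt_coe])]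
  simp

theorem conjFun_bucket (i : Fin n) :
    conjFun ((qbddTrace Φ π).bucket Φ i) = Φ.tail (i + 1) (bucketAt Φ π i) := by
  rw [bucketAt, bucketOf, tail_flatMap Φ π List.filter_sublist.subperm]
  refine conjFun_congr fun B => ?_
  rw [mem_bucket Φ π i (i + 1) (fun j => by rw [WithBot.coe_lt_coe, Fin.lt_def]; rfl)]
  simp [and_assoc]

theorem result_qbddTrace : (qbddTrace Φ π).result.Represents π (Φ.tail 0 Φ.clauses) := by
  rw [← Φ.tail_perm (flatMap_pendingFrom Φ π 0)]
  exact elimOBDD_represents π Φ.quant (List.nodup_finRange n) _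

theorem isRun_qbddTrace : (qbddTrace Φ π).IsRun Φ π := by
  refine ⟨?_, fun i => ?_, fun i => ?_, ?_⟩
  · simp only [qbddTrace, List.forall₂_map_right_iff, List.forall₂_same]
    exact fun C _ => obdd_ofClause_represents Φ π C
  · rw [conjFun_bucket]
    exact elimOBDD_represents π Φ.quant (nodup_drop_finRange _) _
  · have h := obdd_itemAt_represents Φ π i
    rw [Φ.tail_of_lt i.isLt] at h
    have e : Φ.tail (i + 1) (bucketAt Φ π i) = ((qbddTrace Φ π).conj i).eval :=
      funext fun a => ((elimOBDD_represents π Φ.quant (nodup_drop_finRange _) _).1.2 a).symm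
    rwa [e] at h
  · rw [conjFun_bucket_bot]
    exact result_qbddTrace Φ π

end Run

/-! ### Refutations -/

/-- The automaton in which the value of `x` is replaced by `c`. -/
def restrictAut (ls : Levels n) (x : Fin n) (c : Bool) : Automaton n Dat where
  step y b s := Dat.step (stateParam ls y (if y = x then c else b)) s
  accept s := decide (s ≠ Dat.nil)

theorem restrictAut_value (ls : Levels n) (x : Fin n) (c : Bool) (l : List (Fin n)) (s : Dat) :
    (restrictAut ls x c).value l s = restrictFun ((stateAut ls).value l s) x c := by
  funext a
  simp only [Automaton.value, restrictFun]
  have : (restrictAut ls x c).run l a s = (stateAut ls).run l (Function.update a x c) s := by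
    induction l generalizing s with
    | nil => rfl
    | cons y l ih =>
      have e : (if y = x then c else a y) = Function.update a x c y := by
        rw [Function.update_apply]
      simp only [Automaton.run, List.foldl_cons] at ih ⊢
      rw [ih]
      simp only [restrictAut, stateAut, e]
  rw [this]; rfl

section Refutation

variable {Φ : PCNF n} {π : VarOrder n} {k q : ℕ}

theorem size_elimOBDD_le (hπ : SmallSeparators Φ π k) (hq : Φ.numBlocks ≤ q)
    {T : List (Clause n)} (hT : T ⊆ Φ.clauses) (m : ℕ) :
    (elimOBDD π Φ.quant ((List.finRange n).drop m) T).size ≤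
      (n + 1) * (2 * tower k (q + 1)) + 2 :=
  Automaton.size_toOBDD_le _ π _ _ (card_layer_le hπ hq hT fun _ b _ => ⟨b, rfl⟩)

/-- A derivation with at most `N` lines of size at most `Z`. -/
structure BoundedDerivation (Φ : PCNF n) (π : VarOrder n) (N Z : ℕ) (L : List (OBDD n)) : Prop where
  derivation : OBDDDerivation Φ π L
  size_le : ∀ B ∈ L, B.size ≤ Z
  length_le : L.length ≤ N

theorem BoundedDerivation.step {N Z : ℕ} {L : List (OBDD n)} (h : BoundedDerivation Φ π N Z L)
    {B : OBDD n} (hB : OBDDRule Φ π L B) (hsize : B.size ≤ Z) :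
    BoundedDerivation Φ π (N + 1) Z (L ++ [B]) := by
  refine ⟨OBDDDerivation.step L B h.derivation hB, fun B' hB' => ?_, ?_⟩
  · rcases List.mem_append.1 hB' with h' | h'
    · exact h.size_le B' h'
    · rw [List.mem_singleton.1 h']; exact hsize
  · simpa using h.length_le

theorem BoundedDerivation.mono {N N' Z : ℕ} {L : List (OBDD n)} (h : BoundedDerivation Φ π N Z L)
    (hN : N ≤ N') : BoundedDerivation Φ π N' Z L :=
  ⟨h.derivation, h.size_le, h.length_le.trans hN⟩

/-- One clause is conjoined at a time. Every intermediate line is the OBDD of a set of clauses of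
the matrix, so the width bound applies to all of them. -/
theorem exists_derivation_conj (hπ : SmallSeparators Φ π k) (hq : Φ.numBlocks ≤ q)
    (C₀ : Clause n) (l : List (Clause n)) (hl : C₀ :: l ⊆ Φ.clauses) :
    ∃ L, BoundedDerivation Φ π (Φ.clauses.length + l.length)
        ((n + 1) * (2 * tower k (q + 1)) + 2) L ∧
      (∀ C ∈ Φ.clauses, elimOBDD π Φ.quant [] [C] ∈ L) ∧
      elimOBDD π Φ.quant [] (C₀ :: l) ∈ L := by
  have hsz : ∀ T ⊆ Φ.clauses, (elimOBDD π Φ.quant [] T).size ≤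
      (n + 1) * (2 * tower k (q + 1)) + 2 := fun T hT => by
    have := size_elimOBDD_le hπ hq hT n
    rwa [List.drop_eq_nil_of_le (by simp)] at this
  have hval : ∀ T, (elimOBDD π Φ.quant [] T).Represents π (cnfFun T) := fun T =>
    elimOBDD_represents π Φ.quant List.nodup_nil T
  induction l using List.reverseRecOn with
  | nil =>
    refine ⟨Φ.clauses.map fun C => elimOBDD π Φ.quant [] [C], ⟨OBDDDerivation.start _ ?_, ?_, ?_⟩,
      fun C hC => List.mem_map.2 ⟨C, hC, rfl⟩, List.mem_map.2 ⟨C₀, hl (by simp), rfl⟩⟩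
    · simp only [List.forall₂_map_right_iff, List.forall₂_same]
      exact fun C _ => obdd_ofClause_represents Φ π C
    · intro B hB
      obtain ⟨C, hC, rfl⟩ := List.mem_map.1 hB
      exact hsz _ (by simpa using hC)
    · simp
  | append_singleton l C ih =>
    have hC : C ∈ Φ.clauses := hl (by simp)
    obtain ⟨L, h₁, h₂, h₃⟩ := ih fun D hD => hl (by
      rcases List.mem_cons.1 hD with h | h
      · simp [h]
      · simp [h])
    refine ⟨_, (h₁.step (OBDDRule.conjunction (elimOBDD π Φ.quant [] (C₀ :: (l ++ [C]))) _ _ h₃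
      (h₂ C hC) ?_) (hsz _ hl)).mono (by simp [Nat.add_assoc]), fun D hD => by simp [h₂ D hD], by simp⟩
    convert hval (C₀ :: (l ++ [C])) using 1
    funext a
    rw [Bool.eq_iff_iff]
    simp [conjFun, (hval _).1.2, cnfFun, and_assoc]

/-- Eliminating a variable takes at most three new lines: one projection, or two reductions and
their conjunction. The labels of the current line lie left of `x_m`, so that the next variable to be
eliminated, if it occurs, is rightmost, as universal reduction demands. -/
theorem exists_derivation_tail (hπ : SmallSeparators Φ π k) (hq : Φ.numBlocks ≤ q)
    (hne : Φ.clauses ≠ []) (m : ℕ) :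
    ∃ L, BoundedDerivation Φ π (2 * Φ.clauses.length + 3 * (n - m))
        ((n + 1) * (2 * tower k (q + 1)) + 2) L ∧
      ∃ B ∈ L, B.Represents π (Φ.tail m Φ.clauses) ∧ ∀ x ∈ B.vars, (x : ℕ) < m := by
  have key : ∀ d m, n - m = d → ∃ L, BoundedDerivation Φ π (2 * Φ.clauses.length + 3 * d)
        ((n + 1) * (2 * tower k (q + 1)) + 2) L ∧
      ∃ B ∈ L, B.Represents π (Φ.tail m Φ.clauses) ∧ ∀ x ∈ B.vars, (x : ℕ) < m := by
    intro d
    induction d with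
    | zero =>
      intro m hm
      obtain ⟨C₀, l, hl⟩ := List.exists_cons_of_ne_nil hne
      obtain ⟨L, h₁, -, h₂⟩ := exists_derivation_conj hπ hq C₀ l (by simp [hl])
      refine ⟨L, h₁.mono (by simp [hl]; omega), _, h₂, ?_, fun x _ => by omega⟩
      rw [Φ.tail_of_ge (by omega), hl]
      exact elimOBDD_represents π Φ.quant List.nodup_nil _
    | succ d ih =>
      intro m hm
      have hmn : m < n := by omega
      obtain ⟨L, h₁, B, hB, hrep, hvars⟩ := ih (m + 1) (by omega)
      have heval : B.eval = Φ.tail (m + 1) Φ.clauses := funext hrep.1.2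
      set x : Fin n := ⟨m, hmn⟩ with hx
      set B' := elimOBDD π Φ.quant ((List.finRange n).drop m) Φ.clauses with hB'
      have hrep' : B'.Represents π (Φ.tail m Φ.clauses) :=
        elimOBDD_represents π Φ.quant (nodup_drop_finRange _) _
      have hvars' : ∀ z ∈ B'.vars, (z : ℕ) < m := fun z hz => lt_of_mem_vars_elimOBDD Φ π hz
      have hsize' := size_elimOBDD_le hπ hq (List.Subset.refl Φ.clauses) m
      have htail := Φ.tail_of_lt hmn Φ.clauses
      by_cases hxB : x ∈ B.vars
      · cases hQ : Φ.quant x with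
        | ex =>
          refine ⟨_, (h₁.step (OBDDRule.projection B' B x hB hxB ?_) hsize').mono (by omega), B',
            by simp, hrep', hvars'⟩
          rw [heval, ← hQ, hx, ← htail]
          exact hrep'
        | all =>
          have hmax : B.vars.max = (x : WithBot (Fin n)) := by
            refine le_antisymm (Finset.max_le fun z hz => WithBot.coe_le_coe.2 ?_)
              (Finset.le_max hxB)
            have := hvars z hz
            rw [Fin.le_def]
            exact Nat.lt_succ_iff.1 this
          -- The restricted function is computed by the automaton that reads `c` in place of the
          -- value of `x`. Its states lie in the same sets, so the width bound carries over.
          set D : Bool → OBDD n := fun c =>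
            (restrictAut (Φ.levels (m + 1)) x c).toOBDD π (startState (Φ.levels (m + 1)) Φ.clauses)
            with hD
          have hDrep : ∀ c, (D c).Represents π (restrictFun B.eval x c) := fun c => by
            have := Automaton.toOBDD_represents (restrictAut (Φ.levels (m + 1)) x c) π
              (startState (Φ.levels (m + 1)) Φ.clauses)
            rw [restrictAut_value, PCNF.levels,
              stateAut_value_startState _ (nodup_drop_finRange _)] at this
            rw [heval]
            exact this
          have hDsize : ∀ c, (D c).size ≤ (n + 1) * (2 * tower k (q + 1)) + 2 := fun c =>
            Automaton.size_toOBDD_le _ π _ _ (card_layer_le hπ hq (List.Subset.refl _)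
              fun y b _ => ⟨if y = x then c else b, rfl⟩)
          have h₂ := h₁.step (OBDDRule.universalReduction (D false) B x false hB hQ hmax
            (hDrep false)) (hDsize false)
          have h₃ := h₂.step (OBDDRule.universalReduction (D true) B x true (by simp [hB]) hQ hmax
            (hDrep true)) (hDsize true)
          refine ⟨_, (h₃.step (OBDDRule.conjunction B' (D false) (D true) (by simp) (by simp) ?_)
            hsize').mono (by omega), B', by simp, hrep', hvars'⟩
          convert hrep' using 1
          rw [htail, ← hx, hQ]
          funext a
          simp [conjFun, (hDrep _).1.2, quantifyFun, heval]
      -- If `x` does not occur in `B`, no rule applies to it and none is needed: quantifying `x`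
      -- leaves the function unchanged.
      · refine ⟨L, h₁.mono (by omega), B, hB, ?_, fun z hz => ?_⟩
        · have := quantifyFun_of_indep (Q := Φ.quant x) (x := x) (f := B.eval)
            fun a c => OBDD.eval_update hxB a c
          rw [htail, ← heval, ← hx, this, heval]
          exact hrep
        · have h₂ := hvars z hz
          have : (z : ℕ) ≠ m := fun h => hxB ((Fin.ext h : z = x) ▸ hz)
          omega
  exact key _ m rfl

theorem length_le_size (Φ : PCNF n) : Φ.clauses.length ≤ Φ.size ∧ n ≤ Φ.size := by
  refine ⟨?_, Nat.le_add_right _ _⟩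
  have : ∀ l : List (Clause n), l.length ≤ (l.map fun C => C.length + 1).sum := by
    intro l
    induction l with
    | nil => simp
    | cons C l ih => simp only [List.length_cons, List.map_cons, List.sum_cons]; omega
  exact (this _).trans (Nat.le_add_left _ _)

theorem exists_refutation (hfalse : Φ.IsFalse) (hk : Φ.pathwidth = k) (hq : Φ.numBlocks = q) :
    ∃ (π : VarOrder n) (L : List (OBDD n)), OBDDRefutation Φ π L ∧
      derivationSize L ≤ tower k (q + 1) * ((5 * Φ.size + 1) * (2 * Φ.size + 4)) := by
  obtain ⟨π, hπ⟩ := exists_order Φ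
  rw [hk] at hπ
  -- Without clauses there are no variables, and the empty matrix is true.
  have hne : Φ.clauses ≠ [] := by
    intro h
    have h₁ := congrFun (Φ.tail_zero_eq_false hfalse) fun _ => false
    have hn : n = 0 := by
      rcases Nat.eq_zero_or_pos n with h₀ | h₀
      · exact h₀
      · obtain ⟨C, hC, -⟩ := Φ.occurs ⟨0, h₀⟩
        simp [h] at hC
    rw [Φ.tail_of_ge (by omega), h] at h₁
    simp [cnfFun] at h₁
  obtain ⟨L, hL, B, hB, hrep, -⟩ := exists_derivation_tail hπ hq.le hne 0
  rw [Φ.tail_zero_eq_false hfalse] at hrep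
  -- The line that represents `0` need not be the last one; it is derived once more as its
  -- conjunction with itself.
  have hd := hL.step (OBDDRule.conjunction B B B hB hB (by
    convert hrep using 1
    funext a
    simp [conjFun, hrep.1.2])) (hL.size_le B hB)
  refine ⟨π, _, ⟨hd.derivation, B, by simp, hrep⟩, ?_⟩
  have hsum : derivationSize (L ++ [B]) ≤
      (L ++ [B]).length * ((n + 1) * (2 * tower k (q + 1)) + 2) := by
    have := List.sum_le_card_nsmul ((L ++ [B]).map OBDD.size)
      ((n + 1) * (2 * tower k (q + 1)) + 2) (by
        intro z hz
        obtain ⟨B', hB', rfl⟩ := List.mem_map.1 hz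
        exact hd.size_le B' hB')
    simpa [derivationSize] using this
  obtain ⟨h₁, h₂⟩ := length_le_size Φ
  have hW := tower_succ_pos k q
  calc _ ≤ _ := hsum
    _ ≤ (5 * Φ.size + 1) * (tower k (q + 1) * (2 * Φ.size + 4)) := by
      refine Nat.mul_le_mul (hd.length_le.trans (by omega)) ?_
      nlinarith
    _ = _ := by ring

end Refutation

/-! ### Time bounds that depend on a part of the input -/

/-- `f` is bounded by a polynomial in `m`. -/
def PolyIn {α : Type*} (m f : α → ℕ) : Prop := ∃ c, ∀ a, f a ≤ (m a + 2) ^ c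

namespace PolyIn

variable {α : Type*} {m f g : α → ℕ}

theorem mono (hg : PolyIn m g) (h : ∀ a, f a ≤ g a) : PolyIn m f :=
  let ⟨c, hc⟩ := hg
  ⟨c, fun a => (h a).trans (hc a)⟩

theorem const (b : ℕ) : PolyIn m fun _ => b :=
  ⟨b, fun a => (Nat.lt_pow_self (by omega : 1 < 2)).le.trans (Nat.pow_le_pow_left (by omega) b)⟩

theorem self : PolyIn m m := ⟨1, fun a => by simp⟩

theorem add (hf : PolyIn m f) (hg : PolyIn m g) : PolyIn m fun a => f a + g a := by
  obtain ⟨c, hc⟩ := hf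
  obtain ⟨d, hd⟩ := hg
  refine ⟨max c d + 1, fun a => ?_⟩
  have h1 : f a ≤ (m a + 2) ^ max c d :=
    (hc a).trans (Nat.pow_le_pow_right (by omega) (le_max_left _ _))
  have h2 : g a ≤ (m a + 2) ^ max c d :=
    (hd a).trans (Nat.pow_le_pow_right (by omega) (le_max_right _ _))
  calc f a + g a ≤ (m a + 2) ^ max c d * 2 := by omega
    _ ≤ (m a + 2) ^ max c d * (m a + 2) := Nat.mul_le_mul_left _ (by omega)
    _ = _ := (pow_succ _ _).symm

theorem mul (hf : PolyIn m f) (hg : PolyIn m g) : PolyIn m fun a => f a * g a := by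
  obtain ⟨c, hc⟩ := hf
  obtain ⟨d, hd⟩ := hg
  exact ⟨c + d, fun a => (Nat.mul_le_mul (hc a) (hd a)).trans_eq (pow_add _ _ _).symm⟩

theorem pow (hf : PolyIn m f) (c : ℕ) : PolyIn m fun a => f a ^ c := by
  obtain ⟨b, hb⟩ := hf
  exact ⟨b * c, fun a => (Nat.pow_le_pow_left (hb a) c).trans_eq (pow_mul _ _ _).symm⟩

/-- Linear bounds. -/
theorem linear (b c : ℕ) (h : ∀ a, f a ≤ b * m a + c) : PolyIn m f :=
  (((const b).mul self).add (const c)).mono h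

end PolyIn

/-- `F` is computable in time polynomial in `m`. -/
def TimeIn (m : Dat → ℕ) (F : Dat → Dat) : Prop :=
  ∃ c, Implements fun w v T => v = F w ∧ T = (m w + 2) ^ c

namespace TimeIn

variable {m m' : Dat → ℕ} {F G H : Dat → Dat}

theorem of_bound {t : Dat → ℕ} (ht : PolyIn m t)
    (h : Implements fun w v T => v = F w ∧ T = t w) : TimeIn m F := by
  obtain ⟨c, hc⟩ := ht
  refine ⟨c, h.mono ?_⟩
  rintro w v T ⟨rfl, rfl⟩
  exact ⟨_, hc w, rfl, rfl⟩

theorem of_polyTime (h : PolyTime F) : TimeIn Dat.size F :=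
  let ⟨c, _, hc⟩ := h.bound
  ⟨c, hc⟩

theorem define {t : Dat → ℕ} (ht : PolyIn m t) {N : ℕ} (R : Fin N → Spec)
    (h : ∀ j, Implements (R j)) (body : (Fin N → ℕ) → Expr)
    (H : ∀ (P : Program) (idx : Fin N → ℕ), (∀ j, Meets P (idx j) (R j)) →
      ∀ w, EvalLE P [w] (body idx) (F w) (t w)) : TimeIn m F := by
  refine of_bound (ht.add (PolyIn.const 2)) (Implements.define R h (fun idx _ => body idx) _ ?_)
  rintro P idx self hself hR w v T ⟨rfl, rfl⟩
  exact EvalLE.self hself (H P idx hR w)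

/-- The condition concerns only the measure of the intermediate value, not its size. So large parts,
such as tries and node lists, can be passed on at constant cost. -/
theorem comp (hF : TimeIn m' F) (hG : TimeIn m G) (h : PolyIn m fun w => m' (G w)) :
    TimeIn m fun w => F (G w) := by
  obtain ⟨c, hF⟩ := hF
  obtain ⟨d, hG⟩ := hG
  refine define (t := fun w => 1 + (m w + 2) ^ d + (m' (G w) + 2) ^ c)
    (((PolyIn.const 1).add ((PolyIn.self.add (PolyIn.const 2)).pow d)).add
      ((h.add (PolyIn.const 2)).pow c)) ![_, _] (Fin.forall_fin_two.2 ⟨hF, hG⟩)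
    (fun i => Expr.call (i 0) (Expr.call (i 1) (Expr.var 0))) fun P i h w => ?_
  exact ((EvalLE.var rfl).call (h 1 _ _ _ ⟨rfl, rfl⟩)).call (h 0 _ _ _ ⟨rfl, rfl⟩)

theorem const (d : Dat) : TimeIn m fun _ => d := by
  obtain ⟨c, -, h⟩ := (PolyTime.const d).bound
  refine define (t := fun _ => 1 + (Dat.nil.size + 2) ^ c) (PolyIn.const _) ![_]
    (Fin.forall_fin_one.2 h) (fun i => Expr.call (i 0) Expr.nil) fun P i h w => ?_
  exact EvalLE.nil.call (h 0 _ _ _ ⟨rfl, rfl⟩)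

theorem id : TimeIn m fun w => w :=
  define (t := fun _ => 1) (PolyIn.const 1) Fin.elim0 (fun j => j.elim0) (fun _ => Expr.var 0)
    fun _ _ _ _ => EvalLE.var rfl

theorem cons (hF : TimeIn m F) (hG : TimeIn m G) : TimeIn m fun w => Dat.cons (F w) (G w) := by
  obtain ⟨c, hF⟩ := hF
  obtain ⟨d, hG⟩ := hG
  refine define (t := fun w => (1 + (m w + 2) ^ c) + (1 + (m w + 2) ^ d) + 1)
    ((((PolyIn.const 1).add ((PolyIn.self.add (PolyIn.const 2)).pow c)).add
      ((PolyIn.const 1).add ((PolyIn.self.add (PolyIn.const 2)).pow d))).add (PolyIn.const 1))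
    ![_, _] (Fin.forall_fin_two.2 ⟨hF, hG⟩)
    (fun i => Expr.cons (Expr.call (i 0) (Expr.var 0)) (Expr.call (i 1) (Expr.var 0)))
    fun P i h w => ?_
  exact ((EvalLE.var rfl).call (h 0 _ _ _ ⟨rfl, rfl⟩)).cons
    ((EvalLE.var rfl).call (h 1 _ _ _ ⟨rfl, rfl⟩))

theorem fst (hF : TimeIn m F) : TimeIn m fun w => (F w).fst := by
  obtain ⟨c, hF⟩ := hF
  refine define (t := fun w => (1 + (m w + 2) ^ c) + 1 + 1)
    ((((PolyIn.const 1).add ((PolyIn.self.add (PolyIn.const 2)).pow c)).add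
      (PolyIn.const 1)).add (PolyIn.const 1)) ![_] (Fin.forall_fin_one.2 hF)
    (fun i => Expr.cases (Expr.call (i 0) (Expr.var 0)) Expr.nil (Expr.var 0)) fun P i h w => ?_
  have h0 := (EvalLE.var (P := P) (env := [w]) (i := 0) rfl).call (h 0 w _ _ ⟨rfl, rfl⟩)
  cases hw : F w with
  | nil => rw [hw] at h0; exact h0.casesNil EvalLE.nil
  | cons l r => rw [hw] at h0; exact h0.casesCons (EvalLE.var rfl)

theorem snd (hF : TimeIn m F) : TimeIn m fun w => (F w).snd := by
  obtain ⟨c, hF⟩ := hF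
  refine define (t := fun w => (1 + (m w + 2) ^ c) + 1 + 1)
    ((((PolyIn.const 1).add ((PolyIn.self.add (PolyIn.const 2)).pow c)).add
      (PolyIn.const 1)).add (PolyIn.const 1)) ![_] (Fin.forall_fin_one.2 hF)
    (fun i => Expr.cases (Expr.call (i 0) (Expr.var 0)) Expr.nil (Expr.var 1)) fun P i h w => ?_
  have h0 := (EvalLE.var (P := P) (env := [w]) (i := 0) rfl).call (h 0 w _ _ ⟨rfl, rfl⟩)
  cases hw : F w with
  | nil => rw [hw] at h0; exact h0.casesNil EvalLE.nil
  | cons l r => rw [hw] at h0; exact h0.casesCons (EvalLE.var rfl)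

theorem ite (hF : TimeIn m F) (hG : TimeIn m G) (hH : TimeIn m H) :
    TimeIn m fun w => Dat.ite (F w) (G w) (H w) := by
  obtain ⟨c, hF⟩ := hF
  obtain ⟨d, hG⟩ := hG
  obtain ⟨e, hH⟩ := hH
  have hp : ∀ c, PolyIn m fun w => (m w + 2) ^ c :=
    fun c => (PolyIn.self.add (PolyIn.const 2)).pow c
  refine define (t := fun w => (1 + (m w + 2) ^ c) + ((1 + (m w + 2) ^ d) + (1 + (m w + 2) ^ e)) + 1)
    ((((PolyIn.const 1).add (hp c)).add (((PolyIn.const 1).add (hp d)).add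
      ((PolyIn.const 1).add (hp e)))).add (PolyIn.const 1))
    ![_, _, _] (Fin.forall_fin_succ.2 ⟨hF, Fin.forall_fin_two.2 ⟨hG, hH⟩⟩)
    (fun i => Expr.cases (Expr.call (i 0) (Expr.var 0)) (Expr.call (i 2) (Expr.var 0))
      (Expr.call (i 1) (Expr.var 2))) fun P i h w => ?_
  have h0 := (EvalLE.var (P := P) (env := [w]) (i := 0) rfl).call (h 0 w _ _ ⟨rfl, rfl⟩)
  cases hw : F w with
  | nil =>
    rw [hw] at h0
    exact (h0.casesNil ((EvalLE.var rfl).call (h 2 _ _ _ ⟨rfl, rfl⟩))).mono (by omega)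
  | cons l r =>
    rw [hw] at h0
    exact (h0.casesCons ((EvalLE.var rfl).call (h 1 _ _ _ ⟨rfl, rfl⟩))).mono (by omega)

/-- A function that runs in polynomial time on a small part of the input. -/
theorem small (hF : PolyTime F) (hG : TimeIn m G) (h : PolyIn m fun w => (G w).size) :
    TimeIn m fun w => F (G w) := (of_polyTime hF).comp hG h

end TimeIn

/-! ### Tries -/

namespace Expr

def fst (e : Expr) : Expr := cases e nil (var 0)
def snd (e : Expr) : Expr := cases e nil (var 1)

end Expr

namespace EvalLE

variable {P : Program} {env : List Dat} {e : Expr} {v : Dat} {T : ℕ}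

theorem fst (h : EvalLE P env e v T) : EvalLE P env e.fst v.fst (T + 1 + 1) := by
  cases v with
  | nil => exact h.casesNil EvalLE.nil
  | cons l r => exact h.casesCons (EvalLE.var rfl)

theorem snd (h : EvalLE P env e v T) : EvalLE P env e.snd v.snd (T + 1 + 1) := by
  cases v with
  | nil => exact h.casesNil EvalLE.nil
  | cons l r => exact h.casesCons (EvalLE.var rfl)

end EvalLE

namespace Dat

/-- The value at a key in a trie. -/
def trieGet : Dat → Dat → Dat
  | nil, t => t.fst
  | cons b k, t => trieGet k (ite b t.snd.snd t.snd.fst)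

/-- A trie consists of a value and a pair of subtries, and `nil` is the empty trie. Since the
components of `nil` are `nil`, missing branches need no separate case. -/
def trieIns (v : Dat) : Dat → Dat → Dat
  | nil, t => cons v t.snd
  | cons b k, t => cons t.fst (ite b (cons t.snd.fst (trieIns v k t.snd.snd))
      (cons (trieIns v k t.snd.fst) t.snd.snd))

theorem trieGet_nil (k : List Bool) : trieGet (encList encBool k) nil = nil := by
  induction k with
  | nil => rfl
  | cons b k ih => cases b <;> exact ih

theorem trieGet_trieIns (v : Dat) (k k' : List Bool) (t : Dat) :
    trieGet (encList encBool k) (trieIns v (encList encBool k') t) =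
      if k = k' then v else trieGet (encList encBool k) t := by
  induction k generalizing k' t with
  | nil =>
    cases k' with
    | nil => rfl
    | cons b k' => simp [encList, trieGet, trieIns]
  | cons b k ih =>
    cases k' with
    | nil => simp [encList, trieGet, trieIns]
    | cons b' k' =>
      simp only [encList, trieGet, trieIns, ite_encBool]
      cases b <;> cases b' <;> simp [ih]

theorem trieGet_ser_nil (k : Dat) : trieGet (ser k) nil = nil := trieGet_nil _

theorem trieGet_ser_trieIns (v k k' t : Dat) :
    trieGet (ser k) (trieIns v (ser k') t) = if k = k' then v else trieGet (ser k) t := by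
  rw [ser, ser, trieGet_trieIns]
  simp only [serBits_injective.eq_iff]

end Dat

/-- The cost is linear in the key, whatever the size of the trie. This is what makes a lookup
independent of the number of states. -/
theorem timeIn_trieGet : TimeIn (fun w => w.fst.size) fun w => Dat.trieGet w.fst w.snd := by
  refine TimeIn.of_bound (t := fun w => 30 * w.fst.size) (PolyIn.linear 30 0 fun _ => le_rfl)
    (Implements.define Fin.elim0 (fun j => j.elim0) (fun _ self =>
      Expr.cases (Expr.var 0).fst (Expr.var 0).snd.fst
        (Expr.call self (Expr.cons (Expr.var 1)
          (Expr.cases (Expr.var 0) (Expr.var 2).snd.snd.fst (Expr.var 4).snd.snd.snd)))) _ ?_)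
  rintro P idx self hself - w v T ⟨rfl, rfl⟩
  have key : ∀ (k : Dat) (w : Dat), w.fst = k →
      EvalLE P [w] (Expr.call self (Expr.var 0)) (Dat.trieGet w.fst w.snd) (30 * w.fst.size) := by
    intro k
    induction k with
    | nil =>
      intro w hw
      rw [hw]
      refine (EvalLE.self hself (EvalLE.casesNil (T₁ := 3) ?_
        (EvalLE.var (v := w) rfl).snd.fst)).mono (by simp)
      rw [← hw]; exact (EvalLE.var rfl).fst
    | cons b k _ ih =>
      intro w hw
      have h := ih (Dat.cons k (Dat.ite b w.snd.snd.snd w.snd.snd.fst)) rfl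
      rw [hw]
      refine (EvalLE.self hself (EvalLE.casesCons (T₁ := 3) (l := b) (r := k) ?_
        (EvalLE.call (EvalLE.cons (EvalLE.var rfl) (EvalLE.mono (T' := 10)
          (v := Dat.ite b w.snd.snd.snd w.snd.snd.fst) (T := 9) ?_ (by omega))) h))).mono ?_
      · rw [← hw]; exact (EvalLE.var rfl).fst
      · cases b with
        | nil => exact EvalLE.casesNil (EvalLE.var rfl) (EvalLE.var (v := w) rfl).snd.snd.fst
        | cons _ _ => exact EvalLE.casesCons (EvalLE.var rfl) (EvalLE.var (v := w) rfl).snd.snd.snd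
      · simp only [Dat.size_cons, Dat.fst_cons]
        have := b.size_pos
        omega
  exact key _ w rfl

theorem timeIn_trieIns :
    TimeIn (fun w => w.snd.fst.size) fun w => Dat.trieIns w.fst w.snd.fst w.snd.snd := by
  refine TimeIn.of_bound (t := fun w => 60 * w.snd.fst.size) (PolyIn.linear 60 0 fun _ => le_rfl)
    (Implements.define Fin.elim0 (fun j => j.elim0) (fun _ self =>
      Expr.cases (Expr.var 0).snd.fst (Expr.cons (Expr.var 0).fst (Expr.var 0).snd.snd.snd)
        (Expr.cons (Expr.var 2).snd.snd.fst (Expr.cases (Expr.var 0)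
          (Expr.cons (Expr.call self (Expr.cons (Expr.var 2).fst
            (Expr.cons (Expr.var 1) (Expr.var 2).snd.snd.snd.fst))) (Expr.var 2).snd.snd.snd.snd)
          (Expr.cons (Expr.var 4).snd.snd.snd.fst (Expr.call self (Expr.cons (Expr.var 4).fst
            (Expr.cons (Expr.var 3) (Expr.var 4).snd.snd.snd.snd))))))) _ ?_)
  rintro P idx self hself - w v T ⟨rfl, rfl⟩
  have key : ∀ (k : Dat) (w : Dat), w.snd.fst = k →
      EvalLE P [w] (Expr.call self (Expr.var 0)) (Dat.trieIns w.fst w.snd.fst w.snd.snd)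
        (60 * w.snd.fst.size) := by
    intro k
    induction k with
    | nil =>
      intro w hw
      rw [hw]
      refine (EvalLE.self hself (EvalLE.casesNil (T₁ := 5) ?_ (EvalLE.cons
        (EvalLE.var (v := w) rfl).fst (EvalLE.var (v := w) rfl).snd.snd.snd))).mono (by simp)
      rw [← hw]; exact (EvalLE.var rfl).snd.fst
    | cons b k _ ih =>
      intro w hw
      rw [hw, Dat.trieIns]
      refine (EvalLE.self hself (EvalLE.casesCons (T₁ := 5) (l := b) (r := k) ?_
        (EvalLE.cons (EvalLE.var (v := w) rfl).snd.snd.fst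
          (T₂ := 30 + 60 * k.size) ?_))).mono ?_
      · rw [← hw]; exact (EvalLE.var rfl).snd.fst
      · cases b with
        | nil =>
          have h := ih (Dat.cons w.fst (Dat.cons k w.snd.snd.snd.fst)) rfl
          exact (EvalLE.casesNil (EvalLE.var rfl) (EvalLE.cons (EvalLE.call (EvalLE.cons
            (EvalLE.var (v := w) rfl).fst (EvalLE.cons (EvalLE.var rfl)
              (EvalLE.var (v := w) rfl).snd.snd.snd.fst)) h)
              (EvalLE.var (v := w) rfl).snd.snd.snd.snd)).mono
            (by simp only [Dat.fst_cons, Dat.snd_cons]; omega)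
        | cons _ _ =>
          have h := ih (Dat.cons w.fst (Dat.cons k w.snd.snd.snd.snd)) rfl
          exact (EvalLE.casesCons (EvalLE.var rfl) (EvalLE.cons
            (EvalLE.var (v := w) rfl).snd.snd.snd.fst (EvalLE.call (EvalLE.cons
            (EvalLE.var (v := w) rfl).fst (EvalLE.cons (EvalLE.var rfl)
              (EvalLE.var (v := w) rfl).snd.snd.snd.snd)) h))).mono
            (by simp only [Dat.fst_cons, Dat.snd_cons]; omega)
      · simp only [Dat.size_cons]
        have := b.size_pos
        omega
  exact key _ w rfl

/-! ### The construction of an OBDD as a program -/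

def Ref.enc : Ref → Dat
  | Sum.inl b => Dat.cons (encBool false) (encBool b)
  | Sum.inr j => Dat.cons (encBool true) (encNat j)

def encNode (nd : Node n) : Dat :=
  Dat.cons (encFin nd.1) (Dat.cons (Ref.enc nd.2.1) (Ref.enc nd.2.2))

theorem Ref.enc_injective : Function.Injective Ref.enc := by
  rintro (b | i) (c | j) h
  · simp only [Ref.enc, Dat.cons.injEq, true_and] at h
    rw [encBool_injective_of h]
  · simp [Ref.enc, encBool] at h
  · simp [Ref.enc, encBool] at h
  · simp only [Ref.enc, Dat.cons.injEq, true_and] at h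
    rw [Dat.encNat_injective h]
where
  encBool_injective_of {b c : Bool} (h : encBool b = encBool c) : b = c :=
    Dat.encBool_injective h

/-- Thus `nil` can stand for an absent entry in the tries. -/
theorem Ref.enc_ne_nil (r : Ref) : Ref.enc r ≠ Dat.nil := by cases r <;> simp [Ref.enc]

theorem encNode_injective : Function.Injective (encNode (n := n)) := by
  rintro ⟨y, r₀, r₁⟩ ⟨y', r₀', r₁'⟩ h
  simp only [encNode, Dat.cons.injEq] at h
  rw [Dat.encFin_injective h.1, Ref.enc_injective h.2.1, Ref.enc_injective h.2.2]

namespace Dat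

theorem ite_of_ne_nil {c : Dat} (h : c ≠ nil) (a b : Dat) : ite c a b = a := by
  cases c with
  | nil => exact absurd rfl h
  | cons _ _ => rfl

/-- The input consists of a variable, two references and the current data; the data consist of the
trie of known results, the trie of nodes, the reversed list of nodes and its length. -/
def makeNode (u : Dat) : Dat :=
  ite (encBool (decide (u.snd.fst = u.snd.snd.fst))) (cons u.snd.fst u.snd.snd.snd)
    (ite (trieGet (ser (cons u.fst (cons u.snd.fst u.snd.snd.fst))) u.snd.snd.snd.snd.fst)
      (cons (trieGet (ser (cons u.fst (cons u.snd.fst u.snd.snd.fst))) u.snd.snd.snd.snd.fst)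
        u.snd.snd.snd)
      (cons (cons (encBool true) u.snd.snd.snd.snd.snd.snd)
        (cons u.snd.snd.snd.fst
          (cons (trieIns (cons (encBool true) u.snd.snd.snd.snd.snd.snd)
              (ser (cons u.fst (cons u.snd.fst u.snd.snd.fst))) u.snd.snd.snd.snd.fst)
            (cons (cons (cons u.fst (cons u.snd.fst u.snd.snd.fst)) u.snd.snd.snd.snd.snd.fst)
              (inc u.snd.snd.snd.snd.snd.snd))))))

/-- The result at the end of the variable order; the input consists of the rest of the variable
order, a state, the levels and the current data. -/
def leafOutput (w : Dat) : Dat :=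
  cons (cons (encBool false) (ite w.snd.fst (encBool true) (encBool false))) w.snd.snd.snd

/-- The known result or `nil`. -/
def lookup (w : Dat) : Dat := trieGet (ser (cons w.fst w.snd.fst)) w.snd.snd.snd.fst

def falseArg (w : Dat) : Dat :=
  cons (step (cons w.snd.snd.fst (cons (cons w.fst.fst (encBool false))
    (cons w.fst.fst (encBool true)))) w.snd.fst) w.snd.snd

/-- The input consists of the input of the current call and the result of the first recursive
call. -/
def trueArg (z : Dat) : Dat :=
  cons (step (cons z.fst.snd.snd.fst (cons (cons z.fst.fst.fst (encBool true))
    (cons z.fst.fst.fst (encBool false)))) z.fst.snd.fst) (cons z.fst.snd.snd.fst z.snd.snd)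

/-- The input consists of the input of the current call, the first reference and the result of the
second recursive call. -/
def combine (z : Dat) : Dat :=
  cons (makeNode (cons z.fst.fst.fst z.snd)).fst
    (cons (trieIns (makeNode (cons z.fst.fst.fst z.snd)).fst (ser (cons z.fst.fst z.fst.snd.fst))
        (makeNode (cons z.fst.fst.fst z.snd)).snd.fst)
      (makeNode (cons z.fst.fst.fst z.snd)).snd.snd)

/-- The construction of an OBDD. -/
def dfs : Dat → Dat → Dat
  | nil, p => leafOutput (cons nil p)
  | cons y l, p =>
    ite (lookup (cons (cons y l) p)) (cons (lookup (cons (cons y l) p)) p.snd.snd)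
      (combine (cons (cons (cons y l) p) (cons (dfs l (falseArg (cons (cons y l) p))).fst
        (dfs l (trueArg (cons (cons (cons y l) p) (dfs l (falseArg (cons (cons y l) p)))))))))

end Dat

/-- The data `D` represent the state `st` of the construction. -/
structure Simulates (st : BuildState n Dat) (D : Dat) : Prop where
  memo : ∀ l s, Dat.trieGet (Dat.ser (Dat.cons (encList encFin l) s)) D.fst =
    (st.memo (l, s)).elim Dat.nil Ref.enc
  uniq : ∀ nd : Node n, Dat.trieGet (Dat.ser (encNode nd)) D.snd.fst =
    if nd ∈ st.nodes then Ref.enc (Sum.inr (st.nodes.idxOf nd)) else Dat.nil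
  nodes : D.snd.snd.fst = encList encNode st.nodes.reverse
  count : D.snd.snd.snd = encNat st.nodes.length

theorem simulates_init : Simulates (Automaton.initBuild (n := n)) Dat.nil :=
  ⟨fun _ _ => Dat.trieGet_ser_nil _, fun _ => Dat.trieGet_ser_nil _, rfl, by
    simp [Automaton.initBuild, encNat, encList]⟩

theorem makeNode_spec {st : BuildState n Dat} {D : Dat} (h : Simulates st D) (y : Fin n)
    (r₀ r₁ : Ref) : ∃ D', Dat.makeNode (Dat.cons (encFin y) (Dat.cons r₀.enc
        (Dat.cons r₁.enc D))) = Dat.cons (mkNode y r₀ r₁ st.nodes).1.enc D' ∧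
      Simulates ⟨st.memo, st.keys, (mkNode y r₀ r₁ st.nodes).2⟩ D' := by
  have hu := h.uniq (y, r₀, r₁)
  simp only [encNode] at hu
  simp only [Dat.makeNode, Dat.fst_cons, Dat.snd_cons, Ref.enc_injective.eq_iff, hu, mkNode]
  by_cases hr : r₀ = r₁
  · exact ⟨D, by simp [hr], by simpa [hr] using ⟨h.memo, h.uniq, h.nodes, h.count⟩⟩
  · by_cases hm : (y, r₀, r₁) ∈ st.nodes
    · refine ⟨D, ?_, by simpa [hr, hm] using ⟨h.memo, h.uniq, h.nodes, h.count⟩⟩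
      simp [hr, hm, Dat.ite_of_ne_nil (Ref.enc_ne_nil _)]
    · have hc : Dat.cons (encBool true) D.snd.snd.snd = Ref.enc (Sum.inr st.nodes.length) := by
        rw [h.count]; rfl
      simp only [hr, hm, decide_false, if_false, Dat.ite_encBool, Dat.ite_nil, Bool.false_eq_true]
      rw [hc]
      refine ⟨_, rfl, ⟨h.memo, fun nd => ?_, ?_, ?_⟩⟩
      · have e : Dat.cons (encFin y) (Dat.cons r₀.enc r₁.enc) = encNode (y, r₀, r₁) := rfl
        simp only [Dat.fst_cons, Dat.snd_cons, e, Dat.trieGet_ser_trieIns,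
          encNode_injective.eq_iff, h.uniq, List.mem_append, List.mem_singleton]
        by_cases hnd : nd = (y, r₀, r₁)
        · subst hnd
          simp [hm, List.idxOf_append_of_notMem hm]
        · by_cases hmem : nd ∈ st.nodes
          · simp [hnd, hmem, List.idxOf_append_of_mem hmem]
          · simp [hnd, hmem]
      · simp only [Dat.snd_cons, Dat.fst_cons, List.reverse_append, List.reverse_cons,
          List.reverse_nil, List.nil_append, List.singleton_append, encList, h.nodes]
        rfl
      · simp only [Dat.snd_cons, h.count, Dat.inc_encNat, List.length_append, List.length_singleton]

theorem dfs_spec (ls : Levels n) : ∀ (l : List (Fin n)) (s : Dat) (st : BuildState n Dat) (D : Dat),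
    Simulates st D → ∃ D', Dat.dfs (encList encFin l) (Dat.cons s (Dat.cons (encLevels ls) D)) =
      Dat.cons ((stateAut ls).build l s st).1.enc D' ∧
      Simulates ((stateAut ls).build l s st).2 D'
  | [], s, st, D, h => by
    refine ⟨D, ?_, h⟩
    cases s <;> rfl
  | y :: l, s, st, D, h => by
    have hm := h.memo (y :: l) s
    have hl : Dat.lookup (Dat.cons (Dat.cons (encFin y) (encList encFin l))
        (Dat.cons s (Dat.cons (encLevels ls) D))) = (st.memo (y :: l, s)).elim Dat.nil Ref.enc := hm
    simp only [encList, Dat.dfs, hl]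
    cases hs : st.memo (y :: l, s) with
    | some r =>
      refine ⟨D, ?_, ?_⟩
      · simp [Automaton.build, hs, Dat.ite_of_ne_nil (Ref.enc_ne_nil _)]
      · simpa [Automaton.build, hs] using h
    | none =>
      have e : (stateAut ls).build (y :: l) s st =
          (let p₀ := (stateAut ls).build l ((stateAut ls).step y false s) st
           let p₁ := (stateAut ls).build l ((stateAut ls).step y true s) p₀.2
           let m := mkNode y p₀.1 p₁.1 p₁.2.nodes
           (m.1, ⟨Function.update p₁.2.memo (y :: l, s) (some m.1), (y :: l, s) :: p₁.2.keys,
            m.2⟩)) := by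
        rw [Automaton.build, hs]
      rw [e]
      obtain ⟨D₀, e₀, h₀⟩ := dfs_spec ls l ((stateAut ls).step y false s) st D h
      set p₀ := (stateAut ls).build l ((stateAut ls).step y false s) st
      obtain ⟨D₁, e₁, h₁⟩ := dfs_spec ls l ((stateAut ls).step y true s) p₀.2 D₀ h₀
      set p₁ := (stateAut ls).build l ((stateAut ls).step y true s) p₀.2
      obtain ⟨D₂, e₂, h₂⟩ := makeNode_spec h₁ y p₀.1 p₁.1
      have a₀ : Dat.falseArg (Dat.cons (Dat.cons (encFin y) (encList encFin l))
          (Dat.cons s (Dat.cons (encLevels ls) D))) =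
          Dat.cons ((stateAut ls).step y false s) (Dat.cons (encLevels ls) D) := rfl
      have a₁ : Dat.trueArg (Dat.cons (Dat.cons (Dat.cons (encFin y) (encList encFin l))
          (Dat.cons s (Dat.cons (encLevels ls) D))) (Dat.cons p₀.1.enc D₀)) =
          Dat.cons ((stateAut ls).step y true s) (Dat.cons (encLevels ls) D₀) := rfl
      rw [a₀, e₀, a₁, e₁]
      simp only [Option.elim_none, Dat.ite_nil, Dat.combine, Dat.fst_cons, Dat.snd_cons, e₂]
      refine ⟨_, rfl, ⟨fun l' s' => ?_, h₂.uniq, h₂.nodes, h₂.count⟩⟩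
      have hkey : Dat.cons (encList encFin l') s' =
          Dat.cons (Dat.cons (encFin y) (encList encFin l)) s ↔ (l', s') = (y :: l, s) := by
        have : Dat.cons (encFin y) (encList encFin l) = encList encFin (y :: l) := rfl
        rw [this, Dat.cons.injEq, (Dat.encList_injective Dat.encFin_injective).eq_iff, Prod.mk.injEq]
      simp only [Dat.fst_cons, Dat.trieGet_ser_trieIns, hkey]
      by_cases hk : (l', s') = (y :: l, s)
      · rw [if_pos hk, hk, Function.update_self]; rfl
      · rw [if_neg hk, Function.update_of_ne hk]
        exact h₂.memo l' s'

/-! ### Running time of the construction -/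

section Time

/-- The size of the small parts of the input of `Dat.dfs`. -/
def dfsMeasure (w : Dat) : ℕ := w.fst.size + w.snd.fst.size + w.snd.snd.fst.size

/-- Of the current data only the node counter is counted, since the tries and the node list are not
traversed as a whole. -/
def nodeMeasure (u : Dat) : ℕ :=
  u.fst.size + u.snd.fst.size + u.snd.snd.fst.size + u.snd.snd.snd.snd.snd.snd.size

theorem timeIn_nodeKey :
    TimeIn nodeMeasure fun u => Dat.ser (Dat.cons u.fst (Dat.cons u.snd.fst u.snd.snd.fst)) :=
  TimeIn.small (F := Dat.ser) (by fun_prop)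
    (TimeIn.id.fst.cons (TimeIn.id.snd.fst.cons TimeIn.id.snd.snd.fst))
    (PolyIn.linear 1 2 fun u => by simp only [Dat.size_cons, nodeMeasure]; omega)

theorem size_nodeKey (u : Dat) :
    (Dat.ser (Dat.cons u.fst (Dat.cons u.snd.fst u.snd.snd.fst))).size ≤ 4 * nodeMeasure u + 9 := by
  have := Dat.size_ser_le (Dat.cons u.fst (Dat.cons u.snd.fst u.snd.snd.fst))
  simp only [Dat.size_cons, nodeMeasure] at this ⊢
  omega

theorem timeIn_makeNode : TimeIn nodeMeasure Dat.makeNode := by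
  have id := TimeIn.id (m := nodeMeasure)
  have hget := timeIn_trieGet.comp (timeIn_nodeKey.cons id.snd.snd.snd.snd.fst)
    (PolyIn.linear 4 9 size_nodeKey)
  have href := (TimeIn.const (m := nodeMeasure) (encBool true)).cons id.snd.snd.snd.snd.snd.snd
  have hins := timeIn_trieIns.comp (href.cons (timeIn_nodeKey.cons id.snd.snd.snd.snd.fst))
    (PolyIn.linear 4 9 size_nodeKey)
  have heq := TimeIn.small (F := fun w => encBool (decide (w.fst = w.snd)))
    (by fun_prop) (id.snd.fst.cons id.snd.snd.fst)
    (PolyIn.linear 1 2 fun u => by simp only [Dat.size_cons, nodeMeasure]; omega)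
  have hinc := TimeIn.small (F := Dat.inc) (by fun_prop) id.snd.snd.snd.snd.snd.snd
    (PolyIn.linear 1 0 fun u => by simp only [nodeMeasure]; omega)
  exact heq.ite (id.snd.fst.cons id.snd.snd.snd) (hget.ite (hget.cons id.snd.snd.snd)
    (href.cons (id.snd.snd.snd.fst.cons (hins.cons (((id.fst.cons (id.snd.fst.cons
      id.snd.snd.fst)).cons id.snd.snd.snd.snd.snd.fst).cons hinc)))))

theorem timeIn_leafOutput : TimeIn dfsMeasure Dat.leafOutput :=
  ((TimeIn.const _).cons (TimeIn.id.snd.fst.ite (TimeIn.const _) (TimeIn.const _))).cons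
    TimeIn.id.snd.snd.snd

theorem timeIn_lookup : TimeIn dfsMeasure Dat.lookup := by
  have hkey := TimeIn.small (m := dfsMeasure) (F := Dat.ser) (by fun_prop)
    (TimeIn.id.fst.cons TimeIn.id.snd.fst)
    (PolyIn.linear 1 1 fun u => by simp only [Dat.size_cons, dfsMeasure]; omega)
  refine timeIn_trieGet.comp (hkey.cons TimeIn.id.snd.snd.snd.fst) (PolyIn.linear 4 9 fun u => ?_)
  have := Dat.size_ser_le (Dat.cons u.fst u.snd.fst)
  simp only [Dat.size_cons, dfsMeasure, Dat.fst_cons] at this ⊢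
  omega

theorem timeIn_falseArg : TimeIn dfsMeasure Dat.falseArg := by
  refine (TimeIn.small (m := dfsMeasure)
    (F := fun u => Dat.step (Dat.cons u.snd.snd (Dat.cons (Dat.cons u.fst (encBool false))
      (Dat.cons u.fst (encBool true)))) u.snd.fst) (by fun_prop)
    (TimeIn.id.fst.fst.cons (TimeIn.id.snd.fst.cons TimeIn.id.snd.snd.fst))
    (PolyIn.linear 1 2 fun u => ?_)).cons TimeIn.id.snd.snd
  have := u.fst.size_fst_le
  simp only [Dat.size_cons, dfsMeasure]; omega

theorem timeIn_trueArg : TimeIn (fun z => dfsMeasure z.fst) Dat.trueArg := by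
  have id := TimeIn.id (m := fun z => dfsMeasure z.fst)
  refine (TimeIn.small (m := fun z => dfsMeasure z.fst)
    (F := fun u => Dat.step (Dat.cons u.snd.snd (Dat.cons (Dat.cons u.fst (encBool true))
      (Dat.cons u.fst (encBool false)))) u.snd.fst) (by fun_prop)
    (id.fst.fst.fst.cons (id.fst.snd.fst.cons id.fst.snd.snd.fst))
    (PolyIn.linear 1 2 fun u => ?_)).cons (id.fst.snd.snd.fst.cons id.snd.snd)
  have := u.fst.fst.size_fst_le
  simp only [Dat.size_cons, dfsMeasure]; omega

theorem timeIn_combine :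
    TimeIn (fun z => dfsMeasure z.fst + nodeMeasure (Dat.cons Dat.nil z.snd)) Dat.combine := by
  set m : Dat → ℕ := fun z => dfsMeasure z.fst + nodeMeasure (Dat.cons Dat.nil z.snd) with hm
  have id := TimeIn.id (m := m)
  have hnode := timeIn_makeNode.comp (id.fst.fst.fst.cons id.snd)
    (PolyIn.linear (m := m) 1 0 fun z => by
      have := z.fst.fst.size_fst_le
      simp only [hm, nodeMeasure, dfsMeasure, Dat.fst_cons, Dat.snd_cons]
      omega)
  have hkey := TimeIn.small (F := Dat.ser) (by fun_prop) (id.fst.fst.cons id.fst.snd.fst)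
    (PolyIn.linear 1 1 fun u => by simp only [Dat.size_cons, hm, dfsMeasure]; omega)
  refine hnode.fst.cons ((timeIn_trieIns.comp (hnode.fst.cons (hkey.cons hnode.snd.fst))
    (PolyIn.linear 4 9 fun u => ?_)).cons hnode.snd.snd)
  have := Dat.size_ser_le (Dat.cons u.fst.fst u.fst.snd.fst)
  simp only [Dat.size_cons, hm, dfsMeasure, Dat.fst_cons, Dat.snd_cons] at this ⊢
  omega

theorem length_nodes_mkNode (y : Fin n) (r₀ r₁ : Ref) (N : List (Node n)) :
    N.length ≤ (mkNode y r₀ r₁ N).2.length := by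
  unfold mkNode; split_ifs <;> simp

/-- All small parts of the data that occur in the construction have size at most `M`. -/
structure SizeBound (ls : Levels n) (π : VarOrder n) (s₀ : Dat) (M : ℕ) : Prop where
  state : ∀ l s, (stateAut ls).Reach (orderList π) s₀ (l, s) →
    (encList encFin l).size + s.size + (encLevels ls).size ≤ M
  count : ∀ j ≤ ((stateAut ls).result π s₀).2.nodes.length, (encNat j).size + 8 ≤ M

theorem Ref.size_enc_le {N : List (Node n)} {l : List (Fin n)} {r : Ref} (h : Automaton.RefIn N l r)
    {M B : ℕ} (hN : N.length ≤ B) (hM : ∀ j ≤ B, (encNat j).size + 8 ≤ M) : r.enc.size ≤ M := by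
  cases r with
  | inl b =>
    have h1 := Dat.size_encBool_le b
    have h2 := hM 0 (Nat.zero_le _)
    have h3 : (encBool false).size = 1 := rfl
    simp only [Ref.enc, Dat.size_cons]; omega
  | inr j =>
    obtain ⟨nd, hnd, -⟩ := h j rfl
    have hj := (List.getElem?_eq_some_iff.1 hnd).1
    have h2 := hM j (by omega)
    simp only [Ref.enc, Dat.size_cons, encBool, Dat.size_nil]; omega

/-- The specification of `Dat.dfs` with the exponent `c` in the time bound. -/
def DfsSpec (c : ℕ) : Spec := fun w v T =>
  ∃ (n : ℕ) (ls : Levels n) (π : VarOrder n) (s₀ : Dat) (M : ℕ) (l : List (Fin n)) (s : Dat)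
    (st : BuildState n Dat) (D : Dat) (d : ℕ),
    SizeBound ls π s₀ M ∧ Simulates st D ∧ (stateAut ls).BuildInv π (orderList π) s₀ st ∧
    (stateAut ls).Reach (orderList π) s₀ (l, s) ∧
    ((stateAut ls).build l s st).2.nodes.length ≤
      ((stateAut ls).result π s₀).2.nodes.length ∧
    ((stateAut ls).build l s st).2.keys.length = st.keys.length + d ∧
    w = Dat.cons (encList encFin l) (Dat.cons s (Dat.cons (encLevels ls) D)) ∧
    v = Dat.dfs w.fst w.snd ∧
    T = (M + 2) ^ c * (1 + 3 * d)

/-- The time is charged to the `d` new keys. A call answered from the memo or at a leaf takes one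
unit. A memo miss has `d = d₀ + d₁ + 1`, and 1 + 3d = (1 + 3d₀) + (1 + 3d₁) + 2, so two units remain
for its own work. -/
theorem implements_dfs : ∃ c, Implements (DfsSpec c) := by
  obtain ⟨c₁, i₁⟩ := timeIn_leafOutput
  obtain ⟨c₂, i₂⟩ := timeIn_lookup
  obtain ⟨c₃, i₃⟩ := timeIn_falseArg
  obtain ⟨c₄, i₄⟩ := timeIn_trueArg
  obtain ⟨c₅, i₅⟩ := timeIn_combine
  -- The unit of time. The last term belongs to `Dat.combine`, whose measure is made up of that of
  -- the call, two references and the counter, each at most `M`, and a constant.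
  obtain ⟨c, hc⟩ : PolyIn (fun M : ℕ => M) fun M => 60 + (M + 2) ^ c₁ + (M + 2) ^ c₂ +
      (M + 2) ^ c₃ + (M + 2) ^ c₄ + (5 * M + 2) ^ c₅ := by
    have hp : ∀ b c, PolyIn (fun M : ℕ => M) fun M => (b * M + 2) ^ c := fun b c =>
      (((PolyIn.const b).mul PolyIn.self).add (PolyIn.const 2)).pow c
    have hp' : ∀ c, PolyIn (fun M : ℕ => M) fun M => (M + 2) ^ c := fun c =>
      (PolyIn.self.add (PolyIn.const 2)).pow c
    exact (((((PolyIn.const 60).add (hp' c₁)).add (hp' c₂)).add (hp' c₃)).add (hp' c₄)).add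
      (hp 5 c₅)
  refine ⟨c, Implements.define ![_, _, _, _, _] (Fin.forall_fin_succ.2 ⟨i₁, Fin.forall_fin_succ.2
    ⟨i₂, Fin.forall_fin_succ.2 ⟨i₃, Fin.forall_fin_two.2 ⟨i₄, i₅⟩⟩⟩⟩)
    (fun i self => Expr.cases (Expr.var 0).fst (Expr.call (i 0) (Expr.var 0))
      (Expr.bind (Expr.call (i 1) (Expr.var 2))
        (Expr.cases (Expr.var 0)
          (Expr.bind (Expr.call self (Expr.cons (Expr.var 2) (Expr.call (i 2) (Expr.var 3))))
            (Expr.bind (Expr.call self (Expr.cons (Expr.var 3) (Expr.call (i 3)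
                (Expr.cons (Expr.var 4) (Expr.var 0)))))
              (Expr.call (i 4) (Expr.cons (Expr.var 5)
                (Expr.cons (Expr.var 1).fst (Expr.var 0))))))
          (Expr.cons (Expr.var 2) (Expr.var 5).snd.snd.snd)))) _ ?_⟩
  intro P i self hself hm
  have m₁ := hm 0
  have m₂ := hm 1
  have m₃ := hm 2
  have m₄ := hm 3
  have m₅ := hm 4
  rintro w v T ⟨n, ls, π, s₀, M, l, s, st, D, d, hM, hsim, hinv, hreach, hlen, hd, hw, rfl, rfl⟩
  induction l generalizing s st D d w with
  | nil =>
    have hsz := hM.state _ _ hreach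
    have hmeas : dfsMeasure w ≤ M := by rw [hw]; exact hsz
    have hout : Dat.dfs w.fst w.snd = Dat.leafOutput w := by rw [hw]; rfl
    have hwfst : w.fst = Dat.nil := by rw [hw]; rfl
    have hhead : EvalLE P [w] (Expr.var 0).fst Dat.nil (1 + 1 + 1) := by
      rw [← hwfst]; exact (EvalLE.var rfl).fst
    rw [hout]
    refine (EvalLE.self hself (EvalLE.casesNil hhead ((EvalLE.var rfl).call
      (m₁ _ _ _ ⟨rfl, rfl⟩)))).mono ?_
    have hK : 60 + (M + 2) ^ c₁ + (M + 2) ^ c₂ + (M + 2) ^ c₃ + (M + 2) ^ c₄ +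
      (5 * M + 2) ^ c₅ ≤ (M + 2) ^ c := hc M
    have e : (dfsMeasure w + 2) ^ c₁ ≤ (M + 2) ^ c₁ :=
      Nat.pow_le_pow_left (Nat.add_le_add_right hmeas 2) _
    have e2 : (M + 2) ^ c ≤ (M + 2) ^ c * (1 + 3 * d) := Nat.le_mul_of_pos_right _ (by omega)
    generalize (M + 2) ^ c * (1 + 3 * d) = X at *
    omega
  | cons y l ih =>
    have hsz := hM.state _ _ hreach
    have hnd := orderList_nodup π
    have hK : 60 + (M + 2) ^ c₁ + (M + 2) ^ c₂ + (M + 2) ^ c₃ + (M + 2) ^ c₄ +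
      (5 * M + 2) ^ c₅ ≤ (M + 2) ^ c := hc M
    have hmeas : dfsMeasure w ≤ M := by rw [hw]; exact hsz
    have t₂ : (dfsMeasure w + 2) ^ c₂ ≤ (M + 2) ^ c₂ :=
      Nat.pow_le_pow_left (Nat.add_le_add_right hmeas 2) _
    have t₃ : (dfsMeasure w + 2) ^ c₃ ≤ (M + 2) ^ c₃ :=
      Nat.pow_le_pow_left (Nat.add_le_add_right hmeas 2) _
    have t₄ : (dfsMeasure w + 2) ^ c₄ ≤ (M + 2) ^ c₄ :=
      Nat.pow_le_pow_left (Nat.add_le_add_right hmeas 2) _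
    have hlook : Dat.lookup w = (st.memo (y :: l, s)).elim Dat.nil Ref.enc := by
      rw [hw]; exact hsim.memo (y :: l) s
    have hdfs : Dat.dfs w.fst w.snd = Dat.ite (Dat.lookup w) (Dat.cons (Dat.lookup w) w.snd.snd.snd)
        (Dat.combine (Dat.cons w (Dat.cons (Dat.dfs (encList encFin l) (Dat.falseArg w)).fst
        (Dat.dfs (encList encFin l) (Dat.trueArg
          (Dat.cons w (Dat.dfs (encList encFin l) (Dat.falseArg w)))))))) := by
      rw [hw]; rfl
    have hwfst : w.fst = Dat.cons (encFin y) (encList encFin l) := by rw [hw]; rfl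
    have hhead : EvalLE P [w] (Expr.var 0).fst (Dat.cons (encFin y) (encList encFin l)) (1 + 1 + 1) := by
      rw [← hwfst]; exact (EvalLE.var rfl).fst
    have hcall : EvalLE P [encFin y, encList encFin l, w] (Expr.call (i 1) (Expr.var 2))
        (Dat.lookup w) (1 + (dfsMeasure w + 2) ^ c₂) :=
      (EvalLE.var rfl).call (m₂ _ _ _ ⟨rfl, rfl⟩)
    rw [hdfs]
    cases hs : st.memo (y :: l, s) with
    | some r =>
      have hne : Dat.lookup w ≠ Dat.nil := by rw [hlook, hs]; exact Ref.enc_ne_nil r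
      rw [Dat.ite_of_ne_nil hne]
      obtain ⟨a, b, hab⟩ : ∃ a b, Dat.lookup w = Dat.cons a b := by
        cases h : Dat.lookup w with
        | nil => exact absurd h hne
        | cons a b => exact ⟨a, b, rfl⟩
      refine (EvalLE.self hself (EvalLE.casesCons hhead (EvalLE.bind hcall
        (EvalLE.casesCons (l := a) (r := b) (EvalLE.var (by simp [hab])) (EvalLE.cons
          (EvalLE.var rfl) (EvalLE.var (v := w) rfl).snd.snd.snd))))).mono ?_
      have e2 : (M + 2) ^ c ≤ (M + 2) ^ c * (1 + 3 * d) := Nat.le_mul_of_pos_right _ (by omega)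
      generalize (M + 2) ^ c * (1 + 3 * d) = X at *
      omega
    | none =>
      have hnil : Dat.lookup w = Dat.nil := by rw [hlook, hs]; rfl
      have e : (stateAut ls).build (y :: l) s st =
          (let p₀ := (stateAut ls).build l ((stateAut ls).step y false s) st
           let p₁ := (stateAut ls).build l ((stateAut ls).step y true s) p₀.2
           let m := mkNode y p₀.1 p₁.1 p₁.2.nodes
           (m.1, ⟨Function.update p₁.2.memo (y :: l, s) (some m.1), (y :: l, s) :: p₁.2.keys,
            m.2⟩)) := by
        rw [Automaton.build, hs]
      rw [e] at hlen hd
      have hp := orderList_pairwise π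
      obtain ⟨I₀, -, R₀, P₀, K₀, -⟩ := Automaton.build_spec hp l ((stateAut ls).step y false s) st
        hinv (hreach.step hnd false)
      obtain ⟨D₀, e₀, h₀⟩ := dfs_spec ls l ((stateAut ls).step y false s) st D hsim
      have ih₀ := fun w => ih w ((stateAut ls).step y false s) st D
      set p₀ := (stateAut ls).build l ((stateAut ls).step y false s) st
      obtain ⟨-, -, R₁, P₁, K₁, -⟩ := Automaton.build_spec hp l ((stateAut ls).step y true s) p₀.2
        I₀ (hreach.step hnd true)
      obtain ⟨D₁, e₁, h₁⟩ := dfs_spec ls l ((stateAut ls).step y true s) p₀.2 D₀ h₀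
      have ih₁ := fun w => ih w ((stateAut ls).step y true s) p₀.2 D₀
      set p₁ := (stateAut ls).build l ((stateAut ls).step y true s) p₀.2
      have l₁ : p₁.2.nodes.length ≤ ((stateAut ls).result π s₀).2.nodes.length :=
        (length_nodes_mkNode _ _ _ _).trans hlen
      have l₀ : p₀.2.nodes.length ≤ ((stateAut ls).result π s₀).2.nodes.length :=
        P₁.length_le.trans l₁
      obtain ⟨d₀, hd₀⟩ := Nat.exists_eq_add_of_le K₀.length_le
      obtain ⟨d₁, hd₁⟩ := Nat.exists_eq_add_of_le K₁.length_le
      have a₀ : Dat.falseArg w =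
          Dat.cons ((stateAut ls).step y false s) (Dat.cons (encLevels ls) D) := by rw [hw]; rfl
      have a₁ : Dat.trueArg (Dat.cons w (Dat.cons p₀.1.enc D₀)) =
          Dat.cons ((stateAut ls).step y true s) (Dat.cons (encLevels ls) D₀) := by rw [hw]; rfl
      have f₀ := ih₀ _ d₀ hsim hinv (hreach.step hnd false) l₀ hd₀ rfl
      have f₁ := ih₁ _ d₁ h₀ I₀ (hreach.step hnd true) l₁ hd₁ rfl
      simp only [Dat.fst_cons, Dat.snd_cons] at f₀ f₁
      rw [← a₀] at f₀ e₀
      rw [e₀] at f₀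
      rw [hnil, Dat.ite_nil, e₀]
      rw [← a₁] at f₁ e₁
      rw [e₁] at f₁ ⊢
      have r₀ : p₀.1.enc.size ≤ M := Ref.size_enc_le R₀ l₀ hM.count
      have r₁ : p₁.1.enc.size ≤ M := Ref.size_enc_le R₁ l₁ hM.count
      have hcnt : D₁.snd.snd.snd.size ≤ M := by
        rw [h₁.count]
        have := hM.count _ l₁
        omega
      have t₅ : (dfsMeasure w + nodeMeasure (Dat.cons Dat.nil (Dat.cons p₀.1.enc
          (Dat.cons p₁.1.enc D₁))) + 2) ^ c₅ ≤ (5 * M + 2) ^ c₅ := by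
        refine Nat.pow_le_pow_left ?_ _
        have := (encLevels ls).size_pos
        simp only [nodeMeasure, Dat.fst_cons, Dat.snd_cons, Dat.size_nil]
        have h8 := hM.count 0 (Nat.zero_le _)
        omega
      refine (EvalLE.self hself (EvalLE.casesCons hhead (EvalLE.bind hcall
        (EvalLE.casesNil (EvalLE.var (by simp [hnil])) (EvalLE.bind
          (EvalLE.call (EvalLE.cons (EvalLE.var rfl) ((EvalLE.var rfl).call
            (m₃ w _ _ ⟨rfl, rfl⟩))) f₀)
          (EvalLE.bind (EvalLE.call (EvalLE.cons (EvalLE.var rfl) (EvalLE.call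
            (EvalLE.cons (EvalLE.var rfl) (EvalLE.var rfl)) (m₄ _ _ _ ⟨rfl, rfl⟩))) f₁)
            (EvalLE.call (EvalLE.cons (EvalLE.var rfl) (EvalLE.cons (EvalLE.fst
              (v := Dat.cons p₀.1.enc D₀) (EvalLE.var rfl)) (EvalLE.var rfl)))
              (m₅ _ _ _ ⟨rfl, rfl⟩)))))))).mono ?_
      simp only [Dat.fst_cons, Dat.snd_cons]
      have hd' : p₁.2.keys.length + 1 = st.keys.length + d := hd
      have hdd : d = d₀ + d₁ + 1 := by omega
      have e3 : (M + 2) ^ c * (1 + 3 * d) = (M + 2) ^ c * (1 + 3 * d₀) + (M + 2) ^ c * (1 + 3 * d₁)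
          + 2 * (M + 2) ^ c := by rw [hdd]; ring
      rw [e3]
      generalize (M + 2) ^ c * (1 + 3 * d₀) = X₀ at *
      generalize (M + 2) ^ c * (1 + 3 * d₁) = X₁ at *
      omega

end Time

/-! ### Output of an OBDD -/

namespace Dat

/-- Reverses a list of nodes and collects the labels. -/
def revLabels : Dat → Dat → Dat
  | nil, p => p
  | cons nd r, p => revLabels r (cons (cons nd p.fst) (ins nd.fst p.snd))

theorem revLabels_encList (L acc : List (Node n)) :
    revLabels (encList encNode L) (cons (encList encNode acc)
        (sort (encList (fun nd => encFin nd.1) acc))) =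
      cons (encList encNode (L.reverse ++ acc))
        (sort (encList (fun nd => encFin nd.1) (L.reverse ++ acc))) := by
  induction L generalizing acc with
  | nil => rfl
  | cons nd L ih =>
    rw [List.reverse_cons, List.append_assoc]
    exact ih (nd :: acc)

end Dat

theorem encRef_toFin {m : ℕ} {r : Ref} (h : ∀ j, r = Sum.inr j → j < m) :
    encRef (Ref.toFin m r) = r.enc := by
  cases r with
  | inl b => rfl
  | inr j => simp [Ref.toFin, h j rfl, encRef, Ref.enc, encFin]

theorem encList_finRange {α : Type*} (N : List α) (f : Fin N.length → Dat) (g : α → Dat)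
    (h : ∀ i, f i = g N[i]) : encList f (List.finRange N.length) = encList g N := by
  have : N = (List.finRange N.length).map fun i => N[i] := by simp
  conv_rhs => rw [this, encList_map']
  exact congrArg (fun f => encList f _) (funext h)
where
  encList_map' {α β : Type _} (f : β → Dat) (g : α → β) (l : List α) :
      encList f (l.map g) = encList (fun x => f (g x)) l := Dat.encList_map f g l

theorem labelSet_nodesToOBDD (N : List (Node n)) (r : Ref) : (nodesToOBDD N r).labelSet =
    Dat.sort (encList (fun nd => encFin nd.1) N) := by
  rw [OBDD.labelSet]
  exact congrArg _ (encList_finRange N _ _ fun i => rfl)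

theorem encOBDD_nodesToOBDD {π : VarOrder n} {N : List (Node n)} (hN : Reduced π N) {r : Ref}
    (hr : ∀ j, r = Sum.inr j → j < N.length) :
    encOBDD (nodesToOBDD N r) = Dat.cons r.enc (encList encNode N) := by
  have h₁ : encRef (nodesToOBDD N r).root = r.enc := encRef_toFin hr
  rw [encOBDD, h₁]
  refine congrArg _ (encList_finRange N _ _ fun i => ?_)
  have hi : N[i.val]? = some ((N[i]).1, (N[i]).2.1, (N[i]).2.2) := by simp
  have hlt := i.isLt
  have c₀ : encRef ((nodesToOBDD N r).child i false) = (N[i]).2.1.enc :=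
    encRef_toFin (m := N.length) (r := (N[i]).2.1) fun j hj => by
      have : j < i.val := hN.lt₀ (hj ▸ hi)
      omega
  have c₁ : encRef ((nodesToOBDD N r).child i true) = (N[i]).2.2.enc :=
    encRef_toFin (m := N.length) (r := (N[i]).2.2) fun j hj => by
      have : j < i.val := hN.lt₁ (hj ▸ hi)
      omega
  rw [c₀, c₁]
  rfl

/-! ### The program that constructs an OBDD -/

/-- The specification of `Dat.revLabels` with the exponent `c` in the time bound. -/
def RevSpec (c : ℕ) : Spec := fun w v T =>
  ∃ (n : ℕ) (L acc : List (Node n)) (M : ℕ),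
    (∀ l : List (Fin n), (Dat.sort (encList encFin l)).size ≤ M) ∧
    w = Dat.cons (encList encNode L) (Dat.cons (encList encNode acc)
      (Dat.sort (encList (fun nd => encFin nd.1) acc))) ∧
    v = Dat.revLabels w.fst w.snd ∧ T = (M + 2) ^ c * (1 + L.length)

/-- The collected labels form a sorted list without repetitions, whose size is bounded by `M`
independently of the number of nodes; so each node costs only a polynomial in `M`. -/
theorem implements_revLabels : ∃ c, Implements (RevSpec c) := by
  obtain ⟨c₁, -, i₁⟩ := (show PolyTime fun w => Dat.ins w.fst w.snd by fun_prop).bound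
  obtain ⟨c, hc⟩ : PolyIn (fun M : ℕ => M) fun M => 60 + (2 * M + 3) ^ c₁ :=
    (PolyIn.const 60).add ((((PolyIn.const 2).mul PolyIn.self).add (PolyIn.const 3)).pow c₁)
  refine ⟨c, Implements.define ![_] (Fin.forall_fin_one.2 i₁)
    (fun i self => Expr.cases (Expr.var 0).fst (Expr.var 0).snd
      (Expr.call self (Expr.cons (Expr.var 1) (Expr.cons
        (Expr.cons (Expr.var 0) (Expr.var 2).snd.fst)
        (Expr.call (i 0) (Expr.cons (Expr.var 0).fst (Expr.var 2).snd.snd)))))) _ ?_⟩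
  intro P i self hself hm
  have m₁ := hm 0
  rintro w v T ⟨n, L, acc, M, hM, hw, rfl, rfl⟩
  have hK : 60 + (2 * M + 3) ^ c₁ ≤ (M + 2) ^ c := hc M
  induction L generalizing acc w with
  | nil =>
    have hwfst : w.fst = Dat.nil := by rw [hw]; rfl
    have hhead : EvalLE P [w] (Expr.var 0).fst Dat.nil (1 + 1 + 1) := by
      rw [← hwfst]; exact (EvalLE.var rfl).fst
    rw [hwfst]
    refine (EvalLE.self hself (EvalLE.casesNil hhead (EvalLE.var (v := w) rfl).snd)).mono ?_
    simp only [List.length_nil]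
    omega
  | cons nd L ih =>
    have hwfst : w.fst = Dat.cons (encNode nd) (encList encNode L) := by rw [hw]; rfl
    have hhead : EvalLE P [w] (Expr.var 0).fst (Dat.cons (encNode nd) (encList encNode L))
        (1 + 1 + 1) := by
      rw [← hwfst]; exact (EvalLE.var rfl).fst
    have f := ih (Dat.cons (encList encNode L) (Dat.cons
      (Dat.cons (encNode nd) w.snd.fst) (Dat.ins (encNode nd).fst w.snd.snd))) (nd :: acc) (by rw [hw]; rfl)
    rw [hwfst]
    refine (EvalLE.self hself (EvalLE.casesCons hhead (EvalLE.call (EvalLE.cons (EvalLE.var rfl)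
      (EvalLE.cons (EvalLE.cons (EvalLE.var rfl) (EvalLE.var (v := w) rfl).snd.fst)
        (EvalLE.call (EvalLE.cons (EvalLE.fst (v := encNode nd) (EvalLE.var rfl))
          (EvalLE.var (v := w) rfl).snd.snd) (m₁ _ _ _ ⟨rfl, rfl⟩)))) f))).mono ?_
    have e₁ : w.snd.snd = Dat.sort (encList encFin (acc.map Prod.fst)) := by
      rw [hw, Dat.encList_map]; rfl
    have e₂ := hM (acc.map Prod.fst)
    rw [← e₁] at e₂
    have e₃ := hM [nd.1]
    have e₄ : (Dat.sort (encList encFin [nd.1])).size = (encFin nd.1).size + 1 + 1 := rfl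
    have e₅ : ((Dat.cons (encNode nd).fst w.snd.snd).size + 2) ^ c₁ ≤ (2 * M + 3) ^ c₁ := by
      refine Nat.pow_le_pow_left ?_ _
      simp only [Dat.size_cons, encNode, Dat.fst_cons]
      omega
    simp only [List.length_cons]
    have e₆ : (M + 2) ^ c * (1 + (L.length + 1)) = (M + 2) ^ c * (1 + L.length) + (M + 2) ^ c := by
      ring
    rw [e₆]
    generalize (M + 2) ^ c * (1 + L.length) = X at *
    omega

/-- The specification of the program that constructs an OBDD. -/
def BuildSpec (c : ℕ) : Spec := fun w v T =>
  ∃ (n : ℕ) (ls : Levels n) (π : VarOrder n) (C : List (Clause n)) (M W : ℕ),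
    SizeBound ls π (startState ls C) M ∧
    ((stateAut ls).result π (startState ls C)).2.keys.length ≤ W ∧
    (encList encClause C).size ≤ M ∧
    (∀ l : List (Fin n), (Dat.sort (encList encFin l)).size ≤ M) ∧
    w = Dat.cons (encVarOrder π) (Dat.cons (encLevels ls) (encList encClause C)) ∧
    v = Dat.cons (encOBDD ((stateAut ls).toOBDD π (startState ls C)))
      ((stateAut ls).toOBDD π (startState ls C)).labelSet ∧
    T = (M + 2) ^ c * (1 + W)

theorem implements_build : ∃ c, Implements (BuildSpec c) := by
  obtain ⟨c₁, -, i₁⟩ := (show PolyTime fun w => Dat.initState w.snd.fst w.snd.snd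
    by fun_prop).bound
  obtain ⟨c₂, i₂⟩ := implements_dfs
  obtain ⟨c₃, i₃⟩ := implements_revLabels
  obtain ⟨c, hc⟩ : PolyIn (fun M : ℕ => M) fun M => 60 + (3 * M + 4) ^ c₁ + 3 * (M + 2) ^ c₂ +
      (M + 2) ^ c₃ :=
    (((PolyIn.const 60).add ((((PolyIn.const 3).mul PolyIn.self).add (PolyIn.const 4)).pow c₁)).add
      ((PolyIn.const 3).mul ((PolyIn.self.add (PolyIn.const 2)).pow c₂))).add
      ((PolyIn.self.add (PolyIn.const 2)).pow c₃)
  refine ⟨c, Implements.define ![_, _, _] (Fin.forall_fin_succ.2 ⟨i₁, Fin.forall_fin_two.2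
    ⟨i₂, i₃⟩⟩)
    (fun i _ => Expr.bind (Expr.call (i 1) (Expr.cons (Expr.var 0).fst (Expr.cons
        (Expr.call (i 0) (Expr.var 0)) (Expr.cons (Expr.var 0).snd.fst Expr.nil))))
      (Expr.bind (Expr.call (i 2) (Expr.cons (Expr.var 0).snd.snd.snd.fst
          (Expr.cons Expr.nil Expr.nil)))
        (Expr.cons (Expr.cons (Expr.var 1).fst (Expr.var 0).fst) (Expr.var 0).snd))) _ ?_⟩
  intro P i self hself hm
  have m₁ := hm 0
  have m₂ := hm 1
  have m₃ := hm 2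
  rintro w v T ⟨n, ls, π, C, M, W, hM, hW, hC, hl, rfl, rfl, rfl⟩
  have hK : 60 + (3 * M + 4) ^ c₁ + 3 * (M + 2) ^ c₂ + (M + 2) ^ c₃ ≤ (M + 2) ^ c := hc M
  set s₀ := startState ls C with hs₀
  set w := Dat.cons (encVarOrder π) (Dat.cons (encLevels ls) (encList encClause C)) with hw
  obtain ⟨D, eD, hD⟩ := dfs_spec ls (orderList π) s₀ Automaton.initBuild Dat.nil simulates_init
  have hinit := Automaton.buildInv_init (A := stateAut ls) π (orderList π) s₀
  have hreach : (stateAut ls).Reach (orderList π) s₀ (orderList π, s₀) :=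
    ⟨[], fun _ => false, rfl, rfl⟩
  obtain ⟨hinv, -, hrefin, -, -, -⟩ := Automaton.build_spec (orderList_pairwise π) (orderList π) s₀
    Automaton.initBuild hinit hreach
  change Automaton.BuildInv _ π (orderList π) s₀ ((stateAut ls).result π s₀).2 at hinv
  change Automaton.RefIn ((stateAut ls).result π s₀).2.nodes _ ((stateAut ls).result π s₀).1
    at hrefin
  change Dat.dfs _ _ = Dat.cons ((stateAut ls).result π s₀).1.enc D at eD
  change Simulates ((stateAut ls).result π s₀).2 D at hD
  have f₂ := m₂ (Dat.cons (encList encFin (orderList π)) (Dat.cons s₀ (Dat.cons (encLevels ls)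
    Dat.nil))) _ _ ⟨n, ls, π, s₀, M, orderList π, s₀, Automaton.initBuild, Dat.nil,
      ((stateAut ls).result π s₀).2.keys.length, hM, simulates_init, hinit, hreach, le_rfl,
      by simp [Automaton.initBuild, Automaton.result], rfl, rfl, rfl⟩
  rw [Dat.fst_cons, Dat.snd_cons, eD] at f₂
  have f₃ := m₃ (Dat.cons D.snd.snd.fst (Dat.cons Dat.nil Dat.nil)) _ _
    ⟨n, ((stateAut ls).result π s₀).2.nodes.reverse, [], M, hl, by rw [hD.nodes]; rfl, rfl, rfl⟩
  have e₃ : Dat.revLabels D.snd.snd.fst (Dat.cons Dat.nil Dat.nil) =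
      Dat.cons (encList encNode ((stateAut ls).result π s₀).2.nodes)
        ((stateAut ls).toOBDD π s₀).labelSet := by
    rw [hD.nodes]
    have := Dat.revLabels_encList ((stateAut ls).result π s₀).2.nodes.reverse []
    rw [List.reverse_reverse, List.append_nil] at this
    rw [Automaton.toOBDD, labelSet_nodesToOBDD]
    exact this
  rw [Dat.fst_cons, Dat.snd_cons, e₃] at f₃
  have e₄ : encOBDD ((stateAut ls).toOBDD π s₀) = Dat.cons ((stateAut ls).result π s₀).1.enc
      (encList encNode ((stateAut ls).result π s₀).2.nodes) := by
    refine encOBDD_nodesToOBDD hinv.red fun j hj => ?_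
    obtain ⟨nd, hnd, -⟩ := hrefin j hj
    exact (List.getElem?_eq_some_iff.1 hnd).1
  rw [e₄]
  refine (EvalLE.self hself (EvalLE.bind (EvalLE.call (EvalLE.cons (EvalLE.fst (v := w)
    (EvalLE.var rfl)) (EvalLE.cons ((EvalLE.var rfl).call (m₁ w _ _ ⟨rfl, rfl⟩))
      (EvalLE.cons (EvalLE.var (v := w) rfl).snd.fst EvalLE.nil))) f₂)
    (EvalLE.bind (EvalLE.call (EvalLE.cons (EvalLE.fst (EvalLE.snd (EvalLE.snd (EvalLE.snd
      (v := Dat.cons ((stateAut ls).result π s₀).1.enc D) (EvalLE.var rfl)))))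
      (EvalLE.cons EvalLE.nil EvalLE.nil)) f₃)
      (EvalLE.cons (EvalLE.cons (EvalLE.fst
        (v := Dat.cons ((stateAut ls).result π s₀).1.enc D) (EvalLE.var rfl))
        (EvalLE.fst (v := Dat.cons (encList encNode ((stateAut ls).result π s₀).2.nodes)
        ((stateAut ls).toOBDD π s₀).labelSet) (EvalLE.var rfl)))
        (EvalLE.snd (v := Dat.cons (encList encNode ((stateAut ls).result π s₀).2.nodes)
        ((stateAut ls).toOBDD π s₀).labelSet) (EvalLE.var rfl)))))).mono ?_
  have hsz := hM.state _ _ hreach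
  have b₁ : (w.size + 2) ^ c₁ ≤ (3 * M + 4) ^ c₁ := by
    refine Nat.pow_le_pow_left ?_ _
    have : (encVarOrder π).size = (encList encFin (orderList π)).size := rfl
    simp only [hw, Dat.size_cons]
    omega
  have b₂ : (M + 2) ^ c₂ * (1 + 3 * ((stateAut ls).result π s₀).2.keys.length) ≤
      (3 * (M + 2) ^ c₂) * (1 + W) :=
    calc _ ≤ (M + 2) ^ c₂ * (3 * (1 + W)) := Nat.mul_le_mul_left _ (by omega)
      _ = _ := by ring
  have b₃ : (M + 2) ^ c₃ * (1 + ((stateAut ls).result π s₀).2.nodes.reverse.length) ≤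
      (M + 2) ^ c₃ * (1 + W) := by
    have := hinv.length
    rw [List.length_reverse]
    exact Nat.mul_le_mul_left _ (by omega)
  have b₄ := Nat.mul_le_mul_right (1 + W) hK
  have b₅ : 60 + (3 * M + 4) ^ c₁ ≤ (60 + (3 * M + 4) ^ c₁) * (1 + W) :=
    Nat.le_mul_of_pos_right _ (by omega)
  have e₅ : (60 + (3 * M + 4) ^ c₁ + 3 * (M + 2) ^ c₂ + (M + 2) ^ c₃) * (1 + W) =
      (60 + (3 * M + 4) ^ c₁) * (1 + W) + (3 * (M + 2) ^ c₂) * (1 + W) +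
        (M + 2) ^ c₃ * (1 + W) := by ring
  rw [e₅] at b₄
  generalize (60 + (3 * M + 4) ^ c₁) * (1 + W) = X₁ at *
  generalize (3 * (M + 2) ^ c₂) * (1 + W) = X₂ at *
  generalize (M + 2) ^ c₃ * (1 + W) = X₃ at *
  generalize (M + 2) ^ c₂ * (1 + 3 * ((stateAut ls).result π s₀).2.keys.length) = X₄ at *
  generalize (M + 2) ^ c₃ * (1 + ((stateAut ls).result π s₀).2.nodes.reverse.length) = X₅ at *
  generalize (M + 2) ^ c * (1 + W) = X₆ at *
  omega

/-! ### Encodings of the data of a run -/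

theorem length_le_size_encList {α : Type*} (f : α → Dat) (l : List α) :
    l.length ≤ (encList f l).size := by
  induction l with
  | nil => simp
  | cons x l ih => simp only [encList, Dat.size_cons, List.length_cons]; omega

/-- The OBDD is left out: later OBDDs are constructed from the clauses, and the labels suffice for
choosing the bucket. -/
def encItem (it : Item n) : Dat := Dat.cons (encList encClause it.clauses) it.vars

def encVar (quant : Fin n → Quantifier) (x : Fin n) : Dat :=
  Dat.cons (encFin x) (encQuantifier (quant x))

namespace Dat

theorem append_encList {α : Type*} (f : α → Dat) (l l' : List α) :
    append (encList f l) (encList f l') = encList f (l ++ l') :=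
  toList_injective (by simp)

theorem reverse_encList {α : Type*} (f : α → Dat) (l : List α) :
    reverse (encList f l) = encList f l.reverse :=
  toList_injective (by simp)

theorem bucketClauses_encList (x : Fin n) (L : List (Item n)) :
    bucketClauses (encFin x) (encList encItem L) = encList encClause (bucketOf x L) := by
  induction L with
  | nil => rfl
  | cons it L ih =>
    have e : bucketClauses (encFin x) (encList encItem (it :: L)) =
      if it.Contains x then append (encList encClause it.clauses)
        (bucketClauses (encFin x) (encList encItem L))
      else bucketClauses (encFin x) (encList encItem L) := rfl
    rw [e, ih]
    by_cases h : it.Contains x <;> simp [h, bucketOf, append_encList]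

theorem otherItems_encList (x : Fin n) (L : List (Item n)) :
    otherItems (encFin x) (encList encItem L) =
      encList encItem (L.filter fun it => ¬ it.Contains x) := by
  induction L with
  | nil => rfl
  | cons it L ih =>
    have e : otherItems (encFin x) (encList encItem (it :: L)) =
      if it.Contains x then otherItems (encFin x) (encList encItem L)
      else cons (encItem it) (otherItems (encFin x) (encList encItem L)) := rfl
    rw [e, ih]
    by_cases h : it.Contains x <;> simp [h, encList]

theorem allClauses_encList (L : List (Item n)) :
    allClauses (encList encItem L) = encList encClause (L.flatMap Item.clauses) := by
  induction L with
  | nil => rfl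
  | cons it L ih =>
    rw [List.flatMap_cons, ← append_encList, ← ih]
    rfl

theorem clauseVars_encClause (C : Clause n) :
    clauseVars (encClause C) = encList (fun l : Literal n => encFin l.1) C := by
  induction C with
  | nil => rfl
  | cons l C ih => rw [encList, ← ih]; rfl

theorem clauseItems_encList (π : VarOrder n) (quant : Fin n → Quantifier) (T : List (Clause n)) :
    clauseItems (encList encClause T) = encList encItem (T.map (Item.ofClause π quant)) := by
  induction T with
  | nil => rfl
  | cons C T ih =>
    rw [List.map_cons, encList, encList, ← ih, clauseItems, clauseVars_encClause]
    rfl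

theorem enumRight_reverse {α : Type*} (f : α → Dat) (qs : List α) :
    enumRight (encList f qs.reverse) =
      cons (encList (fun p : α × ℕ => cons (encNat p.2) (f p.1)) qs.zipIdx.reverse)
        (encNat qs.length) := by
  induction qs using List.reverseRecOn with
  | nil => simp [encList, enumRight, encNat]
  | append_singleton qs q ih =>
    simp only [List.reverse_append, List.reverse_singleton, List.singleton_append, encList,
      enumRight, ih, fst_cons, snd_cons, inc_encNat, List.zipIdx_append, List.zipIdx_singleton,
      List.length_append, List.length_singleton, Nat.zero_add]

/-- The variables of the prefix with their quantifiers. -/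
def prefixVars (w : Dat) : Dat := reverse (enumRight (reverse w)).fst

theorem prefixVars_ofFn (quant : Fin n → Quantifier) :
    prefixVars (encList encQuantifier (List.ofFn quant)) =
      encList (encVar quant) (List.finRange n) := by
  rw [prefixVars, reverse_encList, enumRight_reverse, fst_cons, reverse_encList,
    List.reverse_reverse]
  refine toList_injective ?_
  rw [toList_encList, toList_encList]
  refine List.ext_getElem (by simp) fun i h₁ h₂ => ?_
  simp [encVar, encFin]

end Dat

/-! ### The program for QBDD -/

/-- All small data that occur in the run have size at most `M`, and every construction of an OBDD
has at most `W` intermediate results. -/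
structure RunBound (Φ : PCNF n) (π : VarOrder n) (M W : ℕ) : Prop where
  size : ∀ m T, T.Subperm Φ.clauses → SizeBound (Φ.levels m) π (startState (Φ.levels m) T) M
  keys : ∀ m T, T.Subperm Φ.clauses →
    ((stateAut (Φ.levels m)).result π (startState (Φ.levels m) T)).2.keys.length ≤ W
  clauses : ∀ T, T.Subperm Φ.clauses → (encList encClause T).size ≤ M
  labels : ∀ l : List (Fin n), (Dat.sort (encList encFin l)).size ≤ M
  pending : ∀ m, (encList encItem (pendingFrom Φ π m)).size ≤ M
  input : (Dat.cons (encPCNF Φ) (encVarOrder π)).size ≤ M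

section Run

variable {Φ : PCNF n} {π : VarOrder n} {M W : ℕ}

theorem RunBound.buildSpec (h : RunBound Φ π M W) (c m : ℕ) {T : List (Clause n)}
    (hT : T.Subperm Φ.clauses) :
    BuildSpec c (Dat.cons (encVarOrder π) (Dat.cons (encLevels (Φ.levels m)) (encList encClause T)))
      (Dat.cons (encOBDD (elimOBDD π Φ.quant ((List.finRange n).drop m) T))
        (elimOBDD π Φ.quant ((List.finRange n).drop m) T).labelSet) ((M + 2) ^ c * (1 + W)) :=
  ⟨n, Φ.levels m, π, T, M, W, h.size m T hT, h.keys m T hT, h.clauses T hT, h.labels, rfl, rfl, rfl⟩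

theorem PCNF.levels_of_ge (Φ : PCNF n) {m : ℕ} (hm : n ≤ m) : Φ.levels m = [] := by
  rw [PCNF.levels, List.drop_eq_nil_of_le (by simpa using hm)]; rfl

theorem PCNF.levels_of_lt (Φ : PCNF n) {m : ℕ} (hm : m < n) :
    Φ.levels m = addVar ⟨m, hm⟩ (Φ.quant ⟨m, hm⟩) (Φ.levels (m + 1)) := by
  rw [PCNF.levels, drop_finRange hm]; rfl

end Run

/-- The specification of the program that constructs the OBDDs of the clauses. -/
def ClausesSpec (c : ℕ) : Spec := fun w v T =>
  ∃ (n : ℕ) (Φ : PCNF n) (π : VarOrder n) (M W : ℕ) (L : List (Clause n)),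
    RunBound Φ π M W ∧ L ⊆ Φ.clauses ∧
    w = Dat.cons (encVarOrder π) (encList encClause L) ∧
    v = encList encOBDD (L.map fun C => (Item.ofClause π Φ.quant C).obdd) ∧
    T = (M + 2) ^ c * (1 + W) * (1 + L.length)

theorem implements_clauses : ∃ c, Implements (ClausesSpec c) := by
  obtain ⟨c₁, i₁⟩ := implements_build
  obtain ⟨c, hc⟩ : PolyIn (fun M : ℕ => M) fun M => 60 + (M + 2) ^ c₁ :=
    (PolyIn.const 60).add ((PolyIn.self.add (PolyIn.const 2)).pow c₁)
  refine ⟨c, Implements.define ![_] (Fin.forall_fin_one.2 i₁)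
    (fun i self => Expr.cases (Expr.var 0).snd Expr.nil
      (Expr.cons (Expr.call (i 0) (Expr.cons (Expr.var 2).fst (Expr.cons Expr.nil
        (Expr.cons (Expr.var 0) Expr.nil)))).fst
        (Expr.call self (Expr.cons (Expr.var 2).fst (Expr.var 1))))) _ ?_⟩
  intro P i self hself hm
  have m₁ := hm 0
  rintro w v T ⟨n, Φ, π, M, W, L, h, hL, rfl, rfl, rfl⟩
  have hK : (60 + (M + 2) ^ c₁) * (1 + W) ≤ (M + 2) ^ c * (1 + W) := Nat.mul_le_mul_right _ (hc M)
  have e₅ : (60 + (M + 2) ^ c₁) * (1 + W) = 60 + 60 * W + (M + 2) ^ c₁ * (1 + W) := by ring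
  induction L with
  | nil =>
    refine (EvalLE.self hself (EvalLE.casesNil (EvalLE.snd
      (v := Dat.cons (encVarOrder π) Dat.nil) (EvalLE.var rfl)) EvalLE.nil)).mono ?_
    simp only [List.length_nil]
    omega
  | cons C L ih =>
    have f := ih fun D hD => hL (List.mem_cons_of_mem _ hD)
    have hC : [C].Subperm Φ.clauses := List.singleton_subperm_iff.2 (hL (by simp))
    -- For `m = n` no variable is eliminated, and the construction yields the OBDD of the clause
    -- itself.
    have g := m₁ _ _ _ (h.buildSpec c₁ n hC)
    rw [Φ.levels_of_ge le_rfl, List.drop_eq_nil_of_le (by simp)] at g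
    refine (EvalLE.self hself (EvalLE.casesCons (EvalLE.snd
      (v := Dat.cons (encVarOrder π) (encList encClause (C :: L))) (EvalLE.var rfl))
      (EvalLE.cons (EvalLE.fst (EvalLE.call (EvalLE.cons (EvalLE.fst
        (v := Dat.cons (encVarOrder π) (encList encClause (C :: L))) (EvalLE.var rfl))
        (EvalLE.cons EvalLE.nil (EvalLE.cons (EvalLE.var rfl) EvalLE.nil))) g))
        (EvalLE.call (EvalLE.cons (EvalLE.fst
        (v := Dat.cons (encVarOrder π) (encList encClause (C :: L))) (EvalLE.var rfl))
        (EvalLE.var rfl)) f)))).mono ?_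
    simp only [List.length_cons]
    have e₆ : (M + 2) ^ c * (1 + W) * (1 + (L.length + 1)) =
      (M + 2) ^ c * (1 + W) * (1 + L.length) + (M + 2) ^ c * (1 + W) := by ring
    rw [e₆]
    generalize (M + 2) ^ c * (1 + W) * (1 + L.length) = X at *
    omega

/-- The specification of the program that eliminates the variables. -/
def LoopSpec (c : ℕ) : Spec := fun w v T =>
  ∃ (n : ℕ) (Φ : PCNF n) (π : VarOrder n) (M W m : ℕ),
    RunBound Φ π M W ∧
    w = Dat.cons (encList (encVar Φ.quant) ((List.finRange n).drop m))
      (Dat.cons (encVarOrder π) (encList encItem (pendingFrom Φ π n))) ∧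
    v = Dat.cons (encList encItem (pendingFrom Φ π m)) (Dat.cons (encLevels (Φ.levels m))
      (Dat.cons (encList encOBDD (((List.finRange n).drop m).map (qbddTrace Φ π).conj))
        (encList encOBDD (((List.finRange n).drop m).map (qbddTrace Φ π).elim)))) ∧
    T = (M + 2) ^ c * (1 + W) * (1 + (n - m))

/-- The recursion descends to the end of the prefix, and the variables are eliminated on the way
back, from the inside out. The same bucket of clauses is used twice: with the levels before the
variable is added for the conjunction, and with the levels afterwards for the elimination. -/
theorem implements_loop : ∃ c, Implements (LoopSpec c) := by
  obtain ⟨c₁, i₁⟩ := implements_build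
  obtain ⟨c₂, -, i₂⟩ := (show PolyTime fun w => Dat.bucketClauses w.fst w.snd by fun_prop).bound
  obtain ⟨c₃, -, i₃⟩ := (show PolyTime fun w => Dat.otherItems w.fst w.snd by fun_prop).bound
  obtain ⟨c₄, -, i₄⟩ := (show PolyTime fun w => Dat.addLevel w.fst.fst w.fst.snd w.snd
    by fun_prop).bound
  obtain ⟨c, hc⟩ : PolyIn (fun M : ℕ => M) fun M => 150 + (2 * M + 10) ^ c₂ + (2 * M + 10) ^ c₃ +
      (2 * M + 10) ^ c₄ + 2 * (M + 2) ^ c₁ := by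
    have hp : ∀ c, PolyIn (fun M : ℕ => M) fun M => (2 * M + 10) ^ c := fun c =>
      (((PolyIn.const 2).mul PolyIn.self).add (PolyIn.const 10)).pow c
    exact (((((PolyIn.const 150).add (hp c₂)).add (hp c₃)).add (hp c₄)).add
      ((PolyIn.const 2).mul ((PolyIn.self.add (PolyIn.const 2)).pow c₁)))
  refine ⟨c, Implements.define ![_, _, _, _] (Fin.forall_fin_succ.2 ⟨i₁, Fin.forall_fin_succ.2
    ⟨i₂, Fin.forall_fin_two.2 ⟨i₃, i₄⟩⟩⟩)
    (fun i self => Expr.cases (Expr.var 0).fst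
      (Expr.cons (Expr.var 0).snd.snd (Expr.cons Expr.nil (Expr.cons Expr.nil Expr.nil)))
      (Expr.bind (Expr.call self (Expr.cons (Expr.var 1) (Expr.var 2).snd))
        (Expr.bind (Expr.call (i 1) (Expr.cons (Expr.var 1).fst (Expr.var 0).fst))
          (Expr.bind (Expr.call (i 0) (Expr.cons (Expr.var 4).snd.fst
              (Expr.cons (Expr.var 1).snd.fst (Expr.var 0))))
            (Expr.bind (Expr.call (i 3) (Expr.cons (Expr.var 3) (Expr.var 2).snd.fst))
              (Expr.bind (Expr.call (i 0) (Expr.cons (Expr.var 6).snd.fst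
                  (Expr.cons (Expr.var 0) (Expr.var 2))))
                (Expr.cons (Expr.cons (Expr.cons (Expr.var 3) (Expr.var 0).snd)
                    (Expr.call (i 2) (Expr.cons (Expr.var 5).fst (Expr.var 4).fst)))
                  (Expr.cons (Expr.var 1) (Expr.cons
                    (Expr.cons (Expr.var 2).fst (Expr.var 4).snd.snd.fst)
                    (Expr.cons (Expr.var 0).fst (Expr.var 4).snd.snd.snd)))))))))) _ ?_⟩
  intro P i self hself hm
  have m₁ := hm 0
  have m₂ := hm 1
  have m₃ := hm 2
  have m₄ := hm 3
  rintro w v T ⟨n, Φ, π, M, W, m, h, hw, hv, rfl⟩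
  have hK : (150 + (2 * M + 10) ^ c₂ + (2 * M + 10) ^ c₃ + (2 * M + 10) ^ c₄ +
    2 * (M + 2) ^ c₁) * (1 + W) ≤ (M + 2) ^ c * (1 + W) := Nat.mul_le_mul_right _ (hc M)
  have e₅ : (150 + (2 * M + 10) ^ c₂ + (2 * M + 10) ^ c₃ + (2 * M + 10) ^ c₄ +
    2 * (M + 2) ^ c₁) * (1 + W) = 150 + (2 * M + 10) ^ c₂ + (2 * M + 10) ^ c₃ +
      (2 * M + 10) ^ c₄ + (150 + (2 * M + 10) ^ c₂ + (2 * M + 10) ^ c₃ + (2 * M + 10) ^ c₄) * W +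
      2 * ((M + 2) ^ c₁ * (1 + W)) := by ring
  rw [e₅] at hK
  generalize (150 + (2 * M + 10) ^ c₂ + (2 * M + 10) ^ c₃ + (2 * M + 10) ^ c₄) * W = Y at hK
  obtain ⟨d, hd⟩ : ∃ d, n - m = d := ⟨_, rfl⟩
  induction d generalizing m w v with
  | zero =>
    have hwfst : w.fst = Dat.nil := by
      rw [hw, List.drop_eq_nil_of_le (by simp; omega)]; rfl
    have hhead : EvalLE P [w] (Expr.var 0).fst Dat.nil (1 + 1 + 1) := by
      rw [← hwfst]; exact (EvalLE.var rfl).fst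
    have hout : v = Dat.cons w.snd.snd (Dat.cons Dat.nil (Dat.cons Dat.nil Dat.nil)) := by
      rw [hv, hw, List.drop_eq_nil_of_le (by simp; omega), Φ.levels_of_ge (by omega),
        pendingFrom_of_ge Φ π (m := m) (by omega), pendingFrom_of_ge Φ π le_rfl]
      rfl
    rw [hout]
    refine (EvalLE.self hself (EvalLE.casesNil hhead (EvalLE.cons
      (EvalLE.var (v := w) rfl).snd.snd (EvalLE.cons EvalLE.nil (EvalLE.cons EvalLE.nil
        EvalLE.nil))))).mono ?_
    rw [hd]
    omega
  | succ d ih =>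
    have hmn : m < n := by omega
    set x : Fin n := ⟨m, hmn⟩ with hx
    set V := encList (encVar Φ.quant) ((List.finRange n).drop (m + 1)) with hV
    have hwfst : w.fst = Dat.cons (encVar Φ.quant x) V := by rw [hw, drop_finRange hmn]; rfl
    have hwsnd : w.snd = Dat.cons (encVarOrder π) (encList encItem (pendingFrom Φ π n)) := by
      rw [hw]; rfl
    have hhead : EvalLE P [w] (Expr.var 0).fst (Dat.cons (encVar Φ.quant x) V) (1 + 1 + 1) := by
      rw [← hwfst]; exact (EvalLE.var rfl).fst
    set acc := Dat.cons (encList encItem (pendingFrom Φ π (m + 1)))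
      (Dat.cons (encLevels (Φ.levels (m + 1)))
      (Dat.cons (encList encOBDD (((List.finRange n).drop (m + 1)).map (qbddTrace Φ π).conj))
        (encList encOBDD (((List.finRange n).drop (m + 1)).map (qbddTrace Φ π).elim)))) with hacc
    have f := ih (Dat.cons V w.snd) acc (m + 1) (by rw [hwsnd]) rfl (by omega)
    have hsub := bucketAt_subperm Φ π x
    have s₁ : (encVar Φ.quant x).size ≤ M + 2 := by
      have h₁ := h.labels [x]
      have h₂ : (Dat.sort (encList encFin [x])).size = (encFin x).size + 1 + 1 := rfl
      have h₃ : (encQuantifier (Φ.quant x)).size ≤ 3 := by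
        cases Φ.quant x
        exacts [Dat.size_encBool_le false, Dat.size_encBool_le true]
      simp only [encVar, Dat.size_cons]
      omega
    have s₂ := h.pending (m + 1)
    have s₃ : (encLevels (Φ.levels (m + 1))).size ≤ M := by
      have := (h.size (m + 1) [] (List.nil_subperm)).state (orderList π) _
        ⟨[], fun _ => false, rfl, rfl⟩
      omega
    have g₂ := m₂ (Dat.cons (encVar Φ.quant x).fst acc.fst) _ _ ⟨rfl, rfl⟩
    have g₃ := m₃ (Dat.cons (encVar Φ.quant x).fst acc.fst) _ _ ⟨rfl, rfl⟩
    have g₄ := m₄ (Dat.cons (encVar Φ.quant x) acc.snd.fst) _ _ ⟨rfl, rfl⟩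
    have o₂ : Dat.bucketClauses (Dat.cons (encVar Φ.quant x).fst acc.fst).fst
        (Dat.cons (encVar Φ.quant x).fst acc.fst).snd = encList encClause (bucketAt Φ π x) :=
      Dat.bucketClauses_encList x _
    have o₃ : Dat.otherItems (Dat.cons (encVar Φ.quant x).fst acc.fst).fst
        (Dat.cons (encVar Φ.quant x).fst acc.fst).snd = encList encItem
          ((pendingFrom Φ π (m + 1)).filter fun it => ¬ it.Contains x) :=
      Dat.otherItems_encList x _
    have o₄ : Dat.addLevel (Dat.cons (encVar Φ.quant x) acc.snd.fst).fst.fst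
        (Dat.cons (encVar Φ.quant x) acc.snd.fst).fst.snd
        (Dat.cons (encVar Φ.quant x) acc.snd.fst).snd = encLevels (Φ.levels m) := by
      rw [Φ.levels_of_lt hmn, encLevels_addVar]; rfl
    rw [o₂] at g₂
    rw [o₃] at g₃
    rw [o₄] at g₄
    have g₅ := m₁ _ _ _ (h.buildSpec c₁ (m + 1) hsub)
    have g₆ := m₁ _ _ _ (h.buildSpec c₁ m hsub)
    set conj := elimOBDD π Φ.quant ((List.finRange n).drop (m + 1)) (bucketAt Φ π x) with hconj
    set elim := elimOBDD π Φ.quant ((List.finRange n).drop m) (bucketAt Φ π x) with helim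
    have hout : v = Dat.cons (Dat.cons (Dat.cons (encList encClause (bucketAt Φ π x)) elim.labelSet)
        (encList encItem ((pendingFrom Φ π (m + 1)).filter fun it => ¬ it.Contains x)))
        (Dat.cons (encLevels (Φ.levels m)) (Dat.cons
          (Dat.cons (encOBDD conj) acc.snd.snd.fst)
          (Dat.cons (encOBDD elim) acc.snd.snd.snd))) := by
      rw [hv, pendingFrom_of_lt Φ π hmn, drop_finRange hmn]
      rfl
    rw [hout]
    have b₂ : ((Dat.cons (encVar Φ.quant x).fst acc.fst).size + 2) ^ c₂ ≤ (2 * M + 10) ^ c₂ := by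
      refine Nat.pow_le_pow_left ?_ _
      have := (encVar Φ.quant x).size_fst_le
      have e : acc.fst = encList encItem (pendingFrom Φ π (m + 1)) := rfl
      simp only [Dat.size_cons, e]
      omega
    have b₃ : ((Dat.cons (encVar Φ.quant x).fst acc.fst).size + 2) ^ c₃ ≤ (2 * M + 10) ^ c₃ := by
      refine Nat.pow_le_pow_left ?_ _
      have := (encVar Φ.quant x).size_fst_le
      have e : acc.fst = encList encItem (pendingFrom Φ π (m + 1)) := rfl
      simp only [Dat.size_cons, e]
      omega
    have b₄ : ((Dat.cons (encVar Φ.quant x) acc.snd.fst).size + 2) ^ c₄ ≤ (2 * M + 10) ^ c₄ := by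
      refine Nat.pow_le_pow_left ?_ _
      have e : acc.snd.fst = encLevels (Φ.levels (m + 1)) := rfl
      simp only [Dat.size_cons, e]
      omega
    have hord : w.snd.fst = encVarOrder π := by rw [hwsnd]; rfl
    have hvar : ∀ env j, env[j]? = some w →
        EvalLE P env (Expr.var j).snd.fst (encVarOrder π) (1 + 1 + 1 + 1 + 1) := fun env j hj => by
      rw [← hord]; exact (EvalLE.var hj).snd.fst
    refine (EvalLE.self hself (EvalLE.casesCons hhead
      (EvalLE.bind (EvalLE.call (EvalLE.cons (EvalLE.var rfl) (EvalLE.var (v := w) rfl).snd) f)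
      (EvalLE.bind (EvalLE.call (EvalLE.cons (EvalLE.fst (v := encVar Φ.quant x) (EvalLE.var rfl))
        (EvalLE.fst (v := acc) (EvalLE.var rfl))) g₂)
      (EvalLE.bind (EvalLE.call (EvalLE.cons (hvar _ _ rfl) (EvalLE.cons
        (EvalLE.fst (EvalLE.snd (v := acc) (EvalLE.var rfl))) (EvalLE.var rfl))) g₅)
      (EvalLE.bind (EvalLE.call (EvalLE.cons (EvalLE.var (v := encVar Φ.quant x) rfl)
        (EvalLE.fst (EvalLE.snd (v := acc) (EvalLE.var rfl)))) g₄)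
      (EvalLE.bind (EvalLE.call (EvalLE.cons (hvar _ _ rfl) (EvalLE.cons
        (EvalLE.var rfl) (EvalLE.var rfl))) g₆)
      (EvalLE.cons (EvalLE.cons (EvalLE.cons (EvalLE.var rfl) (EvalLE.snd
          (v := Dat.cons (encOBDD elim) elim.labelSet) (EvalLE.var rfl)))
        (EvalLE.call (EvalLE.cons (EvalLE.fst (v := encVar Φ.quant x) (EvalLE.var rfl))
          (EvalLE.fst (v := acc) (EvalLE.var rfl))) g₃))
        (EvalLE.cons (EvalLE.var rfl) (EvalLE.cons (EvalLE.cons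
          (EvalLE.fst (v := Dat.cons (encOBDD conj) conj.labelSet) (EvalLE.var rfl))
          (EvalLE.fst (EvalLE.snd (EvalLE.snd (v := acc) (EvalLE.var rfl)))))
          (EvalLE.cons
          (EvalLE.fst (v := Dat.cons (encOBDD elim) elim.labelSet) (EvalLE.var rfl))
          (EvalLE.snd (EvalLE.snd (EvalLE.snd (v := acc) (EvalLE.var rfl))))))))))))))).mono ?_
    have hd' : n - (m + 1) = d := by omega
    rw [hd, hd']
    have e₆ : (M + 2) ^ c * (1 + W) * (1 + (d + 1)) =
      (M + 2) ^ c * (1 + W) * (1 + d) + (M + 2) ^ c * (1 + W) := by ring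
    rw [e₆]
    generalize (M + 2) ^ c * (1 + W) * (1 + d) = X at *
    omega

/-- The program for QBDD. -/
theorem exists_program : ∃ (P : Program) (c : ℕ), ∀ (n : ℕ) (Φ : PCNF n) (π : VarOrder n) (M W : ℕ),
    RunBound Φ π M W → ∃ t ≤ (M + 2) ^ c * (1 + W),
      P.Runs (Dat.cons (encPCNF Φ) (encVarOrder π)) (encTrace (qbddTrace Φ π)) t := by
  obtain ⟨c₁, i₁⟩ := implements_build
  obtain ⟨c₂, i₂⟩ := implements_clauses
  obtain ⟨c₃, i₃⟩ := implements_loop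
  obtain ⟨c₄, -, i₄⟩ := (show PolyTime fun w => Dat.prefixVars w.fst.fst by
    unfold Dat.prefixVars; fun_prop).bound
  obtain ⟨c₅, -, i₅⟩ := (show PolyTime fun w => Dat.clauseItems w.fst.snd by fun_prop).bound
  obtain ⟨c₆, -, i₆⟩ := (show PolyTime fun w => Dat.allClauses w by fun_prop).bound
  obtain ⟨c, hc⟩ : PolyIn (fun M : ℕ => M) fun M => 100 + (M + 2) ^ c₁ +
      (M + 2) ^ c₂ * (1 + M) + (M + 2) ^ c₃ * (1 + M) + (M + 2) ^ c₄ + (M + 2) ^ c₅ +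
      (M + 2) ^ c₆ := by
    have hp : ∀ c, PolyIn (fun M : ℕ => M) fun M => (M + 2) ^ c := fun c =>
      (PolyIn.self.add (PolyIn.const 2)).pow c
    have hq : ∀ c, PolyIn (fun M : ℕ => M) fun M => (M + 2) ^ c * (1 + M) := fun c =>
      (hp c).mul ((PolyIn.const 1).add PolyIn.self)
    exact (((((((PolyIn.const 100).add (hp c₁)).add (hq c₂)).add (hq c₃)).add (hp c₄)).add
      (hp c₅)).add (hp c₆))
  let S : Spec := fun w v T => ∃ (n : ℕ) (Φ : PCNF n) (π : VarOrder n) (M W : ℕ),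
    RunBound Φ π M W ∧ w = Dat.cons (encPCNF Φ) (encVarOrder π) ∧
    v = encTrace (qbddTrace Φ π) ∧ T = (M + 2) ^ c * (1 + W)
  have i : Implements S := by
    refine Implements.define ![_, _, _, _, _, _] (Fin.forall_fin_succ.2 ⟨i₁, Fin.forall_fin_succ.2
      ⟨i₂, Fin.forall_fin_succ.2 ⟨i₃, Fin.forall_fin_succ.2 ⟨i₄, Fin.forall_fin_two.2
      ⟨i₅, i₆⟩⟩⟩⟩⟩)
      (fun i _ => Expr.bind (Expr.call (i 3) (Expr.var 0))
        (Expr.bind (Expr.call (i 4) (Expr.var 1))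
          (Expr.bind (Expr.call (i 2) (Expr.cons (Expr.var 1)
              (Expr.cons (Expr.var 2).snd (Expr.var 0))))
            (Expr.bind (Expr.call (i 0) (Expr.cons (Expr.var 3).snd
                (Expr.cons (Expr.var 0).snd.fst (Expr.call (i 5) (Expr.var 0).fst))))
              (Expr.cons (Expr.call (i 1) (Expr.cons (Expr.var 4).snd (Expr.var 4).fst.snd))
                (Expr.cons (Expr.var 1).snd.snd.fst
                  (Expr.cons (Expr.var 1).snd.snd.snd (Expr.var 0).fst))))))) _ ?_
    intro P i self hself hm
    have m₁ := hm 0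
    have m₂ := hm 1
    have m₃ := hm 2
    have m₄ := hm 3
    have m₅ := hm 4
    have m₆ := hm 5
    rintro w v T ⟨n, Φ, π, M, W, h, rfl, rfl, rfl⟩
    have hin := h.input
    have hsz : (encPCNF Φ).size + (encVarOrder π).size + 1 ≤ M := hin
    have hcl : Φ.clauses.length ≤ M := by
      have h₁ := length_le_size_encList encClause Φ.clauses
      have h₂ : (encPCNF Φ).size = (encList encQuantifier (List.ofFn Φ.quant)).size +
        (encList encClause Φ.clauses).size + 1 := rfl
      omega
    have hn : n ≤ M := by
      have h₁ := length_le_size_encList encFin (List.ofFn fun i => π.symm i)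
      have h₂ : (encVarOrder π).size = (encList encFin (List.ofFn fun i => π.symm i)).size := rfl
      rw [List.length_ofFn] at h₁
      omega
    have g₄ := m₄ (Dat.cons (encPCNF Φ) (encVarOrder π)) _ _ ⟨rfl, rfl⟩
    have g₅ := m₅ (Dat.cons (encPCNF Φ) (encVarOrder π)) _ _ ⟨rfl, rfl⟩
    have o₄ : Dat.prefixVars (Dat.cons (encPCNF Φ) (encVarOrder π)).fst.fst =
        encList (encVar Φ.quant) ((List.finRange n).drop 0) := Dat.prefixVars_ofFn Φ.quant
    have o₅ : Dat.clauseItems (Dat.cons (encPCNF Φ) (encVarOrder π)).fst.snd =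
        encList encItem (pendingFrom Φ π n) := by
      rw [pendingFrom_of_ge Φ π le_rfl]
      exact Dat.clauseItems_encList π Φ.quant Φ.clauses
    rw [o₄] at g₄
    rw [o₅] at g₅
    have g₃ := m₃ _ _ _ ⟨n, Φ, π, M, W, 0, h, rfl, rfl, rfl⟩
    set L := Dat.cons (encList encItem (pendingFrom Φ π 0)) (Dat.cons (encLevels (Φ.levels 0))
      (Dat.cons (encList encOBDD (((List.finRange n).drop 0).map (qbddTrace Φ π).conj))
        (encList encOBDD (((List.finRange n).drop 0).map (qbddTrace Φ π).elim)))) with hL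
    have g₆ := m₆ (encList encItem (pendingFrom Φ π 0)) _ _ ⟨rfl, rfl⟩
    rw [Dat.allClauses_encList] at g₆
    have g₁ := m₁ _ _ _ (h.buildSpec c₁ 0 (flatMap_pendingFrom Φ π 0).subperm)
    have g₂ := m₂ _ _ _ ⟨n, Φ, π, M, W, Φ.clauses, h, fun _ h => h, rfl, rfl, rfl⟩
    set R := elimOBDD π Φ.quant ((List.finRange n).drop 0)
      ((pendingFrom Φ π 0).flatMap Item.clauses) with hR
    have hout : encTrace (qbddTrace Φ π) = Dat.cons
        (encList encOBDD (Φ.clauses.map fun C => (Item.ofClause π Φ.quant C).obdd))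
        (Dat.cons L.snd.snd.fst (Dat.cons L.snd.snd.snd (encOBDD R))) := by
      rw [encTrace, List.ofFn_eq_map, List.ofFn_eq_map]
      rfl
    rw [hout]
    have b₄ := Nat.pow_le_pow_left (Nat.add_le_add_right hin 2) c₄
    have b₅ := Nat.pow_le_pow_left (Nat.add_le_add_right hin 2) c₅
    have b₆ := Nat.pow_le_pow_left (Nat.add_le_add_right (h.pending 0) 2) c₆
    refine EvalLE.mono (EvalLE.self hself (EvalLE.bind (EvalLE.call (EvalLE.var rfl) g₄)
      (EvalLE.bind (EvalLE.call (EvalLE.var rfl) g₅)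
      (EvalLE.bind (EvalLE.call (EvalLE.cons (EvalLE.var rfl) (EvalLE.cons (EvalLE.snd
        (v := Dat.cons (encPCNF Φ) (encVarOrder π)) (EvalLE.var rfl)) (EvalLE.var rfl))) g₃)
      (EvalLE.bind (EvalLE.call (EvalLE.cons (EvalLE.snd
        (v := Dat.cons (encPCNF Φ) (encVarOrder π)) (EvalLE.var rfl)) (EvalLE.cons (EvalLE.fst
        (EvalLE.snd (v := L) (EvalLE.var rfl))) (EvalLE.call (EvalLE.fst (v := L)
        (EvalLE.var rfl)) g₆))) g₁)
      (EvalLE.cons (EvalLE.call (EvalLE.cons (EvalLE.snd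
        (v := Dat.cons (encPCNF Φ) (encVarOrder π)) (EvalLE.var rfl)) (EvalLE.snd (EvalLE.fst
        (v := Dat.cons (encPCNF Φ) (encVarOrder π)) (EvalLE.var rfl)))) g₂)
      (EvalLE.cons (EvalLE.fst (EvalLE.snd (EvalLE.snd (v := L) (EvalLE.var rfl))))
      (EvalLE.cons (EvalLE.snd (EvalLE.snd (EvalLE.snd (v := L) (EvalLE.var rfl))))
      (EvalLE.fst (v := Dat.cons (encOBDD R) R.labelSet) (EvalLE.var rfl)))))))))) ?_
    refine le_trans ?_ (Nat.mul_le_mul_right (1 + W) (hc M))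
    have k₂ : (M + 2) ^ c₂ * (1 + W) * (1 + Φ.clauses.length) ≤
      (M + 2) ^ c₂ * (1 + W) * (1 + M) := Nat.mul_le_mul_left _ (by omega)
    have k₃ : (M + 2) ^ c₃ * (1 + W) * (1 + (n - 0)) ≤ (M + 2) ^ c₃ * (1 + W) * (1 + M) :=
      Nat.mul_le_mul_left _ (by omega)
    have e : (100 + (M + 2) ^ c₁ + (M + 2) ^ c₂ * (1 + M) + (M + 2) ^ c₃ * (1 + M) +
        (M + 2) ^ c₄ + (M + 2) ^ c₅ + (M + 2) ^ c₆) * (1 + W) =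
      100 + (M + 2) ^ c₄ + (M + 2) ^ c₅ + (M + 2) ^ c₆ + (100 + (M + 2) ^ c₄ +
        (M + 2) ^ c₅ + (M + 2) ^ c₆) * W + (M + 2) ^ c₁ * (1 + W) +
        (M + 2) ^ c₂ * (1 + W) * (1 + M) + (M + 2) ^ c₃ * (1 + W) * (1 + M) := by ring
    rw [e]
    omega
  obtain ⟨P, hP⟩ := i.run
  exact ⟨P, c, fun n Φ π M W h => hP _ _ _ ⟨n, Φ, π, M, W, h, rfl, rfl, rfl⟩⟩

/-! ### Sizes of the encodings -/

theorem size_encNat_le {m b : ℕ} (h : m < 2 ^ b) : (encNat m).size ≤ 4 * b + 1 := by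
  have h₁ : m.bits.length ≤ b := by
    rw [Nat.size_eq_bits_len]; exact Nat.size_le.2 h
  have h₂ := Dat.size_encList_le (f := encBool) (l := m.bits) (m := 3)
    fun x _ => Dat.size_encBool_le x
  exact h₂.trans (by omega)

/-- The crude bound of `n` bits is enough, as only polynomial dependence on the size of the formula
matters. -/
theorem size_encFin_le (x : Fin n) : (encFin x).size ≤ 4 * n + 1 :=
  size_encNat_le (x.isLt.trans Nat.lt_two_pow_self)

theorem size_encQuantifier_le (Q : Quantifier) : (encQuantifier Q).size ≤ 3 := by
  cases Q
  exacts [Dat.size_encBool_le false, Dat.size_encBool_le true]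

theorem size_encList_encFin_le {l : List (Fin n)} (h : l.Nodup) :
    (encList encFin l).size ≤ n * (4 * n + 2) + 1 := by
  have hl : l.length ≤ n := by simpa using h.length_le_card
  refine (Dat.size_encList_le (m := 4 * n + 1) fun x _ => size_encFin_le x).trans ?_
  exact Nat.succ_le_succ (Nat.mul_le_mul_right _ hl)

theorem size_sort_encList_encFin_le (l : List (Fin n)) :
    (Dat.sort (encList encFin l)).size ≤ n * (4 * n + 2) + 1 := by
  set s := Dat.sort (encList encFin l) with hs
  have hmem : ∀ d ∈ s.toList, ∃ x : Fin n, d = encFin x := fun d hd => by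
    rw [hs, Dat.mem_sort, Dat.toList_encList, List.mem_map] at hd
    obtain ⟨x, -, rfl⟩ := hd
    exact ⟨x, rfl⟩
  have hnd : s.toList.Nodup := (Dat.sort_sorted _).imp fun {a b} hab he => by
    subst he; simp [Dat.lt_irrefl] at hab
  have hsub : s.toList ⊆ (List.finRange n).map encFin := fun d hd => by
    obtain ⟨x, rfl⟩ := hmem d hd
    exact List.mem_map_of_mem (List.mem_finRange x)
  have hlen : s.toList.length ≤ n := by
    simpa using (List.subperm_of_subset hnd hsub).length_le
  have e : s = encList (fun d => d) s.toList := Dat.toList_injective (by simp [Dat.toList_encList])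
  rw [e]
  refine (Dat.size_encList_le (m := 4 * n + 1) fun d hd => ?_).trans
    (Nat.succ_le_succ (Nat.mul_le_mul_right _ hlen))
  obtain ⟨x, rfl⟩ := hmem d hd
  exact size_encFin_le x

theorem OBDD.size_labelSet_le (B : OBDD n) : B.labelSet.size ≤ n * (4 * n + 2) + 1 := by
  have e : encList (fun v => encFin (B.label v)) (List.finRange B.numNodes) =
      encList encFin ((List.finRange B.numNodes).map B.label) :=
    Dat.toList_injective (by simp [Dat.toList_encList])
  rw [OBDD.labelSet, e]
  exact size_sort_encList_encFin_le _

theorem size_encLevels_levelsOf_le (quant : Fin n → Quantifier) (xs : List (Fin n)) :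
    (encLevels (levelsOf quant xs)).size ≤ xs.length * (4 * n + 8) + 1 := by
  induction xs with
  | nil => simp [levelsOf, encLevels, encList]
  | cons x xs ih =>
    have hstep : ∀ ls : Levels n, (encLevels (addVar x (quant x) ls)).size ≤
        (encLevels ls).size + (4 * n + 8) := by
      intro ls
      have h₁ := size_encFin_le x
      have h₂ := size_encQuantifier_le (quant x)
      rcases ls with _ | ⟨⟨Q, X⟩, ls⟩
      · simp only [addVar, encLevels, encList, Dat.size_cons, Dat.size_nil]; omega
      · rw [addVar]
        split_ifs <;> simp only [encLevels, encList, Dat.size_cons, Dat.size_nil] <;> omega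
    have e : levelsOf quant (x :: xs) = addVar x (quant x) (levelsOf quant xs) := rfl
    rw [e, List.length_cons, Nat.succ_mul]
    exact (hstep _).trans (by omega)

theorem size_encLevels_le (Φ : PCNF n) (m : ℕ) :
    (encLevels (Φ.levels m)).size ≤ n * (4 * n + 8) + 1 := by
  refine (size_encLevels_levelsOf_le _ _).trans
    (Nat.succ_le_succ (Nat.mul_le_mul_right _ ?_))
  rw [List.length_drop, List.length_finRange]
  omega

theorem length_clause_le_size {Φ : PCNF n} {C : Clause n} (hC : C ∈ Φ.clauses) :
    C.length ≤ Φ.size := by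
  have := List.single_le_sum (l := Φ.clauses.map fun C => C.length + 1) (by simp) (C.length + 1)
    (List.mem_map_of_mem (f := fun C : Clause n => C.length + 1) hC)
  rw [PCNF.size]
  omega

theorem size_encClause_le {Φ : PCNF n} {C : Clause n} (hC : C ∈ Φ.clauses) :
    (encClause C).size ≤ Φ.size * (4 * Φ.size + 6) + 1 := by
  have hn := (length_le_size Φ).2
  refine (Dat.size_encList_le (m := 4 * Φ.size + 5) fun l _ => ?_).trans
    (Nat.succ_le_succ (Nat.mul_le_mul_right _ (length_clause_le_size hC)))
  have h₁ := size_encFin_le l.1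
  have h₂ := Dat.size_encBool_le l.2
  rw [encLiteral, Dat.size_cons]
  omega

theorem size_encList_encClause_le {Φ : PCNF n} {T : List (Clause n)} (hT : T.Subperm Φ.clauses) :
    (encList encClause T).size ≤ Φ.size * (Φ.size * (4 * Φ.size + 6) + 2) + 1 :=
  (Dat.size_encList_le fun _ hC => size_encClause_le (hT.subset hC)).trans
    (Nat.succ_le_succ (Nat.mul_le_mul_right _ (hT.length_le.trans (length_le_size Φ).1)))

theorem length_pendingFrom_le (Φ : PCNF n) (π : VarOrder n) (m : ℕ) :
    (pendingFrom Φ π m).length ≤ n + Φ.clauses.length := by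
  have key : ∀ xs, (pending Φ π xs).length ≤ xs.length + Φ.clauses.length := by
    intro xs
    induction xs with
    | nil => simp [pending]
    | cons x xs ih =>
      have := List.length_filter_le (fun it => ¬ it.Contains x) (pending Φ π xs)
      simp only [pending, List.length_cons]
      omega
  refine (key _).trans ?_
  rw [List.length_drop, List.length_finRange]
  omega

theorem size_vars_pendingFrom_le (Φ : PCNF n) (π : VarOrder n) (m : ℕ) {it : Item n}
    (h : it ∈ pendingFrom Φ π m) : it.vars.size ≤ Φ.size * (4 * Φ.size + 2) + 1 := by
  have hn := (length_le_size Φ).2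
  have key : ∀ xs, ∀ it ∈ pending Φ π xs, it.vars.size ≤ Φ.size * (4 * Φ.size + 2) + 1 := by
    intro xs
    induction xs with
    | nil =>
      intro it hit
      obtain ⟨C, hC, rfl⟩ := List.mem_map.1 hit
      refine (Dat.size_encList_le (m := 4 * Φ.size + 1) fun l _ =>
        (size_encFin_le _).trans (by omega)).trans ?_
      exact Nat.succ_le_succ (Nat.mul_le_mul_right _ (length_clause_le_size hC))
    | cons x xs ih =>
      intro it hit
      rcases List.mem_cons.1 hit with rfl | hit
      · exact (OBDD.size_labelSet_le _).trans
          (Nat.succ_le_succ (Nat.mul_le_mul hn (by omega : 4 * n + 2 ≤ 4 * Φ.size + 2)))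
      · exact ih it (List.mem_filter.1 hit).1
  exact key _ it h

theorem size_pendingFrom_le (Φ : PCNF n) (π : VarOrder n) (m : ℕ) :
    (encList encItem (pendingFrom Φ π m)).size ≤
      (2 * Φ.size) * (Φ.size * (Φ.size * (4 * Φ.size + 6) + 2) + Φ.size * (4 * Φ.size + 2) + 4) +
        1 := by
  have h := length_le_size Φ
  refine (Dat.size_encList_le fun it hit => ?_).trans (Nat.succ_le_succ (Nat.mul_le_mul_right _
    ((length_pendingFrom_le Φ π m).trans (by omega))))
  have h₁ := size_vars_pendingFrom_le Φ π m hit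
  have h₂ : it.clauses.Subperm Φ.clauses := by
    refine List.Subperm.trans ?_ (flatMap_pendingFrom Φ π m).subperm
    rw [List.flatMap]
    exact (List.sublist_flatten_of_mem (List.mem_map_of_mem hit)).subperm
  have h₃ := size_encList_encClause_le h₂
  rw [encItem, Dat.size_cons]
  omega

theorem size_input_le (Φ : PCNF n) (π : VarOrder n) :
    (Dat.cons (encPCNF Φ) (encVarOrder π)).size ≤
      Φ.size * 4 + Φ.size * (Φ.size * (4 * Φ.size + 6) + 2) + Φ.size * (4 * Φ.size + 2) + 5 := by
  have hn := (length_le_size Φ).2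
  have h₁ : (encList encQuantifier (List.ofFn Φ.quant)).size ≤ n * 4 + 1 := by
    simpa using Dat.size_encList_le (f := encQuantifier) (l := List.ofFn Φ.quant) (m := 3)
      fun Q _ => size_encQuantifier_le Q
  have h₂ := size_encList_encClause_le (List.Subperm.refl Φ.clauses)
  have h₃ : (encVarOrder π).size ≤ n * (4 * n + 2) + 1 :=
    size_encList_encFin_le (List.nodup_ofFn.2 π.symm.injective)
  have h₄ : n * (4 * n + 2) ≤ Φ.size * (4 * Φ.size + 2) := Nat.mul_le_mul hn (by omega)
  simp only [Dat.size_cons, encPCNF]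
  omega

/-! ### Bounds for the run -/

/-- A bound for the sizes of the data besides the states. -/
def dataBound (N : ℕ) : ℕ := 40 * (N + 1) ^ 4

theorem dataBound_eq (N : ℕ) : dataBound N =
    40 * (N * (N * (N * N))) + 160 * (N * (N * N)) + 240 * (N * N) + 160 * N + 40 := by
  rw [dataBound]; ring

theorem size_startState_le (Φ : PCNF n) (m : ℕ) {T : List (Clause n)} (hT : T.Subperm Φ.clauses) :
    (startState (Φ.levels m) T).size ≤ dataBound Φ.size := by
  have hn := (length_le_size Φ).2
  have h₁ := size_encList_encClause_le hT
  have h₂ := size_encLevels_le Φ m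
  have h₃ : n * (4 * n + 8) ≤ Φ.size * (4 * Φ.size + 8) := Nat.mul_le_mul hn (by omega)
  have h₄ := Dat.size_initState_le (encLevels (Φ.levels m)) (encList encClause T)
  rw [dataBound_eq, startState]
  ring_nf at *
  omega

theorem runBound {Φ : PCNF n} {π : VarOrder n} {S W : ℕ}
    (hS : ∀ m T, T.Subperm Φ.clauses → ∀ c a,
      ((stateAut (Φ.levels m)).run ((orderList π).take c) a (startState (Φ.levels m) T)).size ≤ S)
    (hW : ∀ m T, T.Subperm Φ.clauses → ∀ c,
      ((stateAut (Φ.levels m)).layer π (startState (Φ.levels m) T) c).card ≤ W) :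
    RunBound Φ π (dataBound Φ.size + S) ((n + 1) * W) := by
  have hn := (length_le_size Φ).2
  have h₁ : n * (4 * n + 2) ≤ Φ.size * (4 * Φ.size + 2) := Nat.mul_le_mul hn (by omega)
  refine ⟨fun m T hT => ⟨?_, ?_⟩, fun m T hT => Automaton.length_keys_le _ _ _ _ (hW m T hT),
    fun T hT => ?_, fun l => ?_, fun m => ?_, ?_⟩
  · rintro l s ⟨pre, a, h₂, h₃⟩
    have h₄ : pre = (orderList π).take pre.length := by rw [h₂]; simp
    have h₅ := hS m T hT pre.length a
    rw [← h₄] at h₅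
    simp only at h₃
    rw [← h₃] at h₅
    have h₆ := size_encList_encFin_le (l := l)
      ((List.nodup_append.1 (h₂ ▸ orderList_nodup π)).2.1)
    have h₇ := size_encLevels_le Φ m
    have h₈ : n * (4 * n + 8) ≤ Φ.size * (4 * Φ.size + 8) := Nat.mul_le_mul hn (by omega)
    rw [dataBound_eq]
    ring_nf at *
    omega
  -- For any order there are at most (n+1) · 2^n nodes, by the trivial bound on the layers, so node
  -- indices have O(n) bits and are bounded by `dataBound` alone.
  · intro j hj
    have h₂ := ((stateAut (Φ.levels m)).result_spec π (startState (Φ.levels m) T)).1.length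
    have h₃ := (stateAut (Φ.levels m)).length_keys_le π (startState (Φ.levels m) T) (2 ^ n)
      (card_layer_le_two_pow π _)
    have h₄ : (n + 1) * 2 ^ n ≤ 2 ^ n * 2 ^ n := Nat.mul_le_mul_right _ Nat.lt_two_pow_self
    have h₅ : j < 2 ^ (n + n + 1) := by
      have : 0 < 2 ^ n * 2 ^ n := by positivity
      rw [pow_succ, pow_add]
      omega
    have h₆ := size_encNat_le h₅
    rw [dataBound_eq]
    omega
  · have := size_encList_encClause_le hT
    rw [dataBound_eq]
    ring_nf at *
    omega
  · have := size_sort_encList_encFin_le l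
    rw [dataBound_eq]
    ring_nf at *
    omega
  · have := size_pendingFrom_le Φ π m
    rw [dataBound_eq]
    ring_nf at *
    omega
  · have := size_input_le Φ π
    rw [dataBound_eq]
    ring_nf at *
    omega

theorem size_run_startState_le (Φ : PCNF n) (π : VarOrder n) (m : ℕ) {T : List (Clause n)}
    (hT : T.Subperm Φ.clauses) (c : ℕ) (a : Assignment n) :
    ((stateAut (Φ.levels m)).run ((orderList π).take c) a (startState (Φ.levels m) T)).size ≤
      2 ^ n * dataBound Φ.size := by
  refine (size_run_le _ (fun _ _ _ => Dat.size_step_le _ _) _ _ _).trans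
    (Nat.mul_le_mul (Nat.pow_le_pow_right (by omega) ?_) (size_startState_le Φ m hT))
  have : (orderList π).length = n := by simp [orderList]
  rw [List.length_take, this]
  omega

theorem runBound_two_pow (Φ : PCNF n) (π : VarOrder n) :
    RunBound Φ π (dataBound Φ.size + 2 ^ n * dataBound Φ.size) ((n + 1) * 2 ^ n) :=
  runBound (fun m _ hT c a => size_run_startState_le Φ π m hT c a)
    fun _ _ _ c => card_layer_le_two_pow π _ c

theorem runBound_tower {Φ : PCNF n} {π : VarOrder n} {k q : ℕ} (hπ : SmallSeparators Φ π k)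
    (hq : Φ.numBlocks = q) :
    RunBound Φ π (dataBound Φ.size + 8 * dataBound Φ.size * (tower k q + 1) ^ 3)
      ((n + 1) * (2 * tower k (q + 1))) := by
  refine runBound (fun m T hT c a => ?_) fun m T hT c =>
    card_layer_le hπ hq.le hT.subset (fun _ b _ => ⟨b, rfl⟩) c
  refine (size_run_le_tower hπ hq.le hT.subset (fun _ b _ => ⟨b, rfl⟩) c a).trans
    (Nat.mul_le_mul_right _ (Nat.mul_le_mul_left _ ?_))
  have := size_encList_encClause_le hT
  rw [dataBound_eq]
  ring_nf at *
  omega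

/-! ### The running time -/

/-- The factor of the running time that is polynomial in the size of the formula. -/
def timeFactor (c N : ℕ) : ℕ :=
  (2 * dataBound N + 2) ^ c * (N + 2) +
    (dataBound N + 8 * dataBound N * ((c + 1) * (N + 1)) ^ 3 + 2) ^ c * (2 * N + 3)

theorem exists_eval_eq_timeFactor (c : ℕ) :
    ∃ p : Polynomial ℕ, ∀ N, p.eval N = timeFactor c N := by
  open Polynomial in
  refine ⟨(2 * (40 * (X + 1) ^ 4) + 2) ^ c * (X + 2) + (40 * (X + 1) ^ 4 +
    8 * (40 * (X + 1) ^ 4) * ((C c + 1) * (X + 1)) ^ 3 + 2) ^ c * (2 * X + 3), fun N => ?_⟩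
  simp [timeFactor, dataBound]

/-- The number of states already uses up the factor tower(k, q+1), while their size contributes a
power of tower(k, q). This power is polynomial in |Φ| if tower(k, q) is small compared with `n`; in
the other case the tower is so large that exhaustive bounds are good enough. -/
theorem exists_runBound {Φ : PCNF n} {k q : ℕ} (hk : Φ.pathwidth = k) (hq : Φ.numBlocks = q)
    (c : ℕ) : ∃ (π : VarOrder n) (M W : ℕ), RunBound Φ π M W ∧
      (M + 2) ^ c * (1 + W) ≤ tower k (q + 1) * timeFactor c Φ.size := by
  have hn := (length_le_size Φ).2
  obtain ⟨π, hπ⟩ := exists_order Φ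
  rw [hk] at hπ
  have ht : tower k (q + 1) = 2 ^ tower k q := rfl
  refine ⟨π, ?_⟩
  -- The threshold makes 2^((c+1)n) at most tower(k, q+1) in the second case. There `c` factors 2^n
  -- pay for the size of the states and one for their number.
  rcases Nat.lt_or_ge (tower k q) ((c + 1) * n) with h | h
  · refine ⟨_, _, runBound_tower hπ hq, ?_⟩
    have h₁ : tower k q + 1 ≤ (c + 1) * (Φ.size + 1) := by
      have : (c + 1) * n ≤ (c + 1) * (Φ.size + 1) := Nat.mul_le_mul_left _ (by omega)
      omega
    have h₂ : (dataBound Φ.size + 8 * dataBound Φ.size * (tower k q + 1) ^ 3 + 2) ^ c ≤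
        (dataBound Φ.size + 8 * dataBound Φ.size * ((c + 1) * (Φ.size + 1)) ^ 3 + 2) ^ c := by
      gcongr
    have h₃ : 1 + (n + 1) * (2 * tower k (q + 1)) ≤ tower k (q + 1) * (2 * Φ.size + 3) := by
      have := tower_succ_pos k q
      nlinarith
    refine (Nat.mul_le_mul h₂ h₃).trans ?_
    rw [timeFactor, mul_left_comm]
    exact Nat.mul_le_mul_left _ (Nat.le_add_left _ _)
  · refine ⟨_, _, runBound_two_pow Φ π, ?_⟩
    have hp : 1 ≤ 2 ^ n := Nat.one_le_two_pow
    have h₁ : (dataBound Φ.size + 2 ^ n * dataBound Φ.size + 2) ^ c ≤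
        (2 ^ n * (2 * dataBound Φ.size + 2)) ^ c := Nat.pow_le_pow_left (by nlinarith) c
    have h₂ : 1 + (n + 1) * 2 ^ n ≤ 2 ^ n * (Φ.size + 2) := by nlinarith
    have h₃ : (2 ^ n) ^ c * 2 ^ n ≤ tower k (q + 1) := by
      rw [ht, ← pow_succ, ← pow_mul]
      exact Nat.pow_le_pow_right (by omega) (by rw [mul_comm]; exact h)
    calc _ ≤ _ := Nat.mul_le_mul h₁ h₂
      _ = ((2 ^ n) ^ c * 2 ^ n) * ((2 * dataBound Φ.size + 2) ^ c * (Φ.size + 2)) := by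
        rw [mul_pow]; ring
      _ ≤ _ := Nat.mul_le_mul h₃ (Nat.le_add_right _ _)

theorem solvesByQBDD_of_runs {P : Program} {Φ : PCNF n} {π : VarOrder n} {t T : ℕ}
    (h : P.Runs (Dat.cons (encPCNF Φ) (encVarOrder π)) (encTrace (qbddTrace Φ π)) t) (ht : t ≤ T) :
    SolvesByQBDD P Φ π T := by
  refine ⟨qbddTrace Φ π, t, isRun_qbddTrace Φ π, fun h => ?_, fun h => ?_, h, ht⟩
  · rw [← Φ.tail_zero_eq_true h]; exact result_qbddTrace Φ π
  · rw [← Φ.tail_zero_eq_false h]; exact result_qbddTrace Φ π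

/-! ### The main theorem -/

theorem mainTheorem2 :
    (∃ (P : Program) (p : Polynomial ℕ), ∀ (n : ℕ) (Φ : PCNF n),
      (∀ π : VarOrder n, ∃ T : ℕ, SolvesByQBDD P Φ π T) ∧
      (∀ k q : ℕ, Φ.pathwidth = k → Φ.numBlocks = q →
        ∃ π : VarOrder n, SolvesByQBDD P Φ π (tower k (q + 1) * p.eval Φ.size))) ∧
    (∃ p : Polynomial ℕ, ∀ (n : ℕ) (Φ : PCNF n) (k q : ℕ),
      Φ.IsFalse → Φ.pathwidth = k → Φ.numBlocks = q →
        ∃ (π : VarOrder n) (L : List (OBDD n)),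
          OBDDRefutation Φ π L ∧ derivationSize L ≤ tower k (q + 1) * p.eval Φ.size) := by
  constructor
  · obtain ⟨P, c, hP⟩ := exists_program
    obtain ⟨p, hp⟩ := exists_eval_eq_timeFactor c
    refine ⟨P, p, fun n Φ => ⟨fun π => ?_, fun k q hk hq => ?_⟩⟩
    · obtain ⟨t, -, ht⟩ := hP n Φ π _ _ (runBound_two_pow Φ π)
      exact ⟨t, solvesByQBDD_of_runs ht le_rfl⟩
    · obtain ⟨π, M, W, h, hle⟩ := exists_runBound hk hq c
      obtain ⟨t, ht, hr⟩ := hP n Φ π M W h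
      exact ⟨π, solvesByQBDD_of_runs hr (ht.trans (hle.trans_eq (by rw [hp])))⟩
  · refine ⟨(5 * Polynomial.X + 1) * (2 * Polynomial.X + 4), fun n Φ k q hfalse hk hq => ?_⟩
    obtain ⟨π, L, hL, hle⟩ := exists_refutation hfalse hk hq
    exact ⟨π, L, hL, hle.trans_eq (by simp)⟩
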